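/- Let $G$ be a compact connected simple Lie group with Lie algebra $\mathfrak g$, let $S\subset G$ be a torus and $K=C(S)$ its centralizer, so that $M=G/K$ is a generalized flag manifold, and let $T\supseteq S$ be a maximal torus of $G$. Let $\mathfrak h\subset\mathfrak k\subset\mathfrak g$ be the Lie algebras of $T$, $K$, $G$, let $\varphi$ be the Killing form of $\mathfrak g$, $(\cdot,\cdot)=-\varphi(\cdot,\cdot)$, and $\mathfrak m=\mathfrak k^{\perp}$. Let $R$ be the root system of $\mathfrak g^{\mathbb C}$ relative to $\mathfrak h^{\mathbb C}$ with root spaces $\mathfrak g_\alpha$, let $R_K$ be the set of roots $\alpha$ with $\mathfrak g_\alpha\subset\mathfrak k^{\mathbb C}$, and $R_M=R\setminus R_K$. Let $\mathfrak t=Z(\mathfrak k)\subset\mathfrak h$ and let $R_{\mathfrak t}=\{\alpha|_{\mathfrak t}:\alpha\in R_M\}$ be the set of $\mathfrak t$-roots. For $\xi\in R_{\mathfrak t}$ put $\mathfrak m_\xi=\sum_{\alpha\in R_M,\ \alpha|_{\mathfrak t}=\xi}\mathfrak g_\alpha$, and let $\tau$ be the conjugation of $\mathfrak g^{\mathbb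 C}$ with respect to $\mathfrak g$. Let $\mathfrak m=\mathfrak m_1\oplus\cdots\oplus\mathfrak m_s$ be a $(\cdot,\cdot)$-orthogonal decomposition into pairwise inequivalent irreducible $\mathrm{ad}(\mathfrak k)$-modules, and for $i,j,k\in\{1,\dots,s\}$ let $$c_{ij}^k=\sum_{a,b,c}\big(([e_a,e_b],e_c)\big)^2,$$ where $(e_a)$, $(e_b)$, $(e_c)$ run through $(\cdot,\cdot)$-orthonormal bases of $\mathfrak m_i$, $\mathfrak m_j$, $\mathfrak m_k$ respectively. A $\mathfrak t$-root $\xi$ is said to be associated to $\mathfrak m_i$ if $\mathfrak m_i=(\mathfrak m_\xi\oplus\mathfrak m_{-\xi})^\tau$; thus, with $\xi$, also $-\xi$ is associated to $\mathfrak m_i$. Then every $\mathfrak m_i$ has an associated $\mathfrak t$-root, and for all $i,j,k\in\{1,\dots,s\}$ we have $c_{ij}^k\neq 0$ if and only if there are $\mathfrak t$-roots $\xi_i,\xi_j,\xi_k$ associated to $\mathfrak m_i,\mathfrak m_j,\mathfrak m_k$ respectively (that is, for a suitable choice of their signs) such that $(\xi_i,\xi_j,\xi_k)$ is a symmetric $\mathfrak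 t$-triple, i.e. $\xi_i+\xi_j+\xi_k=0$. -/

import Mathlib

open scoped Manifold ContDiff TensorProduct

noncomputable section

namespace FlagManifold

/-- The Lie bracket on the tangent space at the identity of a smooth real Lie group is available. -/
instance instLEInftyMinSmoothness : ENat.LEInfty (minSmoothness ℝ 3) :=
  ⟨by rw [minSmoothness_of_isRCLikeNormedField]; exact ENat.LEInfty.out⟩

/-! ### Lie groups -/

section Group

variable {E : Type*} [NormedAddCommGroup E] [NormedSpace ℝ E] [FiniteDimensional ℝ E]
variable {G : Type*} [TopologicalSpace G] [ChartedSpace E G] [Group G]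

/-- A torus in a compact Lie group: a compact connected abelian subgroup. -/
structure IsTorus (S : Subgroup G) : Prop where
  isCompact : IsCompact (S : Set G)
  isConnected : IsConnected (S : Set G)
  comm : ∀ a ∈ S, ∀ b ∈ S, a * b = b * a

/-- A maximal torus: maximal for inclusion among the tori of `G`. -/
def IsMaximalTorus (T : Subgroup G) : Prop := Maximal IsTorus T

variable (E) in
/-- `exp (t X) ∈ K` for all real `t`. Here `t ↦ exp (t X)` is the integral curve `γ` through the
identity of the left-invariant vector field which is `X` at the identity. -/
def OneParameterIn (K : Subgroup G) (X : GroupLieAlgebra 𝓘(ℝ, E) G) : Prop :=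
  ∃ γ : ℝ → G, γ 0 = 1 ∧ IsMIntegralCurve (I := 𝓘(ℝ, E)) γ (mulInvariantVectorField X) ∧
    ∀ t, γ t ∈ K

variable (E) in
/-- The Lie algebra `{X | exp (t X) ∈ K for all t}` of a (closed) subgroup `K` of the Lie group `G`,
as a Lie subalgebra of the Lie algebra of `G`. (For a closed subgroup this set is already a Lie
subalgebra, so that taking the span only serves to bundle it.) -/
def lieAlgebraOf [LieGroup 𝓘(ℝ, E) ∞ G] (K : Subgroup G) :
    LieSubalgebra ℝ (GroupLieAlgebra 𝓘(ℝ, E) G) :=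
  LieSubalgebra.lieSpan ℝ _ {X | OneParameterIn E K X}

end Group

/-! ### Roots and `𝔱`-roots

In this section `𝔤` is the Lie algebra of `G`, `𝔨` that of `K` and `𝔥 ⊆ 𝔨` that of a maximal torus.
The complexification of `𝔤` is `ℂ ⊗[ℝ] 𝔤`; a complex linear form on `𝔥^ℂ` is given by its
restriction to `𝔥`, which is an arbitrary real linear map `𝔥 →ₗ[ℝ] ℂ`. -/

section Algebra

variable {𝔤 : Type*} [LieRing 𝔤] [LieAlgebra ℝ 𝔤]

/-- The root space `𝔤_α = {Z ∈ 𝔤^ℂ | [X, Z] = α(X) Z for all X ∈ 𝔥}`. -/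
def rootSpace (𝔥 : LieSubalgebra ℝ 𝔤) (α : 𝔥 →ₗ[ℝ] ℂ) : Submodule ℂ (ℂ ⊗[ℝ] 𝔤) :=
  ⨅ X : 𝔥, Module.End.eigenspace
    (LieAlgebra.ad ℂ (ℂ ⊗[ℝ] 𝔤) ((1 : ℂ) ⊗ₜ[ℝ] (X : 𝔤))) (α X)

/-- The root system `R` of `𝔤^ℂ` relative to `𝔥^ℂ`. -/
def roots (𝔥 : LieSubalgebra ℝ 𝔤) : Set (𝔥 →ₗ[ℝ] ℂ) :=
  {α | α ≠ 0 ∧ rootSpace 𝔥 α ≠ ⊥}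

/-- The roots `R_K`, i.e. those whose root space lies in `𝔨^ℂ`. -/
def isotropyRoots (𝔨 𝔥 : LieSubalgebra ℝ 𝔤) : Set (𝔥 →ₗ[ℝ] ℂ) :=
  {α ∈ roots 𝔥 | rootSpace 𝔥 α ≤ 𝔨.toSubmodule.baseChange ℂ}

/-- The complementary roots `R_M = R \ R_K`. -/
def complementaryRoots (𝔨 𝔥 : LieSubalgebra ℝ 𝔤) : Set (𝔥 →ₗ[ℝ] ℂ) :=
  roots 𝔥 \ isotropyRoots 𝔨 𝔥

/-- The centre `𝔱 = Z(𝔨)`, viewed inside `𝔥`. (`Z(𝔨) ⊆ 𝔥`, since `𝔥 ⊆ 𝔨` is maximal abelian.) -/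
def centre (𝔨 𝔥 : LieSubalgebra ℝ 𝔤) : Submodule ℝ 𝔥 :=
  ((LieAlgebra.center ℝ 𝔨).toSubmodule.map 𝔨.toSubmodule.subtype).comap 𝔥.toSubmodule.subtype

/-- The restriction map `κ : 𝔥^* → 𝔱^*`. -/
def kappa (𝔨 𝔥 : LieSubalgebra ℝ 𝔤) (α : 𝔥 →ₗ[ℝ] ℂ) : centre 𝔨 𝔥 →ₗ[ℝ] ℂ :=
  α.domRestrict (centre 𝔨 𝔥)

/-- The set `R_𝔱 = κ(R_M)` of `𝔱`-roots. -/
def tRoots (𝔨 𝔥 : LieSubalgebra ℝ 𝔤) : Set (centre 𝔨 𝔥 →ₗ[ℝ] ℂ) :=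
  kappa 𝔨 𝔥 '' complementaryRoots 𝔨 𝔥

/-- A symmetric `𝔱`-triple: three `𝔱`-roots with sum zero. -/
def IsSymmetricTTriple (𝔨 𝔥 : LieSubalgebra ℝ 𝔤) (ξ η ζ : centre 𝔨 𝔥 →ₗ[ℝ] ℂ) : Prop :=
  ξ ∈ tRoots 𝔨 𝔥 ∧ η ∈ tRoots 𝔨 𝔥 ∧ ζ ∈ tRoots 𝔨 𝔥 ∧ ξ + η + ζ = 0

/-- The complex module `𝔪_ξ`, the sum of the root spaces `𝔤_α` over `α ∈ R_M` with `κ(α) = ξ`. -/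
def tRootModule (𝔨 𝔥 : LieSubalgebra ℝ 𝔤) (ξ : centre 𝔨 𝔥 →ₗ[ℝ] ℂ) :
    Submodule ℂ (ℂ ⊗[ℝ] 𝔤) :=
  ⨆ α ∈ {α ∈ complementaryRoots 𝔨 𝔥 | kappa 𝔨 𝔥 α = ξ}, rootSpace 𝔥 α

/-- `𝔫^τ = 𝔫 ∩ 𝔤`: the fixed points in `𝔫 ⊆ 𝔤^ℂ` of the conjugation `τ` of `𝔤^ℂ` with respect
to `𝔤`, as a subspace of `𝔤`. -/
def realPoints (𝔫 : Submodule ℂ (ℂ ⊗[ℝ] 𝔤)) : Submodule ℝ 𝔤 :=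
  (𝔫.restrictScalars ℝ).comap (TensorProduct.mk ℝ ℂ 𝔤 1)

/-- `ξ` is a `𝔱`-root associated to the submodule `V` of `𝔪`: `V = (𝔪_ξ ⊕ 𝔪_{-ξ})^τ`. -/
def IsAssociatedTRoot (𝔨 𝔥 : LieSubalgebra ℝ 𝔤) (V : LieSubmodule ℝ 𝔨 𝔤)
    (ξ : centre 𝔨 𝔥 →ₗ[ℝ] ℂ) : Prop :=
  ξ ∈ tRoots 𝔨 𝔥 ∧
    V.toSubmodule = realPoints (tRootModule 𝔨 𝔥 ξ ⊔ tRootModule 𝔨 𝔥 (-ξ))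

/-! ### Isotropy decompositions and structure constants -/

/-- The invariant form `(X, Y) = -φ(X, Y)`, where `φ` is the Killing form of `𝔤`. -/
def form (X Y : 𝔤) : ℝ := -killingForm ℝ 𝔤 X Y

/-- The complement `𝔪 = 𝔨^⊥` with respect to `(·, ·)`. -/
def isotropyModule (𝔨 : LieSubalgebra ℝ 𝔤) : Submodule ℝ 𝔤 where
  carrier := {Y | ∀ X ∈ 𝔨, form X Y = 0}
  zero_mem' := fun X _ => by simp [form]
  add_mem' := fun {Y Z} hY hZ X hX => by
    have h1 := hY X hX
    have h2 := hZ X hX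
    simp only [form, map_add] at *
    linarith
  smul_mem' := fun c Y hY X hX => by
    have h1 := hY X hX
    simp only [form, map_smul, smul_eq_mul] at *
    linear_combination c * h1

/-- `𝔪 = 𝔪_1 ⊕ ⋯ ⊕ 𝔪_s` is a `(·, ·)`-orthogonal decomposition of `𝔪` into pairwise inequivalent
irreducible `ad(𝔨)`-modules. -/
structure IsIsotropyDecomposition (𝔨 : LieSubalgebra ℝ 𝔤) {s : ℕ}
    (m : Fin s → LieSubmodule ℝ 𝔨 𝔤) : Prop where
  sum_eq : ⨆ i, (m i).toSubmodule = isotropyModule 𝔨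
  orthogonal : ∀ i j, i ≠ j → ∀ X ∈ m i, ∀ Y ∈ m j, form X Y = 0
  irreducible : ∀ i, LieModule.IsIrreducible ℝ 𝔨 (m i)
  inequivalent : ∀ i j, i ≠ j → IsEmpty (m i ≃ₗ⁅ℝ,𝔨⁆ m j)

/-- `e` is a `(·, ·)`-orthonormal basis of the subspace `V`. -/
structure IsOrthonormalBasis {d : ℕ} (e : Fin d → 𝔤) (V : Submodule ℝ 𝔤) : Prop where
  orthonormal : ∀ a b, form (e a) (e b) = if a = b then 1 else 0
  span_eq : Submodule.span ℝ (Set.range e) = V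

/-- The structure constant `c_{ij}^k = ∑ ([e_a, e_b], e_c)²`, the sum being over the chosen
orthonormal bases of `𝔪_i`, `𝔪_j`, `𝔪_k`. -/
def structureConstant {s : ℕ} {d : Fin s → ℕ} (e : ∀ i, Fin (d i) → 𝔤) (i j k : Fin s) : ℝ :=
  ∑ a, ∑ b, ∑ c, (form ⁅e i a, e j b⁆ (e k c)) ^ 2

end Algebra

end FlagManifold

end

/-!
The argument takes place over `ℝ`, in the Lie algebra `𝔤` of `G` with the inner product `-φ`; the
classification of root systems is not used.

From the group only the following is needed (`isFlagPair_lieAlgebraOf`): `-φ` is positive definite,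
`𝔥` is maximal abelian, and `𝔨` is the centralizer of its own centre `𝔱`. The first follows by
averaging an inner product over `G` with respect to Haar measure. For the other two, let `S` be a
torus. The Lie algebra of the compact connected abelian group `Ad S` consists of derivations of
`𝔤`, hence of operators `ad Z`, where `Z` lies in the centre of the fixed algebra `𝔤^S`; and a
vector annihilated by the Lie algebra of `Ad S` is fixed by `Ad S`, because near the identity a
compact abelian group of operators consists of exponentials of its Lie algebra
(`apply_mul_eq_of_forall_imageLieAlgebra`). Here `𝔤^S` is the Lie algebra of `C(S)`, and `𝔤^T` that
of `T`.

A *weight module* (`IsWeightModule`) is an `ad(𝔨)`-submodule `V` of `𝔤` on which some `Z₀ ∈ 𝔱` acts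
as a complex structure `J` and every `Z ∈ 𝔱` as `l(Z) J` with a real linear form `l`. Since
`ad Z ad Z'` is symmetric and commutes with `𝔨`, Schur's lemma shows that each `𝔪_i` is a weight
module (`exists_isWeightModule`). The sum `∑ [x_a, J x_a]` over an orthonormal basis of `V` lies in
`𝔱` and represents `dim V • l` (`IsWeightModule.exists_moment`). By the Jacobi identity,

  `([x, J x], [y, J y]) = ([x, y], [J x, J y]) - ([J x, y], [x, J y])`,

so that two weight modules with `[x, y] = [J x, J y]` throughout have dual vectors with nonnegative
product (`IsWeightModule.bilinForm_dual_nonneg`). This inequality is used twice.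

* A nonzero weight module is the full weight space for `l`: on the orthogonal complement of `V` in
  it, the identity `[x, y] = [J x, J y]` holds for the complex structure `-J`, and the dual vectors
  `H` and `-H` would have nonnegative product (`IsWeightModule.eq_weightSpace`).
* If `l₁ + l₂ + l₃ = 0` and `([V₁, V₂], V₃) = 0`, then `[x, y] - [J x, J y]` lies in the weight
  space `V₃` and is orthogonal to it, so it vanishes; the same holds with `V₂` and `V₃` exchanged.
  The dual vectors would then satisfy `(H₁, H₁) = -(H₁, H₂) - (H₁, H₃) ≤ 0`, although `H₁ ≠ 0`
  (`IsWeightModule.exists_bilinForm_lie_ne_zero`).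

Conversely, invariance of `([x, y], z)` under `𝔱` forces a signed sum of the three linear forms to
vanish if the trilinear form does not (`IsWeightModule.exists_sign_add_eq_zero`).

Finally, simultaneous diagonalization of `ad 𝔥` on `𝔤^ℂ` identifies `𝔪_ξ` with the weight space of
`𝔱` for `ξ` (`tRootModule_eq_complexWeightSpace`), and the `𝔱`-roots associated to a weight module
with linear form `l` are `± i l`.
-/

namespace FlagManifold

/-! ### Compact connected abelian groups in a finite-dimensional algebra -/

section TorusRepresentation

open Filter Topology NormedSpace

variable {A : Type*} [NormedRing A] [NormedAlgebra ℝ A] [CompleteSpace A]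

/-- If `exp (w n)` stays in a closed submonoid `Γ` of a Banach algebra along a sequence of
nonzero vectors `w n → 0` whose directions converge to `u`, then `exp (t u) ∈ Γ` for `t ≥ 0`. -/
lemma exp_smul_mem_of_tendsto_direction (Γ : Submonoid A) (hΓ : IsClosed (Γ : Set A))
    {w : ℕ → A} (hw0 : ∀ n, w n ≠ 0) (hw : Tendsto w atTop (𝓝 0))
    (hexp : ∀ n, exp (w n) ∈ Γ) {u : A}
    (hu : Tendsto (fun n => ‖w n‖⁻¹ • w n) atTop (𝓝 u)) {t : ℝ} (ht : 0 ≤ t) :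
    exp (t • u) ∈ Γ := by
  let _ : NormedAlgebra ℚ A := NormedAlgebra.restrictScalars ℚ ℝ A
  -- approximate `t • u` by the multiples `⌊t / ‖w n‖⌋₊ • w n`
  have hpos : ∀ n, 0 < ‖w n‖ := fun n => norm_pos_iff.2 (hw0 n)
  have hnorm : Tendsto (fun n => ‖w n‖) atTop (𝓝 0) := by simpa using hw.norm
  have hk : Tendsto (fun n => (⌊t / ‖w n‖⌋₊ : ℝ) * ‖w n‖) atTop (𝓝 t) := by
    have h1 : Tendsto (fun n => t - ‖w n‖) atTop (𝓝 t) := by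
      simpa using tendsto_const_nhds.sub hnorm
    refine tendsto_of_tendsto_of_tendsto_of_le_of_le h1 tendsto_const_nhds ?_ ?_
    · intro n
      have h2 := Nat.lt_floor_add_one (t / ‖w n‖)
      rw [div_lt_iff₀ (hpos n)] at h2
      simp only
      linarith
    · intro n
      have h2 := Nat.floor_le (div_nonneg ht (hpos n).le)
      rwa [le_div_iff₀ (hpos n)] at h2
  have hlim : Tendsto (fun n => exp (⌊t / ‖w n‖⌋₊ • w n)) atTop (𝓝 (exp (t • u))) := by
    have h3 := hk.smul hu
    refine Tendsto.exp (h3.congr fun n => ?_)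
    rw [smul_smul, mul_assoc, mul_inv_cancel₀ (hpos n).ne', mul_one, Nat.cast_smul_eq_nsmul]
  refine hΓ.mem_of_tendsto hlim (Eventually.of_forall fun n => ?_)
  rw [exp_nsmul]
  exact Γ.pow_mem (hexp n) _

/-- An element of a Banach algebra which commutes with a one-parameter group commutes with its
generator. -/
lemma commute_of_commute_exp_smul {a D : A} (h : ∀ t : ℝ, Commute a (exp (t • D))) :
    Commute a D := by
  have h1 : HasDerivAt (fun t : ℝ => exp (t • D)) D 0 := by
    simpa using hasDerivAt_exp_smul_const (𝕂 := ℝ) D (0 : ℝ)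
  have h2 := h1.const_mul a
  have h3 := h1.mul_const a
  have h4 : (fun t : ℝ => a * exp (t • D)) = fun t : ℝ => exp (t • D) * a :=
    funext fun t => h t
  rw [h4] at h2
  exact h2.unique h3

variable {S : Type*} [Group S]

/-- The Lie algebra of the image of a representation `ρ` of an abelian group `S` in a Banach
algebra: the space of generators of one-parameter groups contained in the image. -/
def imageLieAlgebra (hS : ∀ a b : S, a * b = b * a) (ρ : S →* A) : Submodule ℝ A where
  carrier := {D | ∀ t : ℝ, ∃ s, exp (t • D) = ρ s}
  zero_mem' t := ⟨1, by simp⟩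
  add_mem' {D D'} hD hD' t := by
    let _ : NormedAlgebra ℚ A := NormedAlgebra.restrictScalars ℚ ℝ A
    have hcomm : ∀ s, Commute (ρ s) D := fun s => commute_of_commute_exp_smul fun r => by
      obtain ⟨s', hs'⟩ := hD r
      rw [hs', Commute, SemiconjBy, ← map_mul, hS, map_mul]
    have hDD : Commute D D' := commute_of_commute_exp_smul fun r => by
      obtain ⟨s', hs'⟩ := hD' r
      rw [hs']
      exact (hcomm s').symm
    obtain ⟨s, hs⟩ := hD t
    obtain ⟨s', hs'⟩ := hD' t
    refine ⟨s * s', ?_⟩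
    rw [smul_add, exp_add_of_commute ((hDD.smul_left t).smul_right t), hs, hs', map_mul]
  smul_mem' c D hD t := by
    obtain ⟨s, hs⟩ := hD (t * c)
    exact ⟨s, by rw [smul_smul, hs]⟩

variable {hS : ∀ a b : S, a * b = b * a}

lemma commute_of_mem_imageLieAlgebra {ρ : S →* A} {D : A} (hD : D ∈ imageLieAlgebra hS ρ) (s : S) :
    Commute (ρ s) D :=
  commute_of_commute_exp_smul fun r => by
    obtain ⟨s', hs'⟩ := hD r
    rw [hs', Commute, SemiconjBy, ← map_mul, hS, map_mul]

variable [TopologicalSpace S] [FiniteDimensional ℝ A]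

/-- Transversally to its Lie algebra, the image of a compact abelian group is discrete at `1`. -/
lemma eventually_eq_zero_of_exp_mem_range [CompactSpace S] {ρ : S →* A} (hρ : Continuous ρ)
    (W : Submodule ℝ A) (hW : Disjoint (imageLieAlgebra hS ρ) W) :
    ∀ᶠ w in 𝓝 (0 : A), w ∈ W → (∃ s, exp w = ρ s) → w = 0 := by
  let _ : NormedAlgebra ℚ A := NormedAlgebra.restrictScalars ℚ ℝ A
  by_contra hcon
  rw [Filter.not_eventually] at hcon
  have hfreq : ∃ᶠ w in 𝓝 (0 : A), w ∈ W ∧ (∃ s, exp w = ρ s) ∧ w ≠ 0 :=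
    hcon.mono fun w hw => by
      push Not at hw
      exact ⟨hw.1, hw.2.1, hw.2.2⟩
  obtain ⟨w, hw0, hw⟩ := Filter.exists_seq_forall_of_frequently hfreq
  have hunit : ∀ n, ‖w n‖⁻¹ • w n ∈ Metric.sphere (0 : A) 1 := fun n => by
    rw [mem_sphere_zero_iff_norm, norm_smul, norm_inv, norm_norm,
      inv_mul_cancel₀ (norm_ne_zero_iff.2 (hw n).2.2)]
  have : ProperSpace A := FiniteDimensional.proper_real A
  obtain ⟨u, hu1, ψ, hψ, hu⟩ := (isCompact_sphere (0 : A) 1).tendsto_subseq hunit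
  have hclosed : IsClosed ((MonoidHom.mrange ρ : Submonoid A) : Set A) := by
    rw [MonoidHom.coe_mrange]
    exact (isCompact_range hρ).isClosed
  have hray : ∀ t : ℝ, 0 ≤ t → ∃ s, exp (t • u) = ρ s := fun t ht => by
    obtain ⟨s, hs⟩ := exp_smul_mem_of_tendsto_direction (MonoidHom.mrange ρ) hclosed
      (w := w ∘ ψ) (fun n => (hw _).2.2) (hw0.comp hψ.tendsto_atTop)
      (fun n => by
        obtain ⟨s, hs⟩ := (hw (ψ n)).2.1
        exact ⟨s, hs.symm⟩) hu ht
    exact ⟨s, hs.symm⟩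
  have huL : u ∈ imageLieAlgebra hS ρ := by
    intro t
    rcases le_total 0 t with ht | ht
    · exact hray t ht
    · obtain ⟨s, hs⟩ := hray (-t) (neg_nonneg.2 ht)
      refine ⟨s⁻¹, ?_⟩
      have h1 : exp (t • u) * exp (-t • u) = 1 := by
        rw [← exp_add_of_commute (((Commute.refl u).smul_left t).smul_right (-t)), ← add_smul]
        simp
      calc exp (t • u) = exp (t • u) * (ρ s * ρ s⁻¹) := by rw [← map_mul]; simp
        _ = ρ s⁻¹ := by rw [← mul_assoc, ← hs, h1, one_mul]
  have huW : u ∈ W := by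
    refine W.closed_of_finiteDimensional.mem_of_tendsto hu (Eventually.of_forall fun n => ?_)
    exact W.smul_mem _ (hw _).1
  have hu0 : u = 0 := Submodule.disjoint_def.1 hW u huL huW
  rw [hu0] at hu1
  simp at hu1

/-- Near `1`, a compact abelian group of invertible elements of a finite-dimensional algebra
consists of exponentials of elements of its Lie algebra. -/
lemma eventually_exists_eq_exp [CompactSpace S] {ρ : S →* A} (hρ : Continuous ρ) :
    ∀ᶠ a in 𝓝 (1 : A), (∃ s, a = ρ s) → ∃ D ∈ imageLieAlgebra hS ρ, a = exp D := by
  let _ : NormedAlgebra ℚ A := NormedAlgebra.restrictScalars ℚ ℝ A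
  obtain ⟨W, hW⟩ := (imageLieAlgebra hS ρ).exists_isCompl
  let P : A →L[ℝ] A := LinearMap.toContinuousLinearMap (Submodule.projection _ _ hW)
  have hPmem : ∀ v, P v ∈ imageLieAlgebra hS ρ := fun v =>
    Submodule.projection_apply_mem hW v
  have hQmem : ∀ v, v - P v ∈ W := fun v => by
    have h := Submodule.projection_add_projection_eq_self hW v
    have h2 := Submodule.projection_apply_mem hW.symm v
    have h3 : v - P v = Submodule.projection _ _ hW.symm v := sub_eq_of_eq_add' h.symm
    rw [h3]
    exact h2
  -- the map `v ↦ exp (P v) * exp (v - P v)` is a local diffeomorphism at `0`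
  have hder : HasStrictFDerivAt (fun v => exp (P v) * exp (v - P v))
      ((ContinuousLinearEquiv.refl ℝ A : A ≃L[ℝ] A) : A →L[ℝ] A) 0 := by
    have h0 : HasStrictFDerivAt (exp : A → A) (1 : A →L[ℝ] A) (P 0) := by
      rw [map_zero]; exact hasStrictFDerivAt_exp_zero
    have h0' : HasStrictFDerivAt (exp : A → A) (1 : A →L[ℝ] A) ((0 : A) - P 0) := by
      rw [map_zero, sub_zero]; exact hasStrictFDerivAt_exp_zero
    have h1 := h0.comp (0 : A) P.hasStrictFDerivAt
    have h2 := h0'.comp (0 : A) ((hasStrictFDerivAt_id (𝕜 := ℝ) (0 : A)).sub P.hasStrictFDerivAt)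
    refine (h1.mul' h2).congr_fderiv ?_
    ext v
    simp
  have hmap := hder.map_nhds_eq_of_equiv
  simp only [map_zero, sub_zero, exp_zero, mul_one] at hmap
  rw [← hmap, Filter.eventually_map]
  have hQ : Tendsto (fun v => v - P v) (𝓝 0) (𝓝 0) := by
    have : Continuous fun v => v - P v := by fun_prop
    simpa using this.tendsto 0
  filter_upwards [hQ.eventually (eventually_eq_zero_of_exp_mem_range hρ W hW.disjoint)]
    with v hv
  rintro ⟨s, hs⟩
  have hz : v - P v = 0 := by
    refine hv (hQmem v) ?_
    obtain ⟨s', hs'⟩ := hPmem v 1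
    rw [one_smul] at hs'
    refine ⟨s'⁻¹ * s, ?_⟩
    rw [map_mul, ← hs, ← mul_assoc, hs', ← map_mul]
    simp
  exact ⟨P v, hPmem v, by rw [hz, exp_zero, mul_one]⟩

/-- A linear function on a Banach algebra which is invariant under right multiplication by the
image of a compact connected abelian group infinitesimally is invariant. -/
theorem apply_mul_eq_of_forall_imageLieAlgebra {V : Type*} [NormedAddCommGroup V]
    [NormedSpace ℝ V] [IsTopologicalGroup S] [CompactSpace S] [ConnectedSpace S]
    {ρ : S →* A} (hρ : Continuous ρ) (f : A →L[ℝ] V)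
    (hf : ∀ D ∈ imageLieAlgebra hS ρ, ∀ a, f (a * D) = 0) (s : S) (a : A) :
    f (a * ρ s) = f a := by
  have hexp : ∀ D ∈ imageLieAlgebra hS ρ, ∀ a, f (a * exp D) = f a := by
    intro D hD a
    have hd : ∀ t : ℝ, HasDerivAt (fun t : ℝ => f (a * exp (t • D))) 0 t := fun t => by
      have h1 := (hasDerivAt_exp_smul_const (𝕂 := ℝ) D t).const_mul a
      have h2 := f.hasFDerivAt.comp_hasDerivAt t h1
      rwa [← mul_assoc, hf D hD] at h2
    have h3 := is_const_of_deriv_eq_zero (fun t => (hd t).differentiableAt)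
      (fun t => (hd t).deriv) 1 0
    simpa using h3
  let F : Subgroup S :=
    { carrier := {s | ∀ a, f (a * ρ s) = f a}
      one_mem' := fun a => by simp
      mul_mem' := fun {x y} hx hy a => by rw [ρ.map_mul, ← mul_assoc, hy, hx]
      inv_mem' := fun {x} hx a => by
        have h := hx (a * ρ x⁻¹)
        rw [mul_assoc, ← map_mul] at h
        simpa using h.symm }
  have hF : (F : Set S) ∈ 𝓝 (1 : S) := by
    have h1 : Tendsto ρ (𝓝 1) (𝓝 1) := by simpa using hρ.tendsto 1
    filter_upwards [h1.eventually (eventually_exists_eq_exp (hS := hS) hρ)] with s hs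
    obtain ⟨D, hD, h⟩ := hs ⟨s, rfl⟩
    intro a
    rw [h, hexp D hD]
  have hopen : IsOpen (F : Set S) := Subgroup.isOpen_of_mem_nhds F hF
  have huniv : (F : Set S) = Set.univ :=
    IsClopen.eq_univ ⟨Subgroup.isClosed_of_isOpen F hopen, hopen⟩ ⟨1, F.one_mem⟩
  have hs : s ∈ (F : Set S) := huniv ▸ Set.mem_univ s
  exact hs a

end TorusRepresentation

/-! ### Local groups and the adjoint action in a chart -/

section LocalGroup

open Filter Topology VectorField

variable {E : Type*} [NormedAddCommGroup E] [NormedSpace ℝ E]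

/-- The derivative of the adjoint representation in local coordinates. Here `μ` is the
multiplication of a local group with neutral element `o`, `c` is the conjugation
`c (x, y) = x y x⁻¹`, the linear map `Y ↦ fderiv ℝ c (x, o) (0, Y)` is the adjoint action of `x`,
and `x ↦ fderiv ℝ μ (x, o) (0, Y)` is the left-invariant vector field with value `Y` at `o`. -/
lemma hasFDerivAt_conj_of_local_group {μ c : E × E → E} {o : E}
    (hμ : ContDiffAt ℝ 2 μ (o, o)) (hc : ContDiffAt ℝ 2 c (o, o))
    (hμl : ∀ᶠ y in 𝓝 o, μ (o, y) = y) (hμr : ∀ᶠ x in 𝓝 o, μ (x, o) = x)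
    (hc1 : ∀ᶠ x in 𝓝 o, c (x, o) = o) (hc2 : ∀ᶠ y in 𝓝 o, c (o, y) = y)
    (hmul : ∀ᶠ p in 𝓝 (o, o), μ (c p, p.1) = μ p) (Y : E) :
    ∃ L : E →L[ℝ] E, HasFDerivAt (fun x => fderiv ℝ c (x, o) (0, Y)) L o ∧
      ∀ X, L X = lieBracket ℝ (fun x => fderiv ℝ μ (x, o) (0, X))
        (fun x => fderiv ℝ μ (x, o) (0, Y)) o := by
  have hdμ : DifferentiableAt ℝ (fderiv ℝ μ) (o, o) :=
    (hμ.fderiv_right (m := 1) (by norm_num)).differentiableAt (by norm_num)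
  have hdc : DifferentiableAt ℝ (fderiv ℝ c) (o, o) :=
    (hc.fderiv_right (m := 1) (by norm_num)).differentiableAt (by norm_num)
  have hsymm : IsSymmSndFDerivAt ℝ μ (o, o) := hμ.isSymmSndFDerivAt (by simp)
  set H := fderiv ℝ (fderiv ℝ μ) (o, o) with hH
  have hleft : HasFDerivAt (fun x : E => (x, o)) (ContinuousLinearMap.inl ℝ E E) o :=
    hasFDerivAt_prodMk_left o o
  have hright : HasFDerivAt (fun x : E => (o, x)) (ContinuousLinearMap.inr ℝ E E) o :=
    hasFDerivAt_prodMk_right o o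
  -- the left-invariant vector fields
  have hW : ∀ Z : E, HasFDerivAt (fun x => fderiv ℝ μ (x, o) (0, Z))
      ((ContinuousLinearMap.apply ℝ E ((0 : E), Z)).comp (H.comp (ContinuousLinearMap.inl ℝ E E)))
      o := fun Z => by
    have h1 : HasFDerivAt (fun x => fderiv ℝ μ (x, o))
        (H.comp (ContinuousLinearMap.inl ℝ E E)) o :=
      HasFDerivAt.comp (f := fun x : E => (x, o)) (g := fderiv ℝ μ) o hdμ.hasFDerivAt hleft
    exact (ContinuousLinearMap.apply ℝ E ((0 : E), Z)).hasFDerivAt.comp o h1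
  have hμd : DifferentiableAt ℝ μ (o, o) := hμ.differentiableAt (by norm_num)
  have hcd : DifferentiableAt ℝ c (o, o) := hc.differentiableAt (by norm_num)
  have hμ2 : ∀ Z, fderiv ℝ μ (o, o) (0, Z) = Z := fun Z => by
    have h1 : HasFDerivAt (fun y => μ (o, y)) _ o :=
      HasFDerivAt.comp (f := fun x : E => (o, x)) (g := μ) o hμd.hasFDerivAt hright
    have h2 : HasFDerivAt (fun y => μ (o, y)) (ContinuousLinearMap.id ℝ E) o :=
      (hasFDerivAt_id o).congr_of_eventuallyEq hμl
    simpa using DFunLike.congr_fun (h1.unique h2) Z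
  have hμ1 : ∀ Z, fderiv ℝ μ (o, o) (Z, 0) = Z := fun Z => by
    have h1 : HasFDerivAt (fun y => μ (y, o)) _ o :=
      HasFDerivAt.comp (f := fun x : E => (x, o)) (g := μ) o hμd.hasFDerivAt hleft
    have h2 : HasFDerivAt (fun y => μ (y, o)) (ContinuousLinearMap.id ℝ E) o :=
      (hasFDerivAt_id o).congr_of_eventuallyEq hμr
    simpa using DFunLike.congr_fun (h1.unique h2) Z
  have hc2' : fderiv ℝ c (o, o) (0, Y) = Y := by
    have h1 : HasFDerivAt (fun y => c (o, y)) _ o :=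
      HasFDerivAt.comp (f := fun x : E => (o, x)) (g := c) o hcd.hasFDerivAt hright
    have h2 : HasFDerivAt (fun y => c (o, y)) (ContinuousLinearMap.id ℝ E) o :=
      (hasFDerivAt_id o).congr_of_eventuallyEq hc2
    simpa using DFunLike.congr_fun (h1.unique h2) Y
  have ha : HasFDerivAt (fun x => fderiv ℝ c (x, o) (0, Y))
      ((ContinuousLinearMap.apply ℝ E ((0 : E), Y)).comp
        ((fderiv ℝ (fderiv ℝ c) (o, o)).comp (ContinuousLinearMap.inl ℝ E E))) o := by
    have h1 : HasFDerivAt (fun x => fderiv ℝ c (x, o))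
        ((fderiv ℝ (fderiv ℝ c) (o, o)).comp (ContinuousLinearMap.inl ℝ E E)) o :=
      HasFDerivAt.comp (f := fun x : E => (x, o)) (g := fderiv ℝ c) o hdc.hasFDerivAt hleft
    exact (ContinuousLinearMap.apply ℝ E ((0 : E), Y)).hasFDerivAt.comp o h1
  refine ⟨_, ha, fun X => ?_⟩
  set a : E → E := fun x => fderiv ℝ c (x, o) (0, Y) with hadef
  set L := (ContinuousLinearMap.apply ℝ E ((0 : E), Y)).comp
        ((fderiv ℝ (fderiv ℝ c) (o, o)).comp (ContinuousLinearMap.inl ℝ E E))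
  -- differentiate `c (x, y) x = x y` with respect to `y` at `o`
  have hkey : ∀ᶠ x in 𝓝 o, fderiv ℝ μ (o, x) (a x, 0) = fderiv ℝ μ (x, o) (0, Y) := by
    have hμev : ∀ᶠ p in 𝓝 (o, o), DifferentiableAt ℝ μ p :=
      (hμ.eventually (by simp)).mono fun p hp => hp.differentiableAt (by norm_num)
    have hcev : ∀ᶠ p in 𝓝 (o, o), DifferentiableAt ℝ c p :=
      (hc.eventually (by simp)).mono fun p hp => hp.differentiableAt (by norm_num)
    have hL : Tendsto (fun x : E => (x, o)) (𝓝 o) (𝓝 (o, o)) := hleft.continuousAt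
    have hR : Tendsto (fun x : E => (o, x)) (𝓝 o) (𝓝 (o, o)) := hright.continuousAt
    filter_upwards [hL.eventually hμev, hR.eventually hμev, hL.eventually hcev,
      hL.eventually hmul.eventually_nhds, hc1] with x h1 h2 h3 h4 h5
    have hin : HasFDerivAt (fun y : E => (x, y)) (ContinuousLinearMap.inr ℝ E E) o :=
      hasFDerivAt_prodMk_right x o
    have hrhs : HasFDerivAt (fun y => μ (x, y)) _ o :=
      HasFDerivAt.comp (f := fun y : E => (x, y)) (g := μ) o h1.hasFDerivAt hin
    have hcx : HasFDerivAt (fun y => c (x, y)) _ o :=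
      HasFDerivAt.comp (f := fun y : E => (x, y)) (g := c) o h3.hasFDerivAt hin
    have hpair := hcx.prodMk (hasFDerivAt_const x o)
    have h2' : HasFDerivAt μ (fderiv ℝ μ (o, x)) (c (x, o), x) := by
      rw [h5]; exact h2.hasFDerivAt
    have hlhs : HasFDerivAt (fun y => μ (c (x, y), x)) _ o :=
      HasFDerivAt.comp (f := fun y : E => (c (x, y), x)) (g := μ) o h2' hpair
    have heq : (fun y => μ (c (x, y), x)) =ᶠ[𝓝 o] fun y => μ (x, y) := by
      have ht : Tendsto (fun y : E => (x, y)) (𝓝 o) (𝓝 (x, o)) := hin.continuousAt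
      exact ht.eventually h4
    have h6 := DFunLike.congr_fun ((hlhs.congr_of_eventuallyEq heq.symm).unique hrhs) Y
    simpa using h6
  -- differentiate the resulting identity with respect to `x` at `o`
  have hder : HasFDerivAt (fun x => fderiv ℝ μ (o, x) (a x, 0))
      ((fderiv ℝ μ (o, o)).comp ((ContinuousLinearMap.inl ℝ E E).comp L) +
        ((H.comp (ContinuousLinearMap.inr ℝ E E)).flip (a o, 0))) o := by
    have h1 : HasFDerivAt (fun x => fderiv ℝ μ (o, x))
        (H.comp (ContinuousLinearMap.inr ℝ E E)) o :=
      HasFDerivAt.comp (f := fun x : E => (o, x)) (g := fderiv ℝ μ) o hdμ.hasFDerivAt hright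
    have h2 : HasFDerivAt (fun x => (a x, (0 : E))) ((ContinuousLinearMap.inl ℝ E E).comp L) o :=
      (ContinuousLinearMap.inl ℝ E E).hasFDerivAt.comp o ha
    exact h1.clm_apply h2
  have h7 := DFunLike.congr_fun ((hder.congr_of_eventuallyEq
    (EventuallyEq.symm hkey)).unique (hW Y)) X
  have hao : a o = Y := hc2'
  simp only [hao, add_apply, ContinuousLinearMap.comp_apply,
    ContinuousLinearMap.flip_apply, ContinuousLinearMap.inl_apply, ContinuousLinearMap.inr_apply,
    ContinuousLinearMap.apply_apply, hμ1] at h7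
  rw [lieBracket_eq]
  simp only [(hW X).fderiv, (hW Y).fderiv, hμ2, ContinuousLinearMap.comp_apply,
    ContinuousLinearMap.inl_apply, ContinuousLinearMap.apply_apply]
  rw [← h7, hsymm.eq (0, X) (Y, 0)]
  abel

end LocalGroup

section Group

open Filter Topology VectorField

variable {E : Type*} [NormedAddCommGroup E] [NormedSpace ℝ E]
variable {G : Type*} [TopologicalSpace G] [ChartedSpace E G] [Group G]

/-- The adjoint action `Ad g` on the tangent space at the identity, the derivative at `1` of the
conjugation by `g`. The tangent space at the identity is the model space `E`. -/
noncomputable def adjointMap (E : Type*) [NormedAddCommGroup E] [NormedSpace ℝ E]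
    {G : Type*} [TopologicalSpace G] [ChartedSpace E G] [Group G] (g : G) : E →L[ℝ] E :=
  mfderiv 𝓘(ℝ, E) 𝓘(ℝ, E) (fun x : G => g * x * g⁻¹) 1

/-- The left-invariant vector field with value `X` at the identity, in terms of the model
space. -/
noncomputable def leftField (X : E) (g : G) : E :=
  mfderiv 𝓘(ℝ, E) 𝓘(ℝ, E) (fun x : G => g * x) 1 X

lemma mfderiv_eq_fderiv_chart {f : G → G} (hf : MDifferentiableAt 𝓘(ℝ, E) 𝓘(ℝ, E) f 1) :
    (mfderiv 𝓘(ℝ, E) 𝓘(ℝ, E) f 1 : E →L[ℝ] E) =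
      fderiv ℝ (extChartAt 𝓘(ℝ, E) (f 1) ∘ f ∘ (extChartAt 𝓘(ℝ, E) (1 : G)).symm)
        (extChartAt 𝓘(ℝ, E) (1 : G) 1) := by
  rw [hf.mfderiv, ← fderivWithin_univ]
  simp [writtenInExtChartAt]
  rfl

lemma mfderiv_eq_fderiv_chart' {f : G → E} (hf : MDifferentiableAt 𝓘(ℝ, E) 𝓘(ℝ, E) f 1) :
    (mfderiv 𝓘(ℝ, E) 𝓘(ℝ, E) f 1 : E →L[ℝ] E) =
      fderiv ℝ (f ∘ (extChartAt 𝓘(ℝ, E) (1 : G)).symm) (extChartAt 𝓘(ℝ, E) (1 : G) 1) := by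
  rw [hf.mfderiv, ← fderivWithin_univ]
  simp [writtenInExtChartAt]
  rfl

variable [LieGroup 𝓘(ℝ, E) ∞ G]

lemma contMDiff_conj (g : G) :
    ContMDiff 𝓘(ℝ, E) 𝓘(ℝ, E) ∞ (fun x : G => g * x * g⁻¹) :=
  (contMDiff_mul_right (a := g⁻¹)).comp (contMDiff_mul_left (a := g))

lemma mdifferentiableAt_conj (g x : G) :
    MDifferentiableAt 𝓘(ℝ, E) 𝓘(ℝ, E) (fun x : G => g * x * g⁻¹) x :=
  (contMDiff_conj g).mdifferentiableAt (by simp)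

lemma mdifferentiableAt_mul_left (g x : G) :
    MDifferentiableAt 𝓘(ℝ, E) 𝓘(ℝ, E) (fun x : G => g * x) x :=
  (contMDiff_mul_left (I := 𝓘(ℝ, E)) (n := ∞) (a := g)).mdifferentiableAt (by simp)

/-- The multiplication of `G` in the preferred chart at the identity. -/
noncomputable def chartMul (E : Type*) [NormedAddCommGroup E] [NormedSpace ℝ E]
    (G : Type*) [TopologicalSpace G] [ChartedSpace E G] [Group G] (p : E × E) : E :=
  extChartAt 𝓘(ℝ, E) (1 : G)
    ((extChartAt 𝓘(ℝ, E) (1 : G)).symm p.1 * (extChartAt 𝓘(ℝ, E) (1 : G)).symm p.2)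

/-- The conjugation `(x, y) ↦ x y x⁻¹` of `G` in the preferred chart at the identity. -/
noncomputable def chartConj (E : Type*) [NormedAddCommGroup E] [NormedSpace ℝ E]
    (G : Type*) [TopologicalSpace G] [ChartedSpace E G] [Group G] (p : E × E) : E :=
  extChartAt 𝓘(ℝ, E) (1 : G)
    ((extChartAt 𝓘(ℝ, E) (1 : G)).symm p.1 * (extChartAt 𝓘(ℝ, E) (1 : G)).symm p.2 *
      ((extChartAt 𝓘(ℝ, E) (1 : G)).symm p.1)⁻¹)

variable (E G) in
lemma contMDiffAt_chart_symm :
    ContMDiffAt 𝓘(ℝ, E) 𝓘(ℝ, E) ∞ (extChartAt 𝓘(ℝ, E) (1 : G)).symm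
      (extChartAt 𝓘(ℝ, E) (1 : G) 1) := by
  have := IsManifold.of_le (I := 𝓘(ℝ, E)) (M := G) (m := ∞) (n := ∞) le_rfl
  exact (contMDiffOn_extChartAt_symm (1 : G)).contMDiffAt (extChartAt_target_mem_nhds (1 : G))

variable (E G) in
lemma contDiffAt_chartMul :
    ContDiffAt ℝ ∞ (chartMul E G)
      (extChartAt 𝓘(ℝ, E) (1 : G) 1, extChartAt 𝓘(ℝ, E) (1 : G) 1) := by
  have h := contMDiffAt_chart_symm E G
  have h1 : ContMDiffAt 𝓘(ℝ, E × E) 𝓘(ℝ, E) ∞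
      (fun p : E × E => (extChartAt 𝓘(ℝ, E) (1 : G)).symm p.1)
      (extChartAt 𝓘(ℝ, E) (1 : G) 1, extChartAt 𝓘(ℝ, E) (1 : G) 1) :=
    ContMDiffAt.comp (f := Prod.fst) _ h contDiffAt_fst.contMDiffAt
  have h2 : ContMDiffAt 𝓘(ℝ, E × E) 𝓘(ℝ, E) ∞
      (fun p : E × E => (extChartAt 𝓘(ℝ, E) (1 : G)).symm p.2)
      (extChartAt 𝓘(ℝ, E) (1 : G) 1, extChartAt 𝓘(ℝ, E) (1 : G) 1) :=
    ContMDiffAt.comp (f := Prod.snd) _ h contDiffAt_snd.contMDiffAt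
  have h3 := h1.mul h2
  have h4 : ContMDiffAt 𝓘(ℝ, E) 𝓘(ℝ, E) ∞ (extChartAt 𝓘(ℝ, E) (1 : G))
      ((extChartAt 𝓘(ℝ, E) (1 : G)).symm (extChartAt 𝓘(ℝ, E) (1 : G) 1) *
        (extChartAt 𝓘(ℝ, E) (1 : G)).symm (extChartAt 𝓘(ℝ, E) (1 : G) 1)) := by
    rw [extChartAt_to_inv, mul_one]
    exact contMDiffAt_extChartAt
  exact (ContMDiffAt.comp (g := extChartAt 𝓘(ℝ, E) (1 : G))
    (f := fun p : E × E => (extChartAt 𝓘(ℝ, E) (1 : G)).symm p.1 *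
      (extChartAt 𝓘(ℝ, E) (1 : G)).symm p.2)
    (extChartAt 𝓘(ℝ, E) (1 : G) 1, extChartAt 𝓘(ℝ, E) (1 : G) 1) h4 h3).contDiffAt

variable (E G) in
lemma contDiffAt_chartConj :
    ContDiffAt ℝ ∞ (chartConj E G)
      (extChartAt 𝓘(ℝ, E) (1 : G) 1, extChartAt 𝓘(ℝ, E) (1 : G) 1) := by
  have h := contMDiffAt_chart_symm E G
  have h1 : ContMDiffAt 𝓘(ℝ, E × E) 𝓘(ℝ, E) ∞
      (fun p : E × E => (extChartAt 𝓘(ℝ, E) (1 : G)).symm p.1)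
      (extChartAt 𝓘(ℝ, E) (1 : G) 1, extChartAt 𝓘(ℝ, E) (1 : G) 1) :=
    ContMDiffAt.comp (f := Prod.fst) _ h contDiffAt_fst.contMDiffAt
  have h2 : ContMDiffAt 𝓘(ℝ, E × E) 𝓘(ℝ, E) ∞
      (fun p : E × E => (extChartAt 𝓘(ℝ, E) (1 : G)).symm p.2)
      (extChartAt 𝓘(ℝ, E) (1 : G) 1, extChartAt 𝓘(ℝ, E) (1 : G) 1) :=
    ContMDiffAt.comp (f := Prod.snd) _ h contDiffAt_snd.contMDiffAt
  have h3 := (h1.mul h2).mul h1.inv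
  have h4 : ContMDiffAt 𝓘(ℝ, E) 𝓘(ℝ, E) ∞ (extChartAt 𝓘(ℝ, E) (1 : G))
      ((extChartAt 𝓘(ℝ, E) (1 : G)).symm (extChartAt 𝓘(ℝ, E) (1 : G) 1) *
        (extChartAt 𝓘(ℝ, E) (1 : G)).symm (extChartAt 𝓘(ℝ, E) (1 : G) 1) *
        ((extChartAt 𝓘(ℝ, E) (1 : G)).symm (extChartAt 𝓘(ℝ, E) (1 : G) 1))⁻¹) := by
    rw [extChartAt_to_inv, mul_one, inv_one, mul_one]
    exact contMDiffAt_extChartAt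
  exact (ContMDiffAt.comp (g := extChartAt 𝓘(ℝ, E) (1 : G))
    (f := fun p : E × E => (extChartAt 𝓘(ℝ, E) (1 : G)).symm p.1 *
      (extChartAt 𝓘(ℝ, E) (1 : G)).symm p.2 * ((extChartAt 𝓘(ℝ, E) (1 : G)).symm p.1)⁻¹)
    (extChartAt 𝓘(ℝ, E) (1 : G) 1, extChartAt 𝓘(ℝ, E) (1 : G) 1) h4 h3).contDiffAt

lemma fderiv_partial {f : E × E → E} {x o : E} (h : DifferentiableAt ℝ f (x, o)) (Y : E) :
    fderiv ℝ (fun y => f (x, y)) o Y = fderiv ℝ f (x, o) (0, Y) := by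
  have h1 : HasFDerivAt (fun y => f (x, y)) _ o :=
    HasFDerivAt.comp (f := fun y : E => (x, y)) (g := f) o h.hasFDerivAt
      (hasFDerivAt_prodMk_right x o)
  rw [h1.fderiv]
  simp

lemma adjointMap_eq_fderiv (x : E) (Y : E)
    (hd : DifferentiableAt ℝ (chartConj E G) (x, extChartAt 𝓘(ℝ, E) (1 : G) 1)) :
    adjointMap E ((extChartAt 𝓘(ℝ, E) (1 : G)).symm x) Y =
      fderiv ℝ (chartConj E G) (x, extChartAt 𝓘(ℝ, E) (1 : G) 1) (0, Y) := by
  rw [← fderiv_partial hd, adjointMap, mfderiv_eq_fderiv_chart (mdifferentiableAt_conj _ _)]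
  simp only [mul_one, mul_inv_cancel]
  rfl

lemma mfderiv_chart_leftField {g : G} (hg : g ∈ (extChartAt 𝓘(ℝ, E) (1 : G)).source) (Y : E)
    (hd : DifferentiableAt ℝ (chartMul E G)
      (extChartAt 𝓘(ℝ, E) (1 : G) g, extChartAt 𝓘(ℝ, E) (1 : G) 1)) :
    (mfderiv 𝓘(ℝ, E) 𝓘(ℝ, E) (extChartAt 𝓘(ℝ, E) (1 : G)) g : E →L[ℝ] E) (leftField (E := E) Y g) =
      fderiv ℝ (chartMul E G)
        (extChartAt 𝓘(ℝ, E) (1 : G) g, extChartAt 𝓘(ℝ, E) (1 : G) 1) (0, Y) := by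
  have hφ : MDifferentiableAt 𝓘(ℝ, E) 𝓘(ℝ, E) (extChartAt 𝓘(ℝ, E) (1 : G)) (g * 1) := by
    have := IsManifold.of_le (I := 𝓘(ℝ, E)) (M := G) (m := 1) (n := ∞) (by simp)
    rw [mul_one]
    exact mdifferentiableAt_extChartAt (by simpa using hg)
  have h1 := mfderiv_comp (I' := 𝓘(ℝ, E)) (1 : G) hφ (mdifferentiableAt_mul_left (E := E) g 1)
  have h2 := mfderiv_eq_fderiv_chart' (f := extChartAt 𝓘(ℝ, E) (1 : G) ∘ fun x => g * x)
    (hφ.comp (1 : G) (mdifferentiableAt_mul_left (E := E) g 1))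
  have h3 : (extChartAt 𝓘(ℝ, E) (1 : G) ∘ fun x => g * x) ∘ (extChartAt 𝓘(ℝ, E) (1 : G)).symm =
      fun y => chartMul E G (extChartAt 𝓘(ℝ, E) (1 : G) g, y) := by
    funext y
    simp only [Function.comp, chartMul]
    rw [(extChartAt 𝓘(ℝ, E) (1 : G)).left_inv hg]
  rw [← fderiv_partial hd, ← h3, ← h2, h1]
  let D : G → E →L[ℝ] E := fun k => mfderiv 𝓘(ℝ, E) 𝓘(ℝ, E) (extChartAt 𝓘(ℝ, E) (1 : G)) k
  change D g (leftField Y g) = D (g * 1) (leftField Y g)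
  rw [mul_one]

end Group

/-! ### The differential of the adjoint action -/

section Group

open Filter Topology VectorField

variable {E : Type*} [NormedAddCommGroup E] [NormedSpace ℝ E]
variable {G : Type*} [TopologicalSpace G] [ChartedSpace E G] [Group G] [LieGroup 𝓘(ℝ, E) ∞ G]

lemma inverse_mfderivWithin_chart_symm {x : E} (hx : x ∈ (extChartAt 𝓘(ℝ, E) (1 : G)).target) :
    (mfderivWithin 𝓘(ℝ, E) 𝓘(ℝ, E) (extChartAt 𝓘(ℝ, E) (1 : G)).symm
      (Set.range 𝓘(ℝ, E)) x).inverse =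
    mfderiv 𝓘(ℝ, E) 𝓘(ℝ, E) (extChartAt 𝓘(ℝ, E) (1 : G))
      ((extChartAt 𝓘(ℝ, E) (1 : G)).symm x) := by
  have := IsManifold.of_le (I := 𝓘(ℝ, E)) (M := G) (m := 1) (n := ∞) (by simp)
  exact ContinuousLinearMap.inverse_eq (mfderivWithin_extChartAt_symm_comp_mfderiv_extChartAt hx)
    (mfderiv_extChartAt_comp_mfderivWithin_extChartAt_symm hx)

variable (E G) in
lemma eventually_differentiableAt_chartMul :
    ∀ᶠ x in 𝓝 (extChartAt 𝓘(ℝ, E) (1 : G) 1),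
      DifferentiableAt ℝ (chartMul E G) (x, extChartAt 𝓘(ℝ, E) (1 : G) 1) := by
  have h := (((contDiffAt_chartMul E G).of_le (m := 1) (by simp)).eventually (by simp)).mono
    fun p hp => hp.differentiableAt (by simp)
  have ht : Tendsto (fun x : E => (x, extChartAt 𝓘(ℝ, E) (1 : G) 1))
      (𝓝 (extChartAt 𝓘(ℝ, E) (1 : G) 1)) (𝓝 (extChartAt 𝓘(ℝ, E) (1 : G) 1,
        extChartAt 𝓘(ℝ, E) (1 : G) 1)) :=
    (continuous_id.prodMk continuous_const).tendsto _
  exact ht.eventually h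

variable (E G) in
lemma eventually_differentiableAt_chartConj :
    ∀ᶠ x in 𝓝 (extChartAt 𝓘(ℝ, E) (1 : G) 1),
      DifferentiableAt ℝ (chartConj E G) (x, extChartAt 𝓘(ℝ, E) (1 : G) 1) := by
  have h := (((contDiffAt_chartConj E G).of_le (m := 1) (by simp)).eventually (by simp)).mono
    fun p hp => hp.differentiableAt (by simp)
  have ht : Tendsto (fun x : E => (x, extChartAt 𝓘(ℝ, E) (1 : G) 1))
      (𝓝 (extChartAt 𝓘(ℝ, E) (1 : G) 1)) (𝓝 (extChartAt 𝓘(ℝ, E) (1 : G) 1,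
        extChartAt 𝓘(ℝ, E) (1 : G) 1)) :=
    (continuous_id.prodMk continuous_const).tendsto _
  exact ht.eventually h

/-- The bracket of the Lie algebra of `G` in local coordinates. -/
lemma bracket_eq_lieBracket (X Y : GroupLieAlgebra 𝓘(ℝ, E) G) :
    (⁅X, Y⁆ : GroupLieAlgebra 𝓘(ℝ, E) G) =
      lieBracket ℝ
        (fun x => fderiv ℝ (chartMul E G) (x, extChartAt 𝓘(ℝ, E) (1 : G) 1) ((0 : E), (X : E)))
        (fun x => fderiv ℝ (chartMul E G) (x, extChartAt 𝓘(ℝ, E) (1 : G) 1) ((0 : E), (Y : E)))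
        (extChartAt 𝓘(ℝ, E) (1 : G) 1) := by
  have := IsManifold.of_le (I := 𝓘(ℝ, E)) (M := G) (m := 1) (n := ∞) (by simp)
  have hpull : ∀ Z : GroupLieAlgebra 𝓘(ℝ, E) G,
      (mpullbackWithin 𝓘(ℝ, E) 𝓘(ℝ, E) (extChartAt 𝓘(ℝ, E) (1 : G)).symm
        (mulInvariantVectorField Z) (Set.range 𝓘(ℝ, E)) : E → E)
        =ᶠ[𝓝 (extChartAt 𝓘(ℝ, E) (1 : G) 1)]
      fun x => fderiv ℝ (chartMul E G) (x, extChartAt 𝓘(ℝ, E) (1 : G) 1) ((0 : E), (Z : E)) := by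
    intro Z
    filter_upwards [extChartAt_target_mem_nhds (I := 𝓘(ℝ, E)) (1 : G),
      eventually_differentiableAt_chartMul E G] with x hx hd
    rw [mpullbackWithin_apply, inverse_mfderivWithin_chart_symm hx]
    have h := mfderiv_chart_leftField (g := (extChartAt 𝓘(ℝ, E) (1 : G)).symm x)
      ((extChartAt 𝓘(ℝ, E) (1 : G)).map_target hx) Z
      (by rwa [(extChartAt 𝓘(ℝ, E) (1 : G)).right_inv hx])
    rw [(extChartAt 𝓘(ℝ, E) (1 : G)).right_inv hx] at h
    exact h
  let V : GroupLieAlgebra 𝓘(ℝ, E) G → E → E := fun Z =>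
    mpullbackWithin 𝓘(ℝ, E) 𝓘(ℝ, E) (extChartAt 𝓘(ℝ, E) (1 : G)).symm
        (mulInvariantVectorField Z) (Set.range 𝓘(ℝ, E))
  let M : E →L[ℝ] E := mfderiv 𝓘(ℝ, E) 𝓘(ℝ, E) (extChartAt 𝓘(ℝ, E) (1 : G)) 1
  have hM : M = ContinuousLinearMap.id ℝ E := mfderiv_extChartAt_self
  have hset : (extChartAt 𝓘(ℝ, E) (1 : G)).symm ⁻¹' Set.univ ∩ Set.range 𝓘(ℝ, E) = Set.univ := by
    simp
  change M.inverse (lieBracketWithin ℝ (V X) (V Y)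
      ((extChartAt 𝓘(ℝ, E) (1 : G)).symm ⁻¹' Set.univ ∩ Set.range 𝓘(ℝ, E))
      (extChartAt 𝓘(ℝ, E) (1 : G) 1)) = _
  rw [hM, ContinuousLinearMap.inverse_id, hset, lieBracketWithin_univ]
  exact (hpull X).lieBracket_vectorField_eq (hpull Y) (𝕜 := ℝ)

/-- The differential of the adjoint representation at the identity is the bracket. -/
theorem exists_hasMFDerivAt_adjointMap (Y : GroupLieAlgebra 𝓘(ℝ, E) G) :
    ∃ L : E →L[ℝ] E,
      HasMFDerivAt 𝓘(ℝ, E) 𝓘(ℝ, E) (fun g : G => adjointMap E g (Y : E)) 1 L ∧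
      ∀ X : GroupLieAlgebra 𝓘(ℝ, E) G, L X = (⁅X, Y⁆ : GroupLieAlgebra 𝓘(ℝ, E) G) := by
  have := IsManifold.of_le (I := 𝓘(ℝ, E)) (M := G) (m := 1) (n := ∞) (by simp)
  have htop : IsTopologicalGroup G := topologicalGroup_of_lieGroup 𝓘(ℝ, E) ∞
  set φ := extChartAt 𝓘(ℝ, E) (1 : G) with hφ
  have htarget : φ.target ∈ 𝓝 (φ 1) := extChartAt_target_mem_nhds (I := 𝓘(ℝ, E)) (1 : G)
  have hφ1 : φ.symm (φ 1) = 1 := extChartAt_to_inv (I := 𝓘(ℝ, E)) (1 : G)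
  have hsource : φ.source ∈ 𝓝 (1 : G) := extChartAt_source_mem_nhds (I := 𝓘(ℝ, E)) (1 : G)
  have hcont : ContinuousAt φ.symm (φ 1) := continuousAt_extChartAt_symm (I := 𝓘(ℝ, E)) (1 : G)
  obtain ⟨L, hL, hLX⟩ := hasFDerivAt_conj_of_local_group (μ := chartMul E G) (c := chartConj E G)
    (o := φ 1) ((contDiffAt_chartMul E G).of_le (by norm_cast))
    ((contDiffAt_chartConj E G).of_le (by norm_cast))
    (by
      filter_upwards [htarget] with y hy
      change φ (φ.symm (φ 1) * φ.symm y) = y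
      rw [hφ1, one_mul, φ.right_inv hy])
    (by
      filter_upwards [htarget] with y hy
      change φ (φ.symm y * φ.symm (φ 1)) = y
      rw [hφ1, mul_one, φ.right_inv hy])
    (Eventually.of_forall fun x => by
      change φ (φ.symm x * φ.symm (φ 1) * (φ.symm x)⁻¹) = φ 1
      rw [hφ1, mul_one, mul_inv_cancel])
    (by
      filter_upwards [htarget] with y hy
      change φ (φ.symm (φ 1) * φ.symm y * (φ.symm (φ 1))⁻¹) = y
      rw [hφ1, one_mul, inv_one, mul_one, φ.right_inv hy])
    (by
      have ht : Tendsto (fun p : E × E => φ.symm p.1 * φ.symm p.2 * (φ.symm p.1)⁻¹)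
          (𝓝 (φ 1, φ 1)) (𝓝 1) := by
        have h1 : Tendsto (fun p : E × E => φ.symm p.1) (𝓝 (φ 1, φ 1)) (𝓝 1) := by
          have h0 : Tendsto φ.symm (𝓝 (φ 1)) (𝓝 1) := by simpa only [hφ1] using hcont.tendsto
          exact h0.comp (continuous_fst.tendsto (φ 1, φ 1))
        have h2 : Tendsto (fun p : E × E => φ.symm p.2) (𝓝 (φ 1, φ 1)) (𝓝 1) := by
          have h0 : Tendsto φ.symm (𝓝 (φ 1)) (𝓝 1) := by simpa only [hφ1] using hcont.tendsto
          exact h0.comp (continuous_snd.tendsto (φ 1, φ 1))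
        simpa using (h1.mul h2).mul h1.inv
      filter_upwards [ht hsource] with p hp
      change φ (φ.symm (φ (φ.symm p.1 * φ.symm p.2 * (φ.symm p.1)⁻¹)) * φ.symm p.1) =
        φ (φ.symm p.1 * φ.symm p.2)
      rw [φ.left_inv hp, inv_mul_cancel_right])
    (Y : E)
  refine ⟨L, ?_, fun X => ?_⟩
  · have h1 : HasMFDerivAt 𝓘(ℝ, E) 𝓘(ℝ, E) φ (1 : G)
        (ContinuousLinearMap.id ℝ (TangentSpace 𝓘(ℝ, E) (1 : G))) := by
      have h := (mdifferentiableAt_extChartAt (I := 𝓘(ℝ, E)) (x := (1 : G)) (y := 1)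
        (mem_chart_source E 1)).hasMFDerivAt
      rwa [mfderiv_extChartAt_self] at h
    have h2 := HasMFDerivAt.comp (1 : G) hL.hasMFDerivAt h1
    have h3 : (fun g : G => adjointMap E g (Y : E)) =ᶠ[𝓝 1]
        (fun x => fderiv ℝ (chartConj E G) (x, φ 1) ((0 : E), (Y : E))) ∘ φ := by
      have hc : ContinuousAt φ (1 : G) := continuousAt_extChartAt (I := 𝓘(ℝ, E)) (1 : G)
      filter_upwards [hsource, hc.eventually (eventually_differentiableAt_chartConj E G)]
        with g hg hd
      have h := adjointMap_eq_fderiv (G := G) (φ g) (Y : E) hd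
      rw [φ.left_inv hg] at h
      exact h
    exact h2.congr_of_eventuallyEq h3
  · exact (hLX X).trans (bracket_eq_lieBracket X Y).symm

end Group

/-! ### The adjoint representation -/

section Adjoint

open Filter Topology VectorField

variable {E : Type*} [NormedAddCommGroup E] [NormedSpace ℝ E]
variable {G : Type*} [TopologicalSpace G] [ChartedSpace E G] [Group G] [LieGroup 𝓘(ℝ, E) ∞ G]

variable (E) in
lemma adjointMap_mul (g h : G) : adjointMap E (g * h) = adjointMap E g * adjointMap E h := by
  have h1 : (fun x : G => g * h * x * (g * h)⁻¹) =
      (fun x : G => g * x * g⁻¹) ∘ fun x : G => h * x * h⁻¹ := by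
    funext x
    simp only [Function.comp, mul_inv_rev]
    group
  have h2 := mfderiv_comp (I' := 𝓘(ℝ, E)) (1 : G)
    (mdifferentiableAt_conj (E := E) g (h * 1 * h⁻¹)) (mdifferentiableAt_conj (E := E) h 1)
  rw [← h1] at h2
  let D : G → E →L[ℝ] E := fun k => mfderiv 𝓘(ℝ, E) 𝓘(ℝ, E) (fun x : G => g * x * g⁻¹) k
  have h3 : D (h * 1 * h⁻¹) = D 1 := by rw [mul_one, mul_inv_cancel]
  have h4 : adjointMap E (g * h) = (D (h * 1 * h⁻¹)).comp (adjointMap E h) := h2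
  rw [h4, h3]
  rfl

variable (E G) in
omit [LieGroup 𝓘(ℝ, E) ∞ G] in
lemma adjointMap_one : adjointMap E (1 : G) = 1 := by
  have h1 : (fun x : G => 1 * x * 1⁻¹) = id := by
    funext x
    simp
  have h2 : (mfderiv 𝓘(ℝ, E) 𝓘(ℝ, E) (id : G → G) 1 : E →L[ℝ] E) =
      ContinuousLinearMap.id ℝ E :=
    mfderiv_id
  rw [adjointMap, h1]
  exact h2

variable (E G) in
/-- The adjoint representation of `G`. -/
noncomputable def adjointRep : G →* (E →L[ℝ] E) where
  toFun := adjointMap E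
  map_one' := adjointMap_one E G
  map_mul' := adjointMap_mul E

lemma adjointRep_inv_apply_self (g : G) (X : E) :
    adjointRep E G g⁻¹ (adjointRep E G g X) = X := by
  have h := DFunLike.congr_fun (map_mul (adjointRep E G) g⁻¹ g) X
  simpa using h.symm

lemma adjointRep_self_apply_inv (g : G) (X : E) :
    adjointRep E G g (adjointRep E G g⁻¹ X) = X := by
  simpa using adjointRep_inv_apply_self g⁻¹ X

/-- The adjoint representation is continuous. -/
theorem continuous_adjointRep [FiniteDimensional ℝ E] : Continuous (adjointRep E G) := by
  have htop : IsTopologicalGroup G := topologicalGroup_of_lieGroup 𝓘(ℝ, E) ∞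
  refine continuous_clm_apply.2 fun Y => ?_
  have h1 : ContinuousAt (fun g : G => adjointRep E G g Y) 1 := by
    obtain ⟨L, hL, -⟩ := exists_hasMFDerivAt_adjointMap (G := G) (Y : GroupLieAlgebra 𝓘(ℝ, E) G)
    exact hL.continuousAt
  refine continuous_iff_continuousAt.2 fun g => ?_
  have h2 : ContinuousAt (fun x : G => g⁻¹ * x) g := by fun_prop
  have h3 : ContinuousAt (fun x : G => adjointRep E G (g⁻¹ * x) Y) g :=
    ContinuousAt.comp (f := fun x : G => g⁻¹ * x) (g := fun x : G => adjointRep E G x Y)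
      (by rw [inv_mul_cancel]; exact h1) h2
  have h4 := (adjointRep E G g).continuous.continuousAt.comp h3
  refine h4.congr (Eventually.of_forall fun x => ?_)
  simp only [Function.comp]
  rw [← mul_apply_eq_comp, ← map_mul, mul_inv_cancel_left]

/-- The adjoint action of `g` as a linear map of the Lie algebra of `G`. -/
noncomputable def adjointLin (g : G) :
    GroupLieAlgebra 𝓘(ℝ, E) G →ₗ[ℝ] GroupLieAlgebra 𝓘(ℝ, E) G :=
  (adjointRep E G g : E →ₗ[ℝ] E)

/-- The adjoint representation acts by automorphisms of the Lie algebra. -/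
theorem adjointLin_bracket (g : G) (X Y : GroupLieAlgebra 𝓘(ℝ, E) G) :
    adjointLin g ⁅X, Y⁆ = ⁅adjointLin g X, adjointLin g Y⁆ := by
  obtain ⟨L, hL, hLX⟩ := exists_hasMFDerivAt_adjointMap Y
  obtain ⟨L', hL', hLX'⟩ := exists_hasMFDerivAt_adjointMap (adjointLin g Y)
  -- differentiate `Ad g (Ad h Y) = Ad (g h g⁻¹) (Ad g Y)` with respect to `h` at `1`
  have h1 : HasMFDerivAt 𝓘(ℝ, E) 𝓘(ℝ, E) (fun h : G => adjointRep E G g (adjointRep E G h Y)) 1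
      ((adjointRep E G g).comp L) :=
    HasMFDerivAt.comp (g := adjointRep E G g) (1 : G)
      (adjointRep E G g).hasMFDerivAt hL
  have h2 : HasMFDerivAt 𝓘(ℝ, E) 𝓘(ℝ, E)
      (fun h : G => adjointRep E G (g * h * g⁻¹) (adjointRep E G g Y)) 1
      (L'.comp (adjointRep E G g)) := by
    have h3 : HasMFDerivAt 𝓘(ℝ, E) 𝓘(ℝ, E)
      (fun h : G => adjointMap E h (adjointRep E G g Y)) (g * 1 * g⁻¹) L' := by
      rw [mul_one, mul_inv_cancel]; exact hL'
    exact HasMFDerivAt.comp (1 : G) h3 (mdifferentiableAt_conj g 1).hasMFDerivAt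
  have h4 : (fun h : G => adjointRep E G g (adjointRep E G h Y)) =
      fun h : G => adjointRep E G (g * h * g⁻¹) (adjointRep E G g Y) := by
    funext h
    change (adjointRep E G g * adjointRep E G h) Y =
      (adjointRep E G (g * h * g⁻¹) * adjointRep E G g) Y
    rw [← map_mul, ← map_mul, inv_mul_cancel_right]
  rw [h4] at h1
  have h5 := DFunLike.congr_fun (hasMFDerivAt_unique h1 h2) X
  have h6 : adjointLin g ⁅X, Y⁆ = adjointRep E G g (L X) := by
    rw [hLX X]
    rfl
  exact h6.trans (h5.trans (hLX' (adjointLin g X)))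

end Adjoint

section OneParameter

open Filter Topology

variable {E : Type*} [NormedAddCommGroup E] [NormedSpace ℝ E]
variable {G : Type*} [TopologicalSpace G] [ChartedSpace E G] [Group G] [LieGroup 𝓘(ℝ, E) ∞ G]

lemma mfderiv_conj_leftField (g h : G) (X : E) :
    (mfderiv 𝓘(ℝ, E) 𝓘(ℝ, E) (fun x : G => g * x * g⁻¹) h : E →L[ℝ] E)
      (leftField (E := E) X h) = leftField (adjointRep E G g X) (g * h * g⁻¹) := by
  let D : G → E →L[ℝ] E := fun k => mfderiv 𝓘(ℝ, E) 𝓘(ℝ, E) (fun x : G => g * x * g⁻¹) k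
  let D' : G → E →L[ℝ] E := fun k => mfderiv 𝓘(ℝ, E) 𝓘(ℝ, E) (fun x : G => g * h * g⁻¹ * x) k
  have h1 : (fun x : G => g * x * g⁻¹) ∘ (fun x : G => h * x) =
      (fun x : G => g * h * g⁻¹ * x) ∘ fun x : G => g * x * g⁻¹ := by
    funext x
    simp only [Function.comp]
    group
  have h2 := mfderiv_comp (I' := 𝓘(ℝ, E)) (1 : G)
    (mdifferentiableAt_conj (E := E) g (h * 1)) (mdifferentiableAt_mul_left (E := E) h 1)
  have h3 := mfderiv_comp (I' := 𝓘(ℝ, E)) (1 : G)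
    (mdifferentiableAt_mul_left (E := E) (g * h * g⁻¹) (g * 1 * g⁻¹))
    (mdifferentiableAt_conj (E := E) g 1)
  rw [h1] at h2
  have h4 := DFunLike.congr_fun (h2.symm.trans h3) X
  have h5 : D (h * 1) (leftField X h) = D' (g * 1 * g⁻¹) (adjointRep E G g X) := h4
  rw [mul_one, mul_one, mul_inv_cancel] at h5
  exact h5

lemma mfderiv_mul_left_leftField (g h : G) (X : E) :
    (mfderiv 𝓘(ℝ, E) 𝓘(ℝ, E) (fun x : G => g * x) h : E →L[ℝ] E)
      (leftField (E := E) X h) = leftField X (g * h) := by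
  let D : G → E →L[ℝ] E := fun k => mfderiv 𝓘(ℝ, E) 𝓘(ℝ, E) (fun x : G => g * x) k
  have h1 : (fun x : G => g * x) ∘ (fun x : G => h * x) = fun x : G => g * h * x := by
    funext x
    simp only [Function.comp, mul_assoc]
  have h2 := mfderiv_comp (I' := 𝓘(ℝ, E)) (1 : G)
    (mdifferentiableAt_mul_left (E := E) g (h * 1)) (mdifferentiableAt_mul_left (E := E) h 1)
  rw [h1] at h2
  have h3 : leftField X (g * h) = D (h * 1) (leftField X h) := DFunLike.congr_fun h2 X
  rw [mul_one] at h3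
  exact h3.symm

omit [LieGroup 𝓘(ℝ, E) ∞ G] in
lemma leftField_one (X : E) : leftField X (1 : G) = X := by
  have h1 : (fun x : G => 1 * x) = id := by
    funext x
    simp
  have h2 : (mfderiv 𝓘(ℝ, E) 𝓘(ℝ, E) (id : G → G) 1 : E →L[ℝ] E) =
      ContinuousLinearMap.id ℝ E :=
    mfderiv_id
  rw [leftField, h1]
  exact DFunLike.congr_fun h2 X

omit [LieGroup 𝓘(ℝ, E) ∞ G] in
/-- A map which relates two vector fields maps integral curves to integral curves. -/
lemma IsMIntegralCurveOn.map_of_related {γ : ℝ → G} {s : Set ℝ} {X Y : GroupLieAlgebra 𝓘(ℝ, E) G}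
    (hγ : IsMIntegralCurveOn (I := 𝓘(ℝ, E)) γ (mulInvariantVectorField X) s)
    {f : G → G} (hf : ∀ x, MDifferentiableAt 𝓘(ℝ, E) 𝓘(ℝ, E) f x)
    (h : ∀ x, (mfderiv 𝓘(ℝ, E) 𝓘(ℝ, E) f x : E →L[ℝ] E) (leftField (E := E) X x) =
      leftField (E := E) Y (f x)) :
    IsMIntegralCurveOn (I := 𝓘(ℝ, E)) (f ∘ γ) (mulInvariantVectorField Y) s := by
  intro t ht
  have h1 := HasMFDerivAt.comp_hasMFDerivWithinAt t (hf (γ t)).hasMFDerivAt (hγ t ht)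
  let A : ℝ →L[ℝ] E := (mfderiv 𝓘(ℝ, E) 𝓘(ℝ, E) f (γ t) : E →L[ℝ] E).comp
    ((1 : ℝ →L[ℝ] ℝ).smulRight (leftField (E := E) X (γ t)))
  have h2 : A = (1 : ℝ →L[ℝ] ℝ).smulRight (leftField (E := E) Y (f (γ t))) := by
    ext
    change (mfderiv 𝓘(ℝ, E) 𝓘(ℝ, E) f (γ t) : E →L[ℝ] E)
      ((1 : ℝ) • leftField (E := E) X (γ t)) = (1 : ℝ) • leftField (E := E) Y (f (γ t))
    rw [one_smul, one_smul]
    exact h _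
  have h3 : HasMFDerivWithinAt 𝓘(ℝ, ℝ) 𝓘(ℝ, E) (f ∘ γ) s t A := h1
  rw [h2] at h3
  exact h3

end OneParameter

/-! ### One-parameter groups, centralizers and maximal tori -/

section OneParameter

open Filter Topology

variable {E : Type*} [NormedAddCommGroup E] [NormedSpace ℝ E]
variable {G : Type*} [TopologicalSpace G] [ChartedSpace E G] [Group G] [LieGroup 𝓘(ℝ, E) ∞ G]

/-- `γ` is the one-parameter group `t ↦ exp (t X)`. -/
structure IsOneParameterGroup (γ : ℝ → G) (X : GroupLieAlgebra 𝓘(ℝ, E) G) : Prop where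
  zero : γ 0 = 1
  isMIntegralCurve : IsMIntegralCurve (I := 𝓘(ℝ, E)) γ (mulInvariantVectorField X)

lemma contMDiff_one_mulInvariantVectorField (X : GroupLieAlgebra 𝓘(ℝ, E) G) :
    ContMDiff 𝓘(ℝ, E) 𝓘(ℝ, E).tangent 1
      (fun g : G => (mulInvariantVectorField X g : TangentBundle 𝓘(ℝ, E) G)) :=
  (contMDiff_mulInvariantVectorField X).of_le
    (by rw [minSmoothness_of_isRCLikeNormedField]; norm_num)

lemma isMIntegralCurve_mul_left {γ : ℝ → G} {X : GroupLieAlgebra 𝓘(ℝ, E) G} {s : Set ℝ}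
    (hγ : IsMIntegralCurveOn (I := 𝓘(ℝ, E)) γ (mulInvariantVectorField X) s) (g : G) :
    IsMIntegralCurveOn (I := 𝓘(ℝ, E)) (fun t => g * γ t) (mulInvariantVectorField X) s :=
  IsMIntegralCurveOn.map_of_related hγ (f := fun x => g * x) (mdifferentiableAt_mul_left g)
    fun x => mfderiv_mul_left_leftField (E := E) g x X

lemma exists_isOneParameterGroup [CompleteSpace E] [T2Space G] (X : GroupLieAlgebra 𝓘(ℝ, E) G) :
    ∃ γ : ℝ → G, IsOneParameterGroup γ X := by
  obtain ⟨γ, hγ0, hγ⟩ := exists_isMIntegralCurveAt_of_contMDiffAt_boundaryless (t₀ := 0)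
    (contMDiff_one_mulInvariantVectorField X).contMDiffAt (x₀ := (1 : G))
  obtain ⟨ε, hε, hγε⟩ := isMIntegralCurveAt_iff'.1 hγ
  -- left translates of a local integral curve through `1` exist for the same time everywhere
  obtain ⟨γ', h0, h⟩ := exists_isMIntegralCurve_of_isMIntegralCurveOn
    (contMDiff_one_mulInvariantVectorField X) hε (fun x => ⟨fun t => x * γ t, by simp [hγ0],
      by
        rw [Real.ball_eq_Ioo, zero_sub, zero_add] at hγε
        exact isMIntegralCurve_mul_left hγε x⟩) (1 : G)
  exact ⟨γ', h0, h⟩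

lemma isMIntegralCurve_eq [T2Space G] {γ γ' : ℝ → G} {X : GroupLieAlgebra 𝓘(ℝ, E) G}
    (hγ : IsMIntegralCurve (I := 𝓘(ℝ, E)) γ (mulInvariantVectorField X))
    (hγ' : IsMIntegralCurve (I := 𝓘(ℝ, E)) γ' (mulInvariantVectorField X))
    (h : γ 0 = γ' 0) : γ = γ' :=
  isMIntegralCurve_Ioo_eq_of_contMDiff_boundaryless (t₀ := 0)
    (contMDiff_one_mulInvariantVectorField X) hγ hγ' h

namespace IsOneParameterGroup

variable {γ γ' : ℝ → G} {X Y : GroupLieAlgebra 𝓘(ℝ, E) G}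

lemma conj (hγ : IsOneParameterGroup γ X) (g : G) :
    IsOneParameterGroup (fun t => g * γ t * g⁻¹) (adjointLin g X) where
  zero := by simp [hγ.zero]
  isMIntegralCurve := by
    rw [isMIntegralCurve_iff_isMIntegralCurveOn]
    exact IsMIntegralCurveOn.map_of_related
      (isMIntegralCurve_iff_isMIntegralCurveOn.1 hγ.isMIntegralCurve)
      (f := fun x => g * x * g⁻¹) (mdifferentiableAt_conj g)
      fun x => mfderiv_conj_leftField (E := E) g x X

lemma unique [T2Space G] (hγ : IsOneParameterGroup γ X) (hγ' : IsOneParameterGroup γ' X) :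
    γ = γ' :=
  isMIntegralCurve_eq hγ.isMIntegralCurve hγ'.isMIntegralCurve (hγ.zero.trans hγ'.zero.symm)

omit [LieGroup 𝓘(ℝ, E) ∞ G] in
lemma generator_unique (hγ : IsOneParameterGroup γ X) (hγ' : IsOneParameterGroup γ Y) :
    X = Y := by
  have h1 := hasMFDerivAt_unique (hγ.isMIntegralCurve 0) (hγ'.isMIntegralCurve 0)
  have h2 : (1 : ℝ) • leftField (E := E) X (γ 0) = (1 : ℝ) • leftField (E := E) Y (γ 0) :=
    DFunLike.congr_fun h1 (1 : ℝ)
  rw [one_smul, one_smul, hγ.zero] at h2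
  exact (leftField_one (G := G) (E := E) X).symm.trans (h2.trans (leftField_one (E := E) Y))

lemma add [T2Space G] (hγ : IsOneParameterGroup γ X) (s t : ℝ) : γ (s + t) = γ s * γ t := by
  have h1 : IsMIntegralCurve (I := 𝓘(ℝ, E)) (fun t => γ s * γ t) (mulInvariantVectorField X) := by
    rw [isMIntegralCurve_iff_isMIntegralCurveOn]
    exact isMIntegralCurve_mul_left
      (isMIntegralCurve_iff_isMIntegralCurveOn.1 hγ.isMIntegralCurve) (γ s)
  have h2 := hγ.isMIntegralCurve.comp_add s
  have h3 := isMIntegralCurve_eq h2 h1 (by simp [hγ.zero])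
  have h4 := congrFun h3 t
  simp only [Function.comp] at h4
  rw [add_comm, h4]

/-- `d/dt Ad (exp (t X)) Y = [X, Y]` at `t = 0`. -/
lemma hasDerivAt_adjointRep (hγ : IsOneParameterGroup γ X) (Y : GroupLieAlgebra 𝓘(ℝ, E) G) :
    HasDerivAt (fun t => adjointRep E G (γ t) (Y : E))
      ((⁅X, Y⁆ : GroupLieAlgebra 𝓘(ℝ, E) G) : E) 0 := by
  obtain ⟨L, hL, hLX⟩ := exists_hasMFDerivAt_adjointMap Y
  have h0 : HasMFDerivAt 𝓘(ℝ, E) 𝓘(ℝ, E) (fun g : G => adjointMap E g (Y : E)) (γ 0) L := by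
    rw [hγ.zero]; exact hL
  have h1 := HasMFDerivAt.comp (0 : ℝ) h0 (hγ.isMIntegralCurve 0)
  have h2 : HasFDerivAt (fun t => adjointRep E G (γ t) (Y : E))
      (L.comp ((1 : ℝ →L[ℝ] ℝ).smulRight (leftField (E := E) X (γ 0)))) 0 :=
    hasMFDerivAt_iff_hasFDerivAt.1 h1
  have h3 : (L.comp ((1 : ℝ →L[ℝ] ℝ).smulRight (leftField (E := E) X (γ 0)))) 1 =
      (⁅X, Y⁆ : GroupLieAlgebra 𝓘(ℝ, E) G) := by
    change L ((1 : ℝ) • leftField (E := E) X (γ 0)) = _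
    rw [one_smul, hγ.zero]
    exact (congrArg L (leftField_one (E := E) (G := G) X)).trans (hLX X)
  exact h2.hasDerivAt.congr_deriv h3

end IsOneParameterGroup

omit [LieGroup 𝓘(ℝ, E) ∞ G] in
lemma oneParameterIn_iff {K : Subgroup G} {X : GroupLieAlgebra 𝓘(ℝ, E) G} :
    OneParameterIn E K X ↔ ∃ γ, IsOneParameterGroup γ X ∧ ∀ t, γ t ∈ K :=
  ⟨fun ⟨γ, h1, h2, h3⟩ => ⟨γ, ⟨h1, h2⟩, h3⟩, fun ⟨γ, ⟨h1, h2⟩, h3⟩ => ⟨γ, h1, h2, h3⟩⟩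

/-- The Lie algebra of a centralizer `C(S)` consists of the fixed vectors of `Ad S`. -/
theorem oneParameterIn_centralizer_iff [CompleteSpace E] [T2Space G] {S : Subgroup G}
    {X : GroupLieAlgebra 𝓘(ℝ, E) G} :
    OneParameterIn E (Subgroup.centralizer (S : Set G)) X ↔ ∀ s ∈ S, adjointLin s X = X := by
  rw [oneParameterIn_iff]
  constructor
  · rintro ⟨γ, hγ, hmem⟩ s hs
    have h1 : (fun t => s * γ t * s⁻¹) = γ := by
      funext t
      rw [Subgroup.mem_centralizer_iff.1 (hmem t) s hs, mul_inv_cancel_right]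
    have h2 := hγ.conj s
    rw [h1] at h2
    exact h2.generator_unique hγ
  · intro h
    obtain ⟨γ, hγ⟩ := exists_isOneParameterGroup X
    refine ⟨γ, hγ, fun t => Subgroup.mem_centralizer_iff.2 fun s hs => ?_⟩
    have h1 := hγ.conj s
    rw [h s hs] at h1
    have h2 := congrFun (h1.unique hγ) t
    exact mul_inv_eq_iff_eq_mul.1 h2

/-- A one-parameter group which centralizes a maximal torus lies in it: together they generate
a subgroup whose closure is a torus. -/
lemma IsMaximalTorus.mem_of_isOneParameterGroup [T2Space G] [CompactSpace G] {T : Subgroup G}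
    (hT : IsMaximalTorus T) {γ : ℝ → G} {X : GroupLieAlgebra 𝓘(ℝ, E) G}
    (hγ : IsOneParameterGroup γ X) (h : ∀ t, γ t ∈ Subgroup.centralizer (T : Set G)) (t : ℝ) :
    γ t ∈ T := by
  have htop : IsTopologicalGroup G := topologicalGroup_of_lieGroup 𝓘(ℝ, E) ∞
  have hcomm : ∀ a ∈ T, ∀ r, a * γ r = γ r * a := fun a ha r =>
    Subgroup.mem_centralizer_iff.1 (h r) a ha
  have hγcomm : ∀ r r', γ r * γ r' = γ r' * γ r := fun r r' => by
    rw [← hγ.add, ← hγ.add, add_comm]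
  have hneg : ∀ r, (γ r)⁻¹ = γ (-r) := fun r => by
    rw [inv_eq_iff_mul_eq_one, ← hγ.add, add_neg_cancel, hγ.zero]
  let H : Subgroup G :=
    { carrier := {g | ∃ a ∈ T, ∃ r, g = a * γ r}
      one_mem' := ⟨1, T.one_mem, 0, by simp [hγ.zero]⟩
      mul_mem' := by
        rintro _ _ ⟨a, ha, r, rfl⟩ ⟨b, hb, r', rfl⟩
        refine ⟨a * b, T.mul_mem ha hb, r + r', ?_⟩
        rw [hγ.add, mul_assoc a, ← mul_assoc (γ r), ← hcomm b hb r]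
        simp only [mul_assoc]
      inv_mem' := by
        rintro _ ⟨a, ha, r, rfl⟩
        refine ⟨a⁻¹, T.inv_mem ha, -r, ?_⟩
        rw [mul_inv_rev, hneg, hcomm a⁻¹ (T.inv_mem ha)] }
  have hHcomm : ∀ a ∈ H, ∀ b ∈ H, a * b = b * a := by
    rintro _ ⟨a, ha, r, rfl⟩ _ ⟨b, hb, r', rfl⟩
    calc a * γ r * (b * γ r') = a * (γ r * b) * γ r' := by simp only [mul_assoc]
      _ = a * b * (γ r * γ r') := by rw [← hcomm b hb r]; simp only [mul_assoc]
      _ = b * a * (γ r' * γ r) := by rw [hT.prop.comm a ha b hb, hγcomm]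
      _ = b * (a * γ r') * γ r := by simp only [mul_assoc]
      _ = b * γ r' * (a * γ r) := by rw [hcomm a ha r']; simp only [mul_assoc]
  have hHconn : IsConnected (H : Set G) := by
    have hcont : Continuous γ := hγ.isMIntegralCurve.continuous
    have h1 : (H : Set G) = (fun p : G × ℝ => p.1 * γ p.2) '' ((T : Set G) ×ˢ Set.univ) := by
      ext g
      constructor
      · rintro ⟨a, ha, r, rfl⟩
        exact ⟨(a, r), ⟨ha, Set.mem_univ _⟩, rfl⟩
      · rintro ⟨⟨a, r⟩, ⟨ha, -⟩, rfl⟩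
        exact ⟨a, ha, r, rfl⟩
    rw [h1]
    refine (hT.prop.isConnected.prod isConnected_univ).image _ (Continuous.continuousOn ?_)
    fun_prop
  have hclosure : IsTorus H.topologicalClosure := by
    refine ⟨H.isClosed_topologicalClosure.isCompact, ?_, ?_⟩
    · rw [Subgroup.topologicalClosure_coe]
      exact hHconn.closure
    · intro a ha b hb
      have ha' : a ∈ closure (H : Set G) := ha
      have hb' : b ∈ closure (H : Set G) := hb
      exact closure_minimal (s := (H : Set G) ×ˢ (H : Set G))
        (t := {p : G × G | p.1 * p.2 = p.2 * p.1})
        (fun p hp => hHcomm p.1 hp.1 p.2 hp.2)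
        (isClosed_eq (by fun_prop) (by fun_prop))
        (by rw [closure_prod_eq]; exact Set.mk_mem_prod ha' hb')
  have hle : T ≤ H.topologicalClosure := fun a ha =>
    H.le_topologicalClosure ⟨a, ha, 0, by simp [hγ.zero]⟩
  exact hT.le_of_ge hclosure hle (H.le_topologicalClosure ⟨1, T.one_mem, t, by simp⟩)

/-- The Lie algebra of a maximal torus `T` consists of the fixed vectors of `Ad T`. -/
theorem IsMaximalTorus.oneParameterIn_iff [CompleteSpace E] [T2Space G] [CompactSpace G]
    {T : Subgroup G} (hT : IsMaximalTorus T) {X : GroupLieAlgebra 𝓘(ℝ, E) G} :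
    OneParameterIn E T X ↔ ∀ s ∈ T, adjointLin s X = X := by
  rw [← oneParameterIn_centralizer_iff, FlagManifold.oneParameterIn_iff,
    FlagManifold.oneParameterIn_iff]
  constructor
  · rintro ⟨γ, hγ, h⟩
    exact ⟨γ, hγ, fun t => Subgroup.mem_centralizer_iff.2 fun s hs => hT.prop.comm s hs _ (h t)⟩
  · rintro ⟨γ, hγ, h⟩
    exact ⟨γ, hγ, hT.mem_of_isOneParameterGroup hγ h⟩

end OneParameter

/-! ### Inner products and the Killing form -/

section InnerForm

variable {V : Type*} [AddCommGroup V] [Module ℝ V]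

/-- A bilinear form on a real vector space is an inner product. -/
structure IsInnerForm (B : LinearMap.BilinForm ℝ V) : Prop where
  symm : ∀ x y, B x y = B y x
  pos : ∀ x, x ≠ 0 → 0 < B x x

namespace IsInnerForm

variable {B : LinearMap.BilinForm ℝ V}

lemma self_nonneg (hB : IsInnerForm B) (x : V) : 0 ≤ B x x := by
  by_cases hx : x = 0
  · simp [hx]
  · exact (hB.pos x hx).le

lemma eq_zero_of_self_eq_zero (hB : IsInnerForm B) {x : V} (h : B x x = 0) : x = 0 := by
  by_contra hx
  exact (hB.pos x hx).ne' h

lemma restrict (hB : IsInnerForm B) (W : Submodule ℝ V) : IsInnerForm (B.restrict W) where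
  symm x y := hB.symm x y
  pos x hx := hB.pos x (by simpa using hx)

/-- The inner product space structure defined by an inner product given as a bilinear form. -/
noncomputable abbrev core (hB : IsInnerForm B) : InnerProductSpace.Core ℝ V where
  inner x y := B x y
  conj_inner_symm x y := hB.symm y x
  re_inner_nonneg x := hB.self_nonneg x
  add_left x y z := by simp
  smul_left x y r := by simp
  definite x h := hB.eq_zero_of_self_eq_zero h

lemma exists_orthonormal_basis [FiniteDimensional ℝ V] (hB : IsInnerForm B) :
    ∃ b : Module.Basis (Fin (Module.finrank ℝ V)) ℝ V,
      ∀ i j, B (b i) (b j) = if i = j then 1 else 0 := by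
  let _ : NormedAddCommGroup V := hB.core.toNormedAddCommGroup
  let _ : InnerProductSpace ℝ V := InnerProductSpace.ofCore hB.core.toCore
  let b := stdOrthonormalBasis ℝ V
  refine ⟨b.toBasis, fun i j => ?_⟩
  have h := orthonormal_iff_ite.1 b.orthonormal i j
  rw [b.coe_toBasis]
  exact h

lemma exists_eigenvector [FiniteDimensional ℝ V] [Nontrivial V] (hB : IsInnerForm B)
    (f : V →ₗ[ℝ] V) (hf : ∀ x y, B (f x) y = B x (f y)) :
    ∃ (r : ℝ) (v : V), v ≠ 0 ∧ f v = r • v := by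
  let _ : NormedAddCommGroup V := hB.core.toNormedAddCommGroup
  let _ : InnerProductSpace ℝ V := InnerProductSpace.ofCore hB.core.toCore
  have hsymm : f.IsSymmetric := fun x y => hf x y
  obtain ⟨v, hv⟩ := hsymm.hasEigenvalue_iSup_of_finiteDimensional.exists_hasEigenvector
  exact ⟨_, v, hv.2, by simpa using hv.apply_eq_smul⟩

variable {ι : Type*} [Fintype ι] [DecidableEq ι] {b : Module.Basis ι ℝ V}

lemma repr_eq (hb : ∀ i j, B (b i) (b j) = if i = j then 1 else 0) (v : V) (i : ι) :
    b.repr v i = B (b i) v := by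
  conv_rhs => rw [← b.sum_repr v]
  simp only [map_sum, map_smul, hb, smul_eq_mul, mul_ite, mul_one, mul_zero, Finset.sum_ite_eq,
    Finset.mem_univ, if_true]

lemma trace_eq_sum (hb : ∀ i j, B (b i) (b j) = if i = j then 1 else 0) (f : V →ₗ[ℝ] V) :
    LinearMap.trace ℝ V f = ∑ i, B (b i) (f (b i)) := by
  rw [LinearMap.trace_eq_matrix_trace ℝ b, Matrix.trace]
  simp [LinearMap.toMatrix_apply, repr_eq hb]

lemma trace_comp_self_nonpos [FiniteDimensional ℝ V] (hB : IsInnerForm B) (f : V →ₗ[ℝ] V)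
    (hf : ∀ x y, B (f x) y = -B x (f y)) :
    LinearMap.trace ℝ V (f ∘ₗ f) ≤ 0 ∧ (LinearMap.trace ℝ V (f ∘ₗ f) = 0 → f = 0) := by
  obtain ⟨b, hb⟩ := hB.exists_orthonormal_basis
  have h1 : LinearMap.trace ℝ V (f ∘ₗ f) = -∑ i, B (f (b i)) (f (b i)) := by
    rw [trace_eq_sum hb, ← Finset.sum_neg_distrib]
    refine Finset.sum_congr rfl fun i _ => ?_
    rw [LinearMap.comp_apply, hf, neg_neg]
  have h2 : 0 ≤ ∑ i, B (f (b i)) (f (b i)) := Finset.sum_nonneg fun i _ => hB.self_nonneg _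
  refine ⟨by linarith, fun h => b.ext fun i => ?_⟩
  rw [h1, neg_eq_zero, Finset.sum_eq_zero_iff_of_nonneg fun i _ => hB.self_nonneg _] at h
  rw [LinearMap.zero_apply]
  exact hB.eq_zero_of_self_eq_zero (h i (Finset.mem_univ i))

lemma exists_orthogonal_projection [FiniteDimensional ℝ V] (hB : IsInnerForm B)
    (W : Submodule ℝ V) (v : V) : ∃ p ∈ W, ∀ x ∈ W, B x (v - p) = 0 := by
  obtain ⟨b, hb⟩ := (hB.restrict W).exists_orthonormal_basis
  refine ⟨∑ i, B (b i) v • (b i : V), W.sum_mem fun i _ => W.smul_mem _ (b i).2, fun x hx => ?_⟩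
  have h1 : ∀ j, B (b j) (v - ∑ i, B (b i) v • (b i : V)) = 0 := fun j => by
    have h2 : ∀ i, B (b j) (b i : V) = if j = i then 1 else 0 := fun i => hb j i
    simp [h2]
  have h3 : (x : V) = ∑ i, b.repr ⟨x, hx⟩ i • (b i : V) := by
    calc x = ((∑ i, b.repr ⟨x, hx⟩ i • b i : W) : V) := by rw [b.sum_repr]
      _ = _ := by rw [AddSubmonoidClass.coe_finsetSum]; rfl
  rw [h3]
  simp [map_sum, h1]

end IsInnerForm

end InnerForm

section Averaging

open MeasureTheory

variable {E : Type*} [NormedAddCommGroup E] [NormedSpace ℝ E] [FiniteDimensional ℝ E]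
variable {G : Type*} [Group G] [TopologicalSpace G] [IsTopologicalGroup G] [CompactSpace G]

/-- A representation of a compact group has an invariant inner product. -/
theorem exists_invariant_innerForm (ρ : G →* (E →L[ℝ] E)) (hρ : Continuous ρ) :
    ∃ B : LinearMap.BilinForm ℝ E, IsInnerForm B ∧ ∀ g x y, B (ρ g x) (ρ g y) = B x y := by
  borelize G
  let μ : Measure G := Measure.haar
  let q : E → E → ℝ := fun x y => inner ℝ (toEuclidean x) (toEuclidean y)
  have hcont : ∀ x y, Continuous fun g : G => q (ρ g⁻¹ x) (ρ g⁻¹ y) := fun x y => by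
    have h1 : ∀ x, Continuous fun g : G => toEuclidean (ρ g⁻¹ x) := fun x => by fun_prop
    exact (h1 x).inner (h1 y)
  have hint : ∀ x y, Integrable (fun g : G => q (ρ g⁻¹ x) (ρ g⁻¹ y)) μ := fun x y =>
    (hcont x y).integrable_of_hasCompactSupport (HasCompactSupport.of_compactSpace _)
  let B : LinearMap.BilinForm ℝ E := LinearMap.mk₂ ℝ
    (fun x y => ∫ g, q (ρ g⁻¹ x) (ρ g⁻¹ y) ∂μ)
    (fun x x' y => by
      rw [← integral_add (hint x y) (hint x' y)]
      simp [q, inner_add_left])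
    (fun c x y => by
      rw [smul_eq_mul, ← integral_const_mul]
      simp [q, inner_smul_left])
    (fun x y y' => by
      rw [← integral_add (hint x y) (hint x y')]
      simp [q, inner_add_right])
    (fun c x y => by
      rw [smul_eq_mul, ← integral_const_mul]
      simp [q, inner_smul_right])
  have hBapply : ∀ x y, B x y = ∫ g, q (ρ g⁻¹ x) (ρ g⁻¹ y) ∂μ := fun x y => rfl
  refine ⟨B, ⟨fun x y => ?_, fun x hx => ?_⟩, fun g x y => ?_⟩
  · rw [hBapply, hBapply]
    simp only [q, real_inner_comm]
  · rw [hBapply]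
    refine (hcont x x).integral_pos_of_hasCompactSupport_nonneg_nonzero (x := 1)
      (HasCompactSupport.of_compactSpace _) (fun g => real_inner_self_nonneg) ?_
    simpa [q] using hx
  · have h1 : ∀ z h, ρ h⁻¹ (ρ g z) = ρ (g⁻¹ * h)⁻¹ z := fun z h => by
      rw [mul_inv_rev, inv_inv, map_mul]
      rfl
    simp only [hBapply, h1]
    exact integral_mul_left_eq_self (fun h => q (ρ h⁻¹ x) (ρ h⁻¹ y)) g⁻¹

end Averaging

section KillingForm

variable {𝔤 : Type*} [LieRing 𝔤] [LieAlgebra ℝ 𝔤]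

variable (𝔤) in
/-- The form `(X, Y) = -φ(X, Y)` as a bilinear form. -/
noncomputable def bilinForm : LinearMap.BilinForm ℝ 𝔤 := -killingForm ℝ 𝔤

lemma bilinForm_apply (X Y : 𝔤) : bilinForm 𝔤 X Y = form X Y := rfl

lemma bilinForm_comm (X Y : 𝔤) : bilinForm 𝔤 X Y = bilinForm 𝔤 Y X := by
  simp only [bilinForm, LinearMap.neg_apply]
  rw [LieModule.traceForm_comm]

lemma bilinForm_lie (X Y Z : 𝔤) : bilinForm 𝔤 ⁅X, Y⁆ Z = bilinForm 𝔤 X ⁅Y, Z⁆ := by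
  simp only [bilinForm, LinearMap.neg_apply]
  rw [LieModule.traceForm_apply_lie_apply]

lemma bilinForm_lie_left (X Y Z : 𝔤) : bilinForm 𝔤 ⁅X, Y⁆ Z = -bilinForm 𝔤 Y ⁅X, Z⁆ := by
  rw [← lie_skew, map_neg, LinearMap.neg_apply, bilinForm_lie]

/-- A Lie algebra without centre which has an `ad`-invariant inner product has a negative
definite Killing form. -/
theorem isInnerForm_bilinForm [FiniteDimensional ℝ 𝔤]
    {B : LinearMap.BilinForm ℝ 𝔤} (hB : IsInnerForm B)
    (hinv : ∀ X Y Z : 𝔤, B ⁅X, Y⁆ Z = -B Y ⁅X, Z⁆) (hZ : LieAlgebra.center ℝ 𝔤 = ⊥) :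
    IsInnerForm (bilinForm 𝔤) where
  symm := bilinForm_comm
  pos X hX := by
    obtain ⟨h1, h2⟩ := hB.trace_comp_self_nonpos (LieAlgebra.ad ℝ 𝔤 X) fun Y Z => hinv X Y Z
    have h3 : bilinForm 𝔤 X X =
        -LinearMap.trace ℝ 𝔤 (LieAlgebra.ad ℝ 𝔤 X ∘ₗ LieAlgebra.ad ℝ 𝔤 X) := rfl
    rw [h3]
    refine neg_pos.2 (lt_of_le_of_ne h1 fun h => hX ?_)
    have h4 : X ∈ LieAlgebra.center ℝ 𝔤 := by
      rw [LieModule.mem_maxTrivSubmodule]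
      intro Y
      rw [← lie_skew, neg_eq_zero]
      exact LinearMap.congr_fun (h2 h) Y
    rwa [hZ, LieSubmodule.mem_bot] at h4

lemma isKilling_of_isInnerForm [FiniteDimensional ℝ 𝔤] (h : IsInnerForm (bilinForm 𝔤)) :
    LieAlgebra.IsKilling ℝ 𝔤 where
  killingCompl_top_eq_bot := by
    rw [LieSubmodule.eq_bot_iff]
    intro X hX
    refine h.eq_zero_of_self_eq_zero ?_
    rw [LieIdeal.mem_killingCompl] at hX
    have h1 := hX X (LieSubmodule.mem_top X)
    simpa [bilinForm] using h1

end KillingForm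

/-! ### The Killing form and tori of a compact group -/

section CompactGroup

open NormedSpace

variable {E : Type*} [NormedAddCommGroup E] [NormedSpace ℝ E] [FiniteDimensional ℝ E]
variable {G : Type*} [TopologicalSpace G] [ChartedSpace E G] [Group G] [LieGroup 𝓘(ℝ, E) ∞ G]

instance finiteDimensional_groupLieAlgebra : FiniteDimensional ℝ (GroupLieAlgebra 𝓘(ℝ, E) G) :=
  inferInstanceAs (FiniteDimensional ℝ E)

/-- The bracket of the Lie algebra of `G` as a bilinear map on the model space. -/
noncomputable def bracketMap (E : Type*) [NormedAddCommGroup E] [NormedSpace ℝ E]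
    [FiniteDimensional ℝ E] (G : Type*) [TopologicalSpace G] [ChartedSpace E G] [Group G]
    [LieGroup 𝓘(ℝ, E) ∞ G] : E →L[ℝ] E →L[ℝ] E :=
  LinearMap.toContinuousBilinearMap (E := E) (F := E) (G := E)
    (LieModule.toEnd ℝ (GroupLieAlgebra 𝓘(ℝ, E) G) (GroupLieAlgebra 𝓘(ℝ, E) G) :
      GroupLieAlgebra 𝓘(ℝ, E) G →ₗ[ℝ] Module.End ℝ (GroupLieAlgebra 𝓘(ℝ, E) G))

omit [FiniteDimensional ℝ E] in
lemma hasDerivAt_bilinear {F : Type*} [NormedAddCommGroup F] [NormedSpace ℝ F]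
    (B : E →L[ℝ] E →L[ℝ] F) {f g : ℝ → E} {u v : E} {t : ℝ}
    (hf : HasDerivAt f u t) (hg : HasDerivAt g v t) :
    HasDerivAt (fun r => B (f r) (g r)) (B u (g t) + B (f t) v) t :=
  (B.hasFDerivAt.comp_hasDerivAt t hf).clm_apply hg

/-- The Lie algebra of a compact group has an `ad`-invariant inner product. -/
lemma exists_ad_invariant_innerForm [T2Space G] [CompactSpace G] :
    ∃ B : LinearMap.BilinForm ℝ (GroupLieAlgebra 𝓘(ℝ, E) G), IsInnerForm B ∧
      ∀ X Y Z : GroupLieAlgebra 𝓘(ℝ, E) G, B ⁅X, Y⁆ Z = -B Y ⁅X, Z⁆ := by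
  have htop : IsTopologicalGroup G := topologicalGroup_of_lieGroup 𝓘(ℝ, E) ∞
  obtain ⟨B, hB, hinv⟩ := exists_invariant_innerForm (adjointRep E G) continuous_adjointRep
  refine ⟨B, ⟨hB.symm, hB.pos⟩, fun X Y Z => ?_⟩
  obtain ⟨γ, hγ⟩ := exists_isOneParameterGroup X
  -- differentiate `B (Ad (γ t) Y) (Ad (γ t) Z) = B Y Z` at `t = 0`
  let B' : E →L[ℝ] E →L[ℝ] ℝ := LinearMap.toContinuousBilinearMap B
  have h1 := hasDerivAt_bilinear B' (hγ.hasDerivAt_adjointRep Y) (hγ.hasDerivAt_adjointRep Z)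
  have h2 : (fun t => B' (adjointRep E G (γ t) Y) (adjointRep E G (γ t) Z)) = fun _ => B' Y Z :=
    funext fun t => hinv (γ t) Y Z
  rw [h2] at h1
  have h3 := h1.unique (hasDerivAt_const (0 : ℝ) (B' (Y : E) (Z : E)))
  rw [hγ.zero, map_one] at h3
  exact eq_neg_of_add_eq_zero_left h3

/-- The Killing form of a compact Lie group with simple Lie algebra is negative definite. -/
theorem isInnerForm_of_compact [T2Space G] [CompactSpace G]
    (hG : LieAlgebra.IsSimple ℝ (GroupLieAlgebra 𝓘(ℝ, E) G)) :
    IsInnerForm (bilinForm (GroupLieAlgebra 𝓘(ℝ, E) G)) := by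
  obtain ⟨B, hB, hinv⟩ := exists_ad_invariant_innerForm (E := E) (G := G)
  refine isInnerForm_bilinForm hB hinv ?_
  rcases hG.eq_bot_or_eq_top (LieAlgebra.center ℝ (GroupLieAlgebra 𝓘(ℝ, E) G)) with h | h
  · exact h
  · exact absurd ((LieAlgebra.isLieAbelian_iff_center_eq_top ℝ _).2 h) hG.non_abelian

omit [FiniteDimensional ℝ E] in
lemma hasDerivAt_exp_smul_apply [CompleteSpace E] (D : E →L[ℝ] E) (x : E) :
    HasDerivAt (fun t : ℝ => exp (t • D) x) (D x) 0 := by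
  have h1 : HasDerivAt (fun t : ℝ => exp (t • D)) D 0 := by
    simpa using hasDerivAt_exp_smul_const (𝕂 := ℝ) D (0 : ℝ)
  have h2 := h1.clm_apply (hasDerivAt_const (0 : ℝ) x)
  simpa using h2

section Torus

variable {S : Subgroup G}

/-- The adjoint representation of `G` on its Lie algebra, restricted to a subgroup. -/
noncomputable def adjointRepOn (E : Type*) [NormedAddCommGroup E] [NormedSpace ℝ E] {G : Type*}
    [TopologicalSpace G] [ChartedSpace E G] [Group G] [LieGroup 𝓘(ℝ, E) ∞ G] (S : Subgroup G) :
    S →* (E →L[ℝ] E) :=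
  (adjointRep E G).comp S.subtype

/-- The generator of a one-parameter group of automorphisms `Ad s`, `s ∈ S`, is a derivation. -/
lemma derivation_of_mem_imageLieAlgebra {hS : ∀ a b : S, a * b = b * a} {D : E →L[ℝ] E}
    (hD : D ∈ imageLieAlgebra hS (adjointRepOn E S)) (x y : E) :
    D (bracketMap E G x y) = bracketMap E G (D x) y + bracketMap E G x (D y) := by
  have h1 := hasDerivAt_exp_smul_apply D (bracketMap E G x y)
  have h2 := hasDerivAt_bilinear (bracketMap E G) (hasDerivAt_exp_smul_apply D x)
    (hasDerivAt_exp_smul_apply D y)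
  have h3 : (fun t : ℝ => exp (t • D) (bracketMap E G x y)) =
      fun t : ℝ => bracketMap E G (exp (t • D) x) (exp (t • D) y) := by
    funext t
    obtain ⟨s, hs⟩ := hD t
    rw [hs]
    exact adjointLin_bracket (s : G) x y
  rw [h3] at h1
  simpa using h1.unique h2

lemma apply_eq_zero_of_mem_imageLieAlgebra {hS : ∀ a b : S, a * b = b * a} {D : E →L[ℝ] E}
    (hD : D ∈ imageLieAlgebra hS (adjointRepOn E S)) {x : E}
    (hx : ∀ s ∈ S, adjointRep E G s x = x) : D x = 0 := by
  have h1 := hasDerivAt_exp_smul_apply D x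
  have h2 : (fun t : ℝ => exp (t • D) x) = fun _ => x := by
    funext t
    obtain ⟨s, hs⟩ := hD t
    rw [hs]
    exact hx s s.2
  rw [h2] at h1
  exact h1.unique (hasDerivAt_const (0 : ℝ) x)

/-- Let `S` be a torus and `𝔣` the algebra of vectors fixed by `Ad S`. Then `𝔣` is the
centralizer of its own centre: the Lie algebra of `Ad S` consists of inner derivations `ad Z` with
`Z` in the centre of `𝔣`, and it determines the fixed vectors since `S` is compact and connected. -/
theorem IsTorus.adjointLin_eq_of_forall_lie_eq_zero [CompactSpace G] (hS : IsTorus S)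
    (hinner : IsInnerForm (bilinForm (GroupLieAlgebra 𝓘(ℝ, E) G)))
    {X : GroupLieAlgebra 𝓘(ℝ, E) G}
    (hX : ∀ Z : GroupLieAlgebra 𝓘(ℝ, E) G, (∀ s ∈ S, adjointLin s Z = Z) →
      (∀ U : GroupLieAlgebra 𝓘(ℝ, E) G, (∀ s ∈ S, adjointLin s U = U) → ⁅Z, U⁆ = 0) → ⁅Z, X⁆ = 0) :
    ∀ s ∈ S, adjointLin s X = X := by
  have htop : IsTopologicalGroup G := topologicalGroup_of_lieGroup 𝓘(ℝ, E) ∞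
  have hcomm : ∀ a b : S, a * b = b * a := fun a b => Subtype.ext (hS.comm a a.2 b b.2)
  have hcompact : CompactSpace S := isCompact_iff_compactSpace.1 hS.isCompact
  have hconn : ConnectedSpace S := isConnected_iff_connectedSpace.1 hS.isConnected
  have hcont : Continuous (adjointRepOn E S) :=
    continuous_adjointRep.comp continuous_subtype_val
  have hkilling := isKilling_of_isInnerForm hinner
  have hkey : ∀ D ∈ imageLieAlgebra hcomm (adjointRepOn E S), D X = 0 := by
    intro D hD
    let D' : LieDerivation ℝ (GroupLieAlgebra 𝓘(ℝ, E) G) (GroupLieAlgebra 𝓘(ℝ, E) G) :=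
      { toLinearMap := (D : E →ₗ[ℝ] E)
        leibniz' := fun x y => by
          have h := derivation_of_mem_imageLieAlgebra hD x y
          rw [← lie_skew y, sub_neg_eq_add, add_comm]
          exact h }
    obtain ⟨Z, hZ⟩ := LieDerivation.IsKilling.exists_eq_ad D'
    have hZD : ∀ W : GroupLieAlgebra 𝓘(ℝ, E) G, ⁅Z, W⁆ = D W := fun W => by
      have h := DFunLike.congr_fun hZ W
      rwa [LieDerivation.ad_apply_apply] at h
    have hfix : ∀ s ∈ S, adjointLin s Z = Z := by
      intro s hs
      rw [← sub_eq_zero, ← LieDerivation.IsKilling.ad_apply_eq_zero_iff ℝ]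
      ext W
      have h1 := adjointLin_bracket s Z (adjointLin s⁻¹ W)
      have h2 : adjointLin s (adjointLin s⁻¹ W) = W :=
        adjointRep_self_apply_inv (E := E) s W
      have h3 : adjointLin s ⁅Z, adjointLin s⁻¹ W⁆ = ⁅Z, adjointLin s (adjointLin s⁻¹ W)⁆ := by
        rw [hZD, hZD]
        exact DFunLike.congr_fun (commute_of_mem_imageLieAlgebra hD ⟨s, hs⟩) _
      rw [h2] at h1 h3
      rw [LieDerivation.ad_apply_apply, sub_lie, ← h1, h3, sub_self]
      rfl
    have hcentral : ∀ U : GroupLieAlgebra 𝓘(ℝ, E) G, (∀ s ∈ S, adjointLin s U = U) →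
        ⁅Z, U⁆ = 0 := fun U hU =>
      (hZD U).trans (apply_eq_zero_of_mem_imageLieAlgebra hD hU)
    exact (hZD X).symm.trans (hX Z hfix hcentral)
  intro s hs
  have h := apply_mul_eq_of_forall_imageLieAlgebra (hS := hcomm) hcont
    (ContinuousLinearMap.apply ℝ E (X : E)) (fun D hD a => by
      have h1 : a (D X) = 0 := by rw [hkey D hD]; exact map_zero a
      exact h1) ⟨s, hs⟩ 1
  rw [one_mul] at h
  exact h

end Torus

end CompactGroup

/-! ### The Lie algebras of a flag manifold -/

/-- The properties of the Lie algebras `𝔥 ⊆ 𝔨 ⊆ 𝔤` of a maximal torus, of the isotropy group of a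
generalized flag manifold and of the compact group `G` on which the `𝔱`-root theory rests: the
negative of the Killing form is an inner product, `𝔥` is maximal abelian, and `𝔨` is the
centralizer of its own centre. -/
structure IsFlagPair {𝔤 : Type*} [LieRing 𝔤] [LieAlgebra ℝ 𝔤] (𝔨 𝔥 : LieSubalgebra ℝ 𝔤) :
    Prop where
  inner : IsInnerForm (bilinForm 𝔤)
  le : 𝔥 ≤ 𝔨
  lie_eq_zero : ∀ X ∈ 𝔥, ∀ Y ∈ 𝔥, ⁅X, Y⁆ = 0
  mem_of_lie_eq_zero : ∀ X, (∀ Z ∈ 𝔥, ⁅Z, X⁆ = 0) → X ∈ 𝔥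
  mem_of_centre_lie_eq_zero : ∀ X, (∀ Z ∈ 𝔨, (∀ U ∈ 𝔨, ⁅Z, U⁆ = 0) → ⁅Z, X⁆ = 0) → X ∈ 𝔨

section LieAlgebraOf

variable {E : Type*} [NormedAddCommGroup E] [NormedSpace ℝ E] [FiniteDimensional ℝ E]
variable {G : Type*} [TopologicalSpace G] [ChartedSpace E G] [Group G] [LieGroup 𝓘(ℝ, E) ∞ G]

/-- The subalgebra of the vectors which are fixed by `Ad S`. -/
noncomputable def fixedSubalgebra (E : Type*) [NormedAddCommGroup E] [NormedSpace ℝ E]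
    [FiniteDimensional ℝ E] {G : Type*} [TopologicalSpace G] [ChartedSpace E G] [Group G]
    [LieGroup 𝓘(ℝ, E) ∞ G] (S : Subgroup G) :
    LieSubalgebra ℝ (GroupLieAlgebra 𝓘(ℝ, E) G) where
  carrier := {X | ∀ s ∈ S, adjointLin s X = X}
  zero_mem' s _ := map_zero _
  add_mem' {X Y} hX hY s hs := by rw [map_add, hX s hs, hY s hs]
  smul_mem' c X hX s hs := by rw [map_smul, hX s hs]
  lie_mem' {X Y} hX hY s hs := by
    have h1 := hX s hs
    have h2 := hY s hs
    exact (adjointLin_bracket s X Y).trans (by rw [h1, h2])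

lemma lieAlgebraOf_eq_fixedSubalgebra {K S : Subgroup G}
    (h : ∀ X, OneParameterIn E K X ↔ ∀ s ∈ S, adjointLin s X = X) :
    lieAlgebraOf E K = fixedSubalgebra E S := by
  have h1 : {X | OneParameterIn E K X} = (fixedSubalgebra E S : Set (GroupLieAlgebra 𝓘(ℝ, E) G)) :=
    Set.ext h
  rw [lieAlgebraOf, h1, LieSubalgebra.lieSpan_eq]

/-- The Lie algebras of a maximal torus `T` and of the centralizer of a torus `S ≤ T`. -/
theorem isFlagPair_lieAlgebraOf [T2Space G] [CompactSpace G]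
    (hG : LieAlgebra.IsSimple ℝ (GroupLieAlgebra 𝓘(ℝ, E) G)) {S T : Subgroup G}
    (hS : IsTorus S) (hT : IsMaximalTorus T) (hST : S ≤ T) :
    IsFlagPair (lieAlgebraOf E (Subgroup.centralizer (S : Set G))) (lieAlgebraOf E T) := by
  have hinner := isInnerForm_of_compact hG
  have hTmem : ∀ X : GroupLieAlgebra 𝓘(ℝ, E) G, OneParameterIn E T X ↔
      ∀ s ∈ T, adjointLin s X = X := fun X => hT.oneParameterIn_iff
  rw [lieAlgebraOf_eq_fixedSubalgebra hTmem,
    lieAlgebraOf_eq_fixedSubalgebra (S := S) fun X => oneParameterIn_centralizer_iff]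
  have habel : ∀ X ∈ fixedSubalgebra E T, ∀ Y ∈ fixedSubalgebra E T, ⁅X, Y⁆ = 0 := by
    intro X hX Y hY
    obtain ⟨γ, hγ, hγT⟩ := FlagManifold.oneParameterIn_iff.1 ((hTmem X).2 hX)
    have h1 := hγ.hasDerivAt_adjointRep Y
    have h2 : (fun t => adjointRep E G (γ t) (Y : E)) = fun _ => (Y : E) :=
      funext fun t => hY (γ t) (hγT t)
    rw [h2] at h1
    exact h1.unique (hasDerivAt_const (F := E) (0 : ℝ) Y)
  refine ⟨hinner, fun X hX s hs => hX s (hST hs), habel, fun X hX => ?_, fun X hX => ?_⟩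
  · exact hT.prop.adjointLin_eq_of_forall_lie_eq_zero hinner fun Z hZ _ => hX Z hZ
  · exact hS.adjointLin_eq_of_forall_lie_eq_zero hinner fun Z hZ hZU => hX Z hZ hZU

end LieAlgebraOf

/-! ### Weight modules and their moment elements -/

section WeightSpace

variable {𝔤 : Type*} [LieRing 𝔤] [LieAlgebra ℝ 𝔤] {𝔨 𝔥 : LieSubalgebra ℝ 𝔤}

/-- An element of `𝔱 = Z(𝔨)` as an element of `𝔤`. -/
def centreVal (Z : centre 𝔨 𝔥) : 𝔤 := ((Z : 𝔥) : 𝔤)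

lemma mem_centre_iff {Z : 𝔥} : Z ∈ centre 𝔨 𝔥 ↔ (Z : 𝔤) ∈ 𝔨 ∧ ∀ U ∈ 𝔨, ⁅(Z : 𝔤), U⁆ = 0 := by
  rw [centre, Submodule.mem_comap, Submodule.mem_map]
  constructor
  · rintro ⟨Z', hZ', h⟩
    have h' : (Z' : 𝔤) = (Z : 𝔤) := h
    refine ⟨h' ▸ Z'.2, fun U hU => ?_⟩
    have h1 := (LieModule.mem_maxTrivSubmodule ℝ 𝔨 𝔨 Z').1 hZ' ⟨U, hU⟩
    have h2 : ⁅U, (Z' : 𝔤)⁆ = 0 := congrArg Subtype.val h1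
    rw [← h', ← lie_skew, h2, neg_zero]
  · rintro ⟨h1, h2⟩
    refine ⟨⟨Z, h1⟩, (LieModule.mem_maxTrivSubmodule ℝ 𝔨 𝔨 _).2 fun U => Subtype.ext ?_, rfl⟩
    have h3 := h2 U U.2
    change ⁅(U : 𝔤), (Z : 𝔤)⁆ = 0
    rw [← lie_skew, h3, neg_zero]

lemma centreVal_mem (Z : centre 𝔨 𝔥) : centreVal Z ∈ 𝔨 := (mem_centre_iff.1 Z.2).1

lemma centreVal_lie (Z : centre 𝔨 𝔥) {U : 𝔤} (hU : U ∈ 𝔨) : ⁅centreVal Z, U⁆ = 0 :=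
  (mem_centre_iff.1 Z.2).2 U hU

lemma lie_centreVal (Z : centre 𝔨 𝔥) {U : 𝔤} (hU : U ∈ 𝔨) : ⁅U, centreVal Z⁆ = 0 := by
  rw [← lie_skew, centreVal_lie Z hU, neg_zero]

lemma centreVal_add (Z Z' : centre 𝔨 𝔥) : centreVal (Z + Z') = centreVal Z + centreVal Z' := rfl

lemma centreVal_smul (c : ℝ) (Z : centre 𝔨 𝔥) : centreVal (c • Z) = c • centreVal Z := rfl

lemma centreVal_neg (Z : centre 𝔨 𝔥) : centreVal (-Z) = -centreVal Z := rfl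

/-- The centre commutes with the isotropy algebra, hence its action commutes with that of `𝔨`. -/
lemma lie_centreVal_lie (Z : centre 𝔨 𝔥) {U : 𝔤} (hU : U ∈ 𝔨) (x : 𝔤) :
    ⁅U, ⁅centreVal Z, x⁆⁆ = ⁅centreVal Z, ⁅U, x⁆⁆ := by
  rw [leibniz_lie U, lie_centreVal Z hU, zero_lie, zero_add]

namespace IsFlagPair

variable (hp : IsFlagPair 𝔨 𝔥)
include hp

lemma exists_centreVal_eq {Z : 𝔤} (hZ : Z ∈ 𝔨) (h : ∀ U ∈ 𝔨, ⁅Z, U⁆ = 0) :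
    ∃ Z' : centre 𝔨 𝔥, centreVal Z' = Z := by
  have h1 : Z ∈ 𝔥 := hp.mem_of_lie_eq_zero Z fun W hW => by
    rw [← lie_skew, h W (hp.le hW), neg_zero]
  exact ⟨⟨⟨Z, h1⟩, mem_centre_iff.2 ⟨hZ, h⟩⟩, rfl⟩

lemma mem_of_forall_centreVal {X : 𝔤} (h : ∀ Z : centre 𝔨 𝔥, ⁅centreVal Z, X⁆ = 0) : X ∈ 𝔨 :=
  hp.mem_of_centre_lie_eq_zero X fun Z hZ hZU => by
    obtain ⟨Z', rfl⟩ := hp.exists_centreVal_eq hZ hZU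
    exact h Z'

end IsFlagPair

/-- `V` is an `ad(𝔨)`-submodule of `𝔤` on which `𝔱` acts through the real linear form `l`:
with the complex structure `J = ad Z₀` on `V`, where `Z₀ ∈ 𝔱`, every `Z ∈ 𝔱` acts as `l(Z) J`.
In the complexification, `V` lies in the sum of the weight spaces of `i l` and `-i l`. -/
structure IsWeightModule (V : Submodule ℝ 𝔤) (l : centre 𝔨 𝔥 →ₗ[ℝ] ℝ) (Z₀ : centre 𝔨 𝔥) :
    Prop where
  stable : ∀ U ∈ 𝔨, ∀ x ∈ V, ⁅U, x⁆ ∈ V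
  lie_eq : ∀ Z : centre 𝔨 𝔥, ∀ x ∈ V, ⁅centreVal Z, x⁆ = l Z • ⁅centreVal Z₀, x⁆
  sq : ∀ x ∈ V, ⁅centreVal Z₀, ⁅centreVal Z₀, x⁆⁆ = -x

namespace IsWeightModule

variable {V V₁ V₂ : Submodule ℝ 𝔤} {l l₁ l₂ : centre 𝔨 𝔥 →ₗ[ℝ] ℝ} {Z₀ Z₁ Z₂ : centre 𝔨 𝔥}

lemma mem_J (hV : IsWeightModule V l Z₀) {x : 𝔤} (hx : x ∈ V) : ⁅centreVal Z₀, x⁆ ∈ V :=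
  hV.stable _ (centreVal_mem Z₀) x hx

lemma apply_self (hV : IsWeightModule V l Z₀) (hne : V ≠ ⊥) : l Z₀ = 1 := by
  obtain ⟨x, hx, hx0⟩ := Submodule.exists_mem_ne_zero_of_ne_bot hne
  have h1 := congrArg (fun y => ⁅centreVal Z₀, y⁆) (hV.lie_eq Z₀ x hx)
  simp only [lie_smul, hV.sq x hx, smul_neg, neg_inj] at h1
  have h2 : (l Z₀ - 1) • x = 0 := by rw [sub_smul, one_smul, ← h1, sub_self]
  rcases smul_eq_zero.1 h2 with h | h
  · linarith
  · exact absurd h hx0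

/-- The opposite complex structure. -/
lemma neg (hV : IsWeightModule V l Z₀) : IsWeightModule V (-l) (-Z₀) where
  stable := hV.stable
  lie_eq Z x hx := by
    rw [centreVal_neg, neg_lie, LinearMap.neg_apply, neg_smul_neg]
    exact hV.lie_eq Z x hx
  sq x hx := by
    rw [centreVal_neg, neg_lie, neg_lie, lie_neg, neg_neg]
    exact hV.sq x hx

/-- The value at `C ∈ 𝔨` of the moment map `∑ [x_a, J x_a]` is a trace. -/
lemma sum_bilinForm_eq_neg_trace (hV : IsWeightModule V l Z₀) {ι : Type*} [Fintype ι]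
    [DecidableEq ι] {b : Module.Basis ι ℝ V}
    (hb : ∀ i j, (bilinForm 𝔤).restrict V (b i) (b j) = if i = j then 1 else 0)
    {C : 𝔤} (hC : C ∈ 𝔨) :
    bilinForm 𝔤 (∑ i, ⁅(b i : 𝔤), ⁅centreVal Z₀, (b i : 𝔤)⁆⁆) C =
      -LinearMap.trace ℝ V ((LieAlgebra.ad ℝ 𝔤 C).restrict (hV.stable C hC) *
        (LieAlgebra.ad ℝ 𝔤 (centreVal Z₀)).restrict
          (hV.stable (centreVal Z₀) (centreVal_mem Z₀))) := by
  rw [IsInnerForm.trace_eq_sum hb, map_sum, LinearMap.sum_apply, ← Finset.sum_neg_distrib]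
  refine Finset.sum_congr rfl fun i _ => ?_
  rw [bilinForm_lie, ← lie_skew, map_neg]
  rfl

variable (hp : IsFlagPair 𝔨 𝔥)
include hp

/-- The moment map element `∑ [x_a, J x_a]`, the sum being over an orthonormal basis of `V`, lies
in `𝔱` and represents the linear form `dim V • l`. -/
lemma exists_moment [FiniteDimensional ℝ 𝔤] (hV : IsWeightModule V l Z₀) {ι : Type*} [Fintype ι]
    [DecidableEq ι] {b : Module.Basis ι ℝ V}
    (hb : ∀ i j, (bilinForm 𝔤).restrict V (b i) (b j) = if i = j then 1 else 0) :
    ∃ H : centre 𝔨 𝔥, centreVal H = ∑ i, ⁅(b i : 𝔤), ⁅centreVal Z₀, (b i : 𝔤)⁆⁆ ∧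
      ∀ Z, bilinForm 𝔤 (centreVal H) (centreVal Z) = Fintype.card ι * l Z := by
  set h := ∑ i, ⁅(b i : 𝔤), ⁅centreVal Z₀, (b i : 𝔤)⁆⁆ with hh
  have hk : h ∈ 𝔨 := hp.mem_of_forall_centreVal fun Z => by
    rw [hh, lie_sum]
    refine Finset.sum_eq_zero fun i _ => ?_
    rw [leibniz_lie, hV.lie_eq Z _ (b i).2, hV.lie_eq Z _ (hV.mem_J (b i).2), hV.sq _ (b i).2]
    simp
  have hcentral : ∀ U ∈ 𝔨, ⁅h, U⁆ = 0 := by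
    intro U hU
    refine hp.inner.eq_zero_of_self_eq_zero ?_
    have hA : ⁅h, U⁆ ∈ 𝔨 := 𝔨.lie_mem hk hU
    rw [bilinForm_lie, hh, hV.sum_bilinForm_eq_neg_trace hb (𝔨.lie_mem hU hA)]
    let f : ∀ C ∈ 𝔨, Module.End ℝ V := fun C hC => (LieAlgebra.ad ℝ 𝔤 C).restrict (hV.stable C hC)
    have h1 : f ⁅U, ⁅h, U⁆⁆ (𝔨.lie_mem hU hA) = f U hU * f _ hA - f _ hA * f U hU :=
      LinearMap.ext fun x => Subtype.ext (lie_lie U ⁅h, U⁆ (x : 𝔤))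
    have h2 : f U hU * f _ (centreVal_mem Z₀) = f _ (centreVal_mem Z₀) * f U hU :=
      LinearMap.ext fun x => Subtype.ext (lie_centreVal_lie Z₀ hU (x : 𝔤))
    change -LinearMap.trace ℝ V (f _ (𝔨.lie_mem hU hA) * f _ (centreVal_mem Z₀)) = 0
    rw [h1, sub_mul, mul_assoc _ (f U hU), h2, map_sub, mul_assoc, LinearMap.trace_mul_comm,
      mul_assoc, sub_self, neg_zero]
  obtain ⟨H, hH⟩ := hp.exists_centreVal_eq hk hcentral
  refine ⟨H, hH, fun Z => ?_⟩
  rw [hH, hh, map_sum, LinearMap.sum_apply]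
  have h1 : ∀ i, bilinForm 𝔤 ⁅(b i : 𝔤), ⁅centreVal Z₀, (b i : 𝔤)⁆⁆ (centreVal Z) = l Z := by
    intro i
    have h2 : bilinForm 𝔤 (b i : 𝔤) (b i : 𝔤) = 1 := by simpa using hb i i
    rw [bilinForm_lie, ← lie_skew, hV.lie_eq Z _ (hV.mem_J (b i).2), hV.sq _ (b i).2, smul_neg,
      neg_neg, map_smul, h2, smul_eq_mul, mul_one]
  simp [h1]

end IsWeightModule

end WeightSpace

/-! ### Brackets of weight modules -/

section WeightModules

variable {𝔤 : Type*} [LieRing 𝔤] [LieAlgebra ℝ 𝔤] {𝔨 𝔥 : LieSubalgebra ℝ 𝔤}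
variable {V V₁ V₂ V₃ : Submodule ℝ 𝔤} {l l₁ l₂ l₃ : centre 𝔨 𝔥 →ₗ[ℝ] ℝ} {Z₀ Z₁ Z₂ Z₃ : centre 𝔨 𝔥}

/-- The largest weight module with the given linear form and complex structure. -/
def weightSpace (l : centre 𝔨 𝔥 →ₗ[ℝ] ℝ) (Z₀ : centre 𝔨 𝔥) : Submodule ℝ 𝔤 where
  carrier := {x | (∀ Z : centre 𝔨 𝔥, ⁅centreVal Z, x⁆ = l Z • ⁅centreVal Z₀, x⁆) ∧
    ⁅centreVal Z₀, ⁅centreVal Z₀, x⁆⁆ = -x}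
  zero_mem' := by simp
  add_mem' := by
    rintro x y ⟨h1, h2⟩ ⟨h3, h4⟩
    refine ⟨fun Z => ?_, ?_⟩
    · rw [lie_add, lie_add, smul_add, h1, h3]
    · rw [lie_add, lie_add, h2, h4, neg_add]
  smul_mem' := by
    rintro c x ⟨h1, h2⟩
    refine ⟨fun Z => ?_, ?_⟩
    · rw [lie_smul, lie_smul, h1, smul_comm]
    · rw [lie_smul, lie_smul, h2, smul_neg]

lemma isWeightModule_weightSpace (l : centre 𝔨 𝔥 →ₗ[ℝ] ℝ) (Z₀ : centre 𝔨 𝔥) :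
    IsWeightModule (weightSpace l Z₀) l Z₀ where
  stable U hU x hx := by
    refine ⟨fun Z => ?_, ?_⟩
    · rw [← lie_centreVal_lie Z hU, ← lie_centreVal_lie Z₀ hU, hx.1, lie_smul]
    · rw [← lie_centreVal_lie Z₀ hU, ← lie_centreVal_lie Z₀ hU, hx.2, lie_neg]
  lie_eq Z x hx := hx.1 Z
  sq x hx := hx.2

namespace IsWeightModule

lemma le_weightSpace (hV : IsWeightModule V l Z₀) : V ≤ weightSpace l Z₀ :=
  fun x hx => ⟨fun Z => hV.lie_eq Z x hx, hV.sq x hx⟩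

lemma lie_lie_eq (hV₁ : IsWeightModule V₁ l₁ Z₁) (hV₂ : IsWeightModule V₂ l₂ Z₂)
    (Z : centre 𝔨 𝔥) {x y : 𝔤} (hx : x ∈ V₁) (hy : y ∈ V₂) :
    ⁅centreVal Z, ⁅x, y⁆⁆ = l₁ Z • ⁅⁅centreVal Z₁, x⁆, y⁆ + l₂ Z • ⁅x, ⁅centreVal Z₂, y⁆⁆ := by
  rw [leibniz_lie, hV₁.lie_eq Z x hx, hV₂.lie_eq Z y hy, smul_lie, lie_smul]

lemma lie_J_left (hV : IsWeightModule V l Z₀) (Z : centre 𝔨 𝔥) {x : 𝔤} (hx : x ∈ V) :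
    ⁅centreVal Z, ⁅centreVal Z₀, x⁆⁆ = -l Z • x := by
  rw [hV.lie_eq Z _ (hV.mem_J hx), hV.sq x hx, smul_neg, neg_smul]

/-- The product of `[x, J x]` and `[y, J y]` is a sum of squares as soon as `[x, y] = [J x, J y]`
throughout. -/
lemma bilinForm_lie_J_nonneg (hp : IsFlagPair 𝔨 𝔥)
    (hV₂ : IsWeightModule V₂ l₂ Z₂)
    (h : ∀ x ∈ V₁, ∀ y ∈ V₂, ⁅x, y⁆ = ⁅⁅centreVal Z₁, x⁆, ⁅centreVal Z₂, y⁆⁆)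
    {x y : 𝔤} (hx : x ∈ V₁) (hy : y ∈ V₂) :
    0 ≤ bilinForm 𝔤 ⁅x, ⁅centreVal Z₁, x⁆⁆ ⁅y, ⁅centreVal Z₂, y⁆⁆ := by
  have h1 := h x hx y hy
  have h2 := h x hx _ (hV₂.mem_J hy)
  rw [hV₂.sq y hy, lie_neg] at h2
  rw [bilinForm_lie, leibniz_lie ⁅centreVal Z₁, x⁆, map_add, ← bilinForm_lie x y, ← h1,
    ← lie_skew _ ⁅centreVal Z₂, y⁆, map_neg, ← bilinForm_lie x, h2, map_neg, LinearMap.neg_apply,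
    neg_neg]
  exact add_nonneg (hp.inner.self_nonneg _) (hp.inner.self_nonneg _)

variable [FiniteDimensional ℝ 𝔤] (hp : IsFlagPair 𝔨 𝔥)
include hp

lemma exists_dual (hV : IsWeightModule V l Z₀) (hne : V ≠ ⊥) :
    ∃ H : centre 𝔨 𝔥, ∀ Z, bilinForm 𝔤 (centreVal H) (centreVal Z) = l Z := by
  obtain ⟨b, hb⟩ := (hp.inner.restrict V).exists_orthonormal_basis
  obtain ⟨M, -, hM⟩ := hV.exists_moment hp hb
  have hn : (Module.finrank ℝ V : ℝ) ≠ 0 := by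
    rw [Ne, Nat.cast_eq_zero, Submodule.finrank_eq_zero]
    exact hne
  refine ⟨(Module.finrank ℝ V : ℝ)⁻¹ • M, fun Z => ?_⟩
  rw [centreVal_smul, map_smul, LinearMap.smul_apply, hM, Fintype.card_fin, smul_eq_mul,
    inv_mul_cancel_left₀ hn]

/-- If the bracket of two weight modules is antilinear in the sense that `[x, y] = [J x, J y]`,
the dual vectors of their linear forms enclose a non-obtuse angle. -/
theorem bilinForm_dual_nonneg (hV₁ : IsWeightModule V₁ l₁ Z₁) (hV₂ : IsWeightModule V₂ l₂ Z₂)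
    (hne₁ : V₁ ≠ ⊥) (hne₂ : V₂ ≠ ⊥)
    (h : ∀ x ∈ V₁, ∀ y ∈ V₂, ⁅x, y⁆ = ⁅⁅centreVal Z₁, x⁆, ⁅centreVal Z₂, y⁆⁆)
    {H₁ H₂ : centre 𝔨 𝔥} (hH₁ : ∀ Z, bilinForm 𝔤 (centreVal H₁) (centreVal Z) = l₁ Z)
    (hH₂ : ∀ Z, bilinForm 𝔤 (centreVal H₂) (centreVal Z) = l₂ Z) :
    0 ≤ bilinForm 𝔤 (centreVal H₁) (centreVal H₂) := by
  obtain ⟨b₁, hb₁⟩ := (hp.inner.restrict V₁).exists_orthonormal_basis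
  obtain ⟨b₂, hb₂⟩ := (hp.inner.restrict V₂).exists_orthonormal_basis
  obtain ⟨M₁, hM₁, hM₁'⟩ := hV₁.exists_moment hp hb₁
  obtain ⟨M₂, hM₂, hM₂'⟩ := hV₂.exists_moment hp hb₂
  rw [Fintype.card_fin] at hM₁' hM₂'
  have hn₁ : 0 < (Module.finrank ℝ V₁ : ℝ) := by
    rw [Nat.cast_pos, Nat.pos_iff_ne_zero, Ne, Submodule.finrank_eq_zero]
    exact hne₁
  have hn₂ : 0 < (Module.finrank ℝ V₂ : ℝ) := by
    rw [Nat.cast_pos, Nat.pos_iff_ne_zero, Ne, Submodule.finrank_eq_zero]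
    exact hne₂
  have h1 : bilinForm 𝔤 (centreVal M₁) (centreVal M₂) =
      Module.finrank ℝ V₁ *
        (Module.finrank ℝ V₂ * bilinForm 𝔤 (centreVal H₁) (centreVal H₂)) := by
    rw [hM₁', ← hH₁, bilinForm_comm, hM₂', ← hH₂, bilinForm_comm]
  have h2 : 0 ≤ bilinForm 𝔤 (centreVal M₁) (centreVal M₂) := by
    rw [hM₁, hM₂, LinearMap.map_sum₂]
    refine Finset.sum_nonneg fun i _ => ?_
    rw [map_sum]
    exact Finset.sum_nonneg fun j _ =>
      bilinForm_lie_J_nonneg hp hV₂ h (b₁ i).2 (b₂ j).2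
  rw [h1] at h2
  exact nonneg_of_mul_nonneg_right (nonneg_of_mul_nonneg_right h2 hn₁) hn₂

omit [FiniteDimensional ℝ 𝔤] in
lemma bilinForm_dual_pos (hV : IsWeightModule V l Z₀) (hne : V ≠ ⊥) {H : centre 𝔨 𝔥}
    (hH : ∀ Z, bilinForm 𝔤 (centreVal H) (centreVal Z) = l Z) :
    0 < bilinForm 𝔤 (centreVal H) (centreVal H) := by
  refine hp.inner.pos _ fun h => ?_
  have h1 := hH Z₀
  rw [h, map_zero, LinearMap.zero_apply, hV.apply_self hne] at h1
  exact zero_ne_one h1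

omit [FiniteDimensional ℝ 𝔤] in
/-- A weight module and a weight module for the same weight which is orthogonal to it satisfy
`[x, y] = -[J x, J y]`: the sum of the two sides lies in `𝔨`, and is orthogonal to it. -/
lemma lie_add_lie_J_eq_zero (hV₁ : IsWeightModule V₁ l Z₀) (hV₂ : IsWeightModule V₂ l Z₀)
    (h : ∀ x ∈ V₁, ∀ y ∈ V₂, bilinForm 𝔤 x y = 0) {x y : 𝔤} (hx : x ∈ V₁) (hy : y ∈ V₂) :
    ⁅x, y⁆ + ⁅⁅centreVal Z₀, x⁆, ⁅centreVal Z₀, y⁆⁆ = 0 := by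
  set A := ⁅x, y⁆ + ⁅⁅centreVal Z₀, x⁆, ⁅centreVal Z₀, y⁆⁆ with hA
  have hAk : A ∈ 𝔨 := hp.mem_of_forall_centreVal fun Z => by
    rw [hA, lie_add, hV₁.lie_lie_eq hV₂ Z hx hy,
      hV₁.lie_lie_eq hV₂ Z (hV₁.mem_J hx) (hV₂.mem_J hy), hV₁.sq x hx, hV₂.sq y hy, neg_lie,
      lie_neg]
    module
  have h1 : ∀ x ∈ V₁, ∀ y ∈ V₂, bilinForm 𝔤 ⁅x, y⁆ A = 0 := fun x hx y hy => by
    rw [bilinForm_lie_left, ← lie_skew, map_neg, neg_neg, bilinForm_comm]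
    exact h _ (hV₁.stable A hAk x hx) y hy
  refine hp.inner.eq_zero_of_self_eq_zero ?_
  conv_lhs => enter [1]; rw [hA]
  rw [LinearMap.map_add₂, h1 x hx y hy, h1 _ (hV₁.mem_J hx) _ (hV₂.mem_J hy), add_zero]

/-- A nonzero weight module is the whole weight space: the orthogonal complement in the weight
space would have, with the opposite complex structure, a linear form whose dual vector encloses
a non-obtuse angle with its own negative. -/
theorem eq_weightSpace (hV : IsWeightModule V l Z₀) (hne : V ≠ ⊥) : V = weightSpace l Z₀ := by
  refine le_antisymm hV.le_weightSpace fun w hw => ?_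
  have hW := isWeightModule_weightSpace l Z₀
  let V' : Submodule ℝ 𝔤 :=
    { carrier := {x | x ∈ weightSpace l Z₀ ∧ ∀ v ∈ V, bilinForm 𝔤 v x = 0}
      zero_mem' := ⟨zero_mem _, fun v _ => map_zero _⟩
      add_mem' := fun {x y} hx hy => ⟨add_mem hx.1 hy.1, fun v hv => by
        rw [map_add, hx.2 v hv, hy.2 v hv, add_zero]⟩
      smul_mem' := fun c x hx => ⟨Submodule.smul_mem _ c hx.1, fun v hv => by
        rw [map_smul, hx.2 v hv, smul_zero]⟩ }
  have hV' : IsWeightModule V' l Z₀ :=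
    { stable := fun U hU x hx => ⟨hW.stable U hU x hx.1, fun v hv => by
        rw [bilinForm_comm, bilinForm_lie_left, bilinForm_comm, hx.2 _ (hV.stable U hU v hv),
          neg_zero]⟩
      lie_eq := fun Z x hx => hW.lie_eq Z x hx.1
      sq := fun x hx => hW.sq x hx.1 }
  have hbot : V' = ⊥ := by
    by_contra hne'
    obtain ⟨H, hH⟩ := hV.exists_dual hp hne
    have h1 := hV.bilinForm_dual_nonneg hp hV'.neg hne hne' (fun x hx y hy => by
      rw [centreVal_neg, neg_lie, lie_neg]
      exact eq_neg_of_add_eq_zero_left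
        (hV.lie_add_lie_J_eq_zero hp hV' (fun x hx y hy => hy.2 x hx) hx hy)) hH
      (H₂ := -H) (fun Z => by rw [centreVal_neg, map_neg, LinearMap.neg_apply, hH]; rfl)
    rw [centreVal_neg, map_neg] at h1
    linarith [hV.bilinForm_dual_pos hp hne hH]
  obtain ⟨p, hp1, hp2⟩ := hp.inner.exists_orthogonal_projection V w
  have h2 : w - p ∈ V' := ⟨sub_mem hw (hV.le_weightSpace hp1), hp2⟩
  rw [hbot, Submodule.mem_bot, sub_eq_zero] at h2
  exact h2 ▸ hp1

/-- If `l₁ + l₂ + l₃ = 0` and `[V₁, V₂]` is orthogonal to the full weight space `V₃`, then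
`[x, y] = [J x, J y]`, since the difference of the two sides lies in `V₃`. -/
lemma lie_eq_of_forall_bilinForm_eq_zero (hV₁ : IsWeightModule V₁ l₁ Z₁)
    (hV₂ : IsWeightModule V₂ l₂ Z₂) (hV₃ : IsWeightModule V₃ l₃ Z₃) (hne : V₃ ≠ ⊥)
    (hl : l₁ + l₂ + l₃ = 0)
    (h : ∀ x ∈ V₁, ∀ y ∈ V₂, ∀ z ∈ V₃, bilinForm 𝔤 ⁅x, y⁆ z = 0) :
    ∀ x ∈ V₁, ∀ y ∈ V₂, ⁅x, y⁆ = ⁅⁅centreVal Z₁, x⁆, ⁅centreVal Z₂, y⁆⁆ := by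
  intro x hx y hy
  have hl' : ∀ Z, l₁ Z + l₂ Z = -l₃ Z := fun Z => by
    have h1 := LinearMap.congr_fun hl Z
    simp only [LinearMap.add_apply, LinearMap.zero_apply] at h1
    linarith
  have h3 := hV₃.apply_self hne
  set w := ⁅x, y⁆ - ⁅⁅centreVal Z₁, x⁆, ⁅centreVal Z₂, y⁆⁆ with hw
  set u := ⁅⁅centreVal Z₁, x⁆, y⁆ + ⁅x, ⁅centreVal Z₂, y⁆⁆ with hu
  have h4 : ∀ Z, ⁅centreVal Z, w⁆ = -l₃ Z • u := fun Z => by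
    rw [← hl', hw, lie_sub, hV₁.lie_lie_eq hV₂ Z hx hy,
      hV₁.lie_lie_eq hV₂ Z (hV₁.mem_J hx) (hV₂.mem_J hy), hV₁.sq x hx, hV₂.sq y hy, neg_lie,
      lie_neg, hu]
    module
  have h5 : ∀ Z, ⁅centreVal Z, u⁆ = l₃ Z • w := fun Z => by
    rw [← neg_neg (l₃ Z), ← hl', hu, lie_add, hV₁.lie_lie_eq hV₂ Z (hV₁.mem_J hx) hy,
      hV₁.lie_lie_eq hV₂ Z hx (hV₂.mem_J hy), hV₁.sq x hx, hV₂.sq y hy, neg_lie, lie_neg, hw]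
    module
  have h6 : w ∈ V₃ := by
    rw [hV₃.eq_weightSpace hp hne]
    refine ⟨fun Z => ?_, ?_⟩
    · rw [h4, h4, h3]
      module
    · rw [h4, lie_smul, h5, h3]
      module
  have h7 : w = 0 := hp.inner.eq_zero_of_self_eq_zero (by
    conv_lhs => enter [1]; rw [hw]
    rw [LinearMap.map_sub₂, h x hx y hy w h6,
      h _ (hV₁.mem_J hx) _ (hV₂.mem_J hy) w h6, sub_zero])
  exact sub_eq_zero.1 h7

/-- Three nonzero weight modules whose linear forms sum to zero are linked by the bracket. -/
theorem exists_bilinForm_lie_ne_zero (hV₁ : IsWeightModule V₁ l₁ Z₁)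
    (hV₂ : IsWeightModule V₂ l₂ Z₂) (hV₃ : IsWeightModule V₃ l₃ Z₃)
    (hne₁ : V₁ ≠ ⊥) (hne₂ : V₂ ≠ ⊥) (hne₃ : V₃ ≠ ⊥) (hl : l₁ + l₂ + l₃ = 0) :
    ∃ x ∈ V₁, ∃ y ∈ V₂, ∃ z ∈ V₃, bilinForm 𝔤 ⁅x, y⁆ z ≠ 0 := by
  by_contra! h
  obtain ⟨H₁, hH₁⟩ := hV₁.exists_dual hp hne₁
  obtain ⟨H₂, hH₂⟩ := hV₂.exists_dual hp hne₂
  obtain ⟨H₃, hH₃⟩ := hV₃.exists_dual hp hne₃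
  have h12 := hV₁.bilinForm_dual_nonneg hp hV₂ hne₁ hne₂
    (hV₁.lie_eq_of_forall_bilinForm_eq_zero hp hV₂ hV₃ hne₃ hl h) hH₁ hH₂
  have h13 := hV₁.bilinForm_dual_nonneg hp hV₃ hne₁ hne₃
    (hV₁.lie_eq_of_forall_bilinForm_eq_zero hp hV₃ hV₂ hne₂ (by rw [← hl]; abel)
      fun x hx z hz y hy => by
        rw [bilinForm_lie, ← lie_skew, map_neg, ← bilinForm_lie, h x hx y hy z hz, neg_zero])
    hH₁ hH₃
  have h1 : bilinForm 𝔤 (centreVal H₁) (centreVal H₁) +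
      bilinForm 𝔤 (centreVal H₁) (centreVal H₂) +
      bilinForm 𝔤 (centreVal H₁) (centreVal H₃) = 0 := by
    rw [bilinForm_comm _ (centreVal H₂), bilinForm_comm _ (centreVal H₃), hH₁, hH₂, hH₃]
    exact LinearMap.congr_fun hl H₁
  linarith [hV₁.bilinForm_dual_pos hp hne₁ hH₁]

omit [FiniteDimensional ℝ 𝔤] hp in
/-- Conversely, if three weight modules are linked by the bracket, a signed sum of their linear
forms vanishes. -/
theorem exists_sign_add_eq_zero (hV₁ : IsWeightModule V₁ l₁ Z₁)
    (hV₂ : IsWeightModule V₂ l₂ Z₂) (hV₃ : IsWeightModule V₃ l₃ Z₃)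
    {x y z : 𝔤} (hx : x ∈ V₁) (hy : y ∈ V₂) (hz : z ∈ V₃) (h : bilinForm 𝔤 ⁅x, y⁆ z ≠ 0) :
    ∃ ε δ : ℝ, (ε = 1 ∨ ε = -1) ∧ (δ = 1 ∨ δ = -1) ∧ l₁ + ε • l₂ + δ • l₃ = 0 := by
  have hinv : ∀ Z, ∀ x ∈ V₁, ∀ y ∈ V₂, ∀ z ∈ V₃, l₁ Z * bilinForm 𝔤 ⁅⁅centreVal Z₁, x⁆, y⁆ z +
      l₂ Z * bilinForm 𝔤 ⁅x, ⁅centreVal Z₂, y⁆⁆ z +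
      l₃ Z * bilinForm 𝔤 ⁅x, y⁆ ⁅centreVal Z₃, z⁆ = 0 := by
    intro Z x hx y hy z hz
    have h1 := bilinForm_lie_left (centreVal Z) ⁅x, y⁆ z
    rw [hV₁.lie_lie_eq hV₂ Z hx hy, hV₃.lie_eq Z z hz] at h1
    simp only [map_add, map_smul, LinearMap.add_apply, LinearMap.smul_apply, smul_eq_mul] at h1
    linarith
  set J₁ := centreVal Z₁
  set J₂ := centreVal Z₂
  set J₃ := centreVal Z₃
  set t0 := bilinForm 𝔤 ⁅x, y⁆ z with ht0
  set t1 := bilinForm 𝔤 ⁅⁅J₁, x⁆, ⁅J₂, y⁆⁆ z with ht1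
  set t2 := bilinForm 𝔤 ⁅⁅J₁, x⁆, y⁆ ⁅J₃, z⁆ with ht2
  set t3 := bilinForm 𝔤 ⁅x, ⁅J₂, y⁆⁆ ⁅J₃, z⁆ with ht3
  have e1 : ∀ Z, -l₁ Z * t0 + l₂ Z * t1 + l₃ Z * t2 = 0 := fun Z => by
    have := hinv Z _ (hV₁.mem_J hx) y hy z hz
    rw [hV₁.sq x hx, neg_lie, map_neg, LinearMap.neg_apply] at this
    linarith
  have e2 : ∀ Z, l₁ Z * t1 - l₂ Z * t0 + l₃ Z * t3 = 0 := fun Z => by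
    have := hinv Z x hx _ (hV₂.mem_J hy) z hz
    rw [hV₂.sq y hy, lie_neg, map_neg, LinearMap.neg_apply] at this
    linarith
  have e3 : ∀ Z, l₁ Z * t2 + l₂ Z * t3 - l₃ Z * t0 = 0 := fun Z => by
    have := hinv Z x hx y hy _ (hV₃.mem_J hz)
    rw [hV₃.sq z hz, map_neg] at this
    linarith
  have e4 : ∀ Z, l₁ Z * t3 + l₂ Z * t2 + l₃ Z * t1 = 0 := fun Z => by
    have := hinv Z _ (hV₁.mem_J hx) _ (hV₂.mem_J hy) _ (hV₃.mem_J hz)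
    rw [hV₁.sq x hx, hV₂.sq y hy, hV₃.sq z hz, neg_lie, lie_neg, map_neg, map_neg, map_neg,
      LinearMap.neg_apply, LinearMap.neg_apply] at this
    linarith
  -- the component of the trilinear form for the signs `ε`, `δ`
  have key : ∀ ε δ : ℝ, (ε = 1 ∨ ε = -1) → (δ = 1 ∨ δ = -1) →
      t0 + ε * t1 + δ * t2 - ε * δ * t3 ≠ 0 →
      ∃ ε δ : ℝ, (ε = 1 ∨ ε = -1) ∧ (δ = 1 ∨ δ = -1) ∧ l₁ + ε • l₂ + δ • l₃ = 0 := by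
    intro ε δ hε hδ hS
    refine ⟨-ε, -δ, by rcases hε with rfl | rfl <;> simp, by rcases hδ with rfl | rfl <;> simp,
      LinearMap.ext fun Z => ?_⟩
    have h2 : ε * ε = 1 := by rcases hε with rfl | rfl <;> norm_num
    have h3 : δ * δ = 1 := by rcases hδ with rfl | rfl <;> norm_num
    have h4 : (l₁ Z - ε * l₂ Z - δ * l₃ Z) * (t0 + ε * t1 + δ * t2 - ε * δ * t3) = 0 := by
      linear_combination -e1 Z + ε * e2 Z + δ * e3 Z - ε * δ * e4 Z +
        (-l₂ Z * t1 + δ * l₂ Z * t3) * h2 + (-l₃ Z * t2 + ε * l₃ Z * t3) * h3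
    have h5 := (mul_eq_zero.1 h4).resolve_right hS
    simp only [LinearMap.add_apply, LinearMap.smul_apply, smul_eq_mul, LinearMap.zero_apply]
    linarith
  by_contra hcon
  have s1 := not_not.1 fun hS => hcon (key 1 1 (Or.inl rfl) (Or.inl rfl) hS)
  have s2 := not_not.1 fun hS => hcon (key 1 (-1) (Or.inl rfl) (Or.inr rfl) hS)
  have s3 := not_not.1 fun hS => hcon (key (-1) 1 (Or.inr rfl) (Or.inl rfl) hS)
  have s4 := not_not.1 fun hS => hcon (key (-1) (-1) (Or.inr rfl) (Or.inr rfl) hS)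
  exact h (by linarith)

end IsWeightModule

end WeightModules

/-! ### Irreducible isotropy modules are weight modules -/

section Irreducible

variable {𝔤 : Type*} [LieRing 𝔤] [LieAlgebra ℝ 𝔤] {𝔨 𝔥 : LieSubalgebra ℝ 𝔤}
variable [FiniteDimensional ℝ 𝔤]

/-- Schur's lemma for symmetric operators: on an irreducible module, the symmetric operator
`ad Z ad Z'` is a real scalar, since its eigenspaces are submodules. -/
lemma exists_lie_lie_eq_smul (hp : IsFlagPair 𝔨 𝔥) (M : LieSubmodule ℝ 𝔨 𝔤)
    [LieModule.IsIrreducible ℝ 𝔨 M] (Z Z' : centre 𝔨 𝔥) :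
    ∃ r : ℝ, ∀ x ∈ M, ⁅centreVal Z, ⁅centreVal Z', x⁆⁆ = r • x := by
  have hM : ∀ U ∈ 𝔨, ∀ x ∈ M, ⁅U, x⁆ ∈ M := fun U hU x hx => M.lie_mem (x := ⟨U, hU⟩) hx
  let f : Module.End ℝ M.toSubmodule :=
    (LieAlgebra.ad ℝ 𝔤 (centreVal Z)).restrict (hM _ (centreVal_mem Z)) *
      (LieAlgebra.ad ℝ 𝔤 (centreVal Z')).restrict (hM _ (centreVal_mem Z'))
  have hf : ∀ x : M.toSubmodule, (f x : 𝔤) = ⁅centreVal Z, ⁅centreVal Z', (x : 𝔤)⁆⁆ :=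
    fun x => rfl
  have hnt : Nontrivial M.toSubmodule := LieModule.nontrivial_of_isIrreducible ℝ 𝔨 M
  obtain ⟨r, v, hv, hrv⟩ := (hp.inner.restrict M.toSubmodule).exists_eigenvector f fun x y => by
    change bilinForm 𝔤 ⁅centreVal Z, ⁅centreVal Z', (x : 𝔤)⁆⁆ (y : 𝔤) =
      bilinForm 𝔤 (x : 𝔤) ⁅centreVal Z, ⁅centreVal Z', (y : 𝔤)⁆⁆
    rw [bilinForm_lie_left, bilinForm_lie_left, neg_neg,
      lie_centreVal_lie Z (centreVal_mem Z')]
  let N : LieSubmodule ℝ 𝔨 M :=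
    { carrier := {x | ⁅centreVal Z, ⁅centreVal Z', (x : 𝔤)⁆⁆ = r • (x : 𝔤)}
      zero_mem' := by simp
      add_mem' := fun {x y} hx hy => by
        simp only [Set.mem_ofPred_eq] at hx hy ⊢
        rw [LieSubmodule.coe_add, lie_add, lie_add, hx, hy, smul_add]
      smul_mem' := fun c x hx => by
        simp only [Set.mem_ofPred_eq] at hx ⊢
        rw [LieSubmodule.coe_smul, lie_smul, lie_smul, hx, smul_comm]
      lie_mem := fun {U x} hx => by
        change ⁅centreVal Z, ⁅centreVal Z', ⁅(U : 𝔤), (x : 𝔤)⁆⁆⁆ = r • ⁅(U : 𝔤), (x : 𝔤)⁆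
        rw [← lie_centreVal_lie Z' U.2, ← lie_centreVal_lie Z U.2]
        have hx' : ⁅centreVal Z, ⁅centreVal Z', (x : 𝔤)⁆⁆ = r • (x : 𝔤) := hx
        rw [hx', lie_smul] }
  have hN : N = ⊤ := by
    have hbot : N ≠ ⊥ := fun h => hv (by
      have h1 : v ∈ N := congrArg Subtype.val hrv
      rw [h] at h1
      exact h1)
    have : Nontrivial N := (LieSubmodule.nontrivial_iff_ne_bot ℝ 𝔨 M).2 hbot
    exact LieSubmodule.eq_top_of_isIrreducible ℝ 𝔨 M N
  refine ⟨r, fun x hx => ?_⟩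
  have h1 : (⟨x, hx⟩ : M) ∈ N := by rw [hN]; exact LieSubmodule.mem_top _
  exact h1

/-- An irreducible submodule of the isotropy module is a weight module. -/
theorem exists_isWeightModule (hp : IsFlagPair 𝔨 𝔥) (M : LieSubmodule ℝ 𝔨 𝔤)
    [LieModule.IsIrreducible ℝ 𝔨 M] (hM : M.toSubmodule ≤ isotropyModule 𝔨) :
    ∃ (l : centre 𝔨 𝔥 →ₗ[ℝ] ℝ) (Z₀ : centre 𝔨 𝔥), IsWeightModule M.toSubmodule l Z₀ := by
  have hstable : ∀ U ∈ 𝔨, ∀ x ∈ M.toSubmodule, ⁅U, x⁆ ∈ M.toSubmodule :=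
    fun U hU x hx => M.lie_mem (x := ⟨U, hU⟩) hx
  have hnt : Nontrivial M.toSubmodule := LieModule.nontrivial_of_isIrreducible ℝ 𝔨 M
  obtain ⟨x₀, hx₀, hne⟩ := Submodule.exists_mem_ne_zero_of_ne_bot
    (Submodule.nontrivial_iff_ne_bot.1 hnt)
  have hpos := hp.inner.pos x₀ hne
  -- some element of `𝔱` does not annihilate `x₀`, as `x₀ ∉ 𝔨`
  obtain ⟨Z, hZ⟩ : ∃ Z : centre 𝔨 𝔥, ⁅centreVal Z, x₀⁆ ≠ 0 := by
    by_contra! h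
    exact hpos.ne' (hM hx₀ x₀ (hp.mem_of_forall_centreVal h))
  obtain ⟨r, hr⟩ := exists_lie_lie_eq_smul hp M Z Z
  have hr0 : r < 0 := by
    have h1 := hp.inner.pos _ hZ
    rw [bilinForm_lie_left, hr x₀ hx₀, map_smul, smul_eq_mul] at h1
    by_contra! h2
    linarith [mul_nonneg h2 hpos.le]
  set Z₀ : centre 𝔨 𝔥 := (√(-r))⁻¹ • Z with hZ₀
  have hsq : ∀ x ∈ M, ⁅centreVal Z₀, ⁅centreVal Z₀, x⁆⁆ = -x := fun x hx => by
    have h1 : (√(-r))⁻¹ * (√(-r))⁻¹ * r = -1 := by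
      rw [← mul_inv, Real.mul_self_sqrt (by linarith), inv_neg, neg_mul, inv_mul_cancel₀ hr0.ne]
    rw [hZ₀, centreVal_smul, smul_lie, smul_lie, lie_smul, hr x hx, smul_smul, smul_smul,
      h1, neg_one_smul]
  let l : centre 𝔨 𝔥 →ₗ[ℝ] ℝ :=
    { toFun := fun Z => -(bilinForm 𝔤 x₀ ⁅centreVal Z, ⁅centreVal Z₀, x₀⁆⁆) / bilinForm 𝔤 x₀ x₀
      map_add' := fun Z Z' => by
        rw [centreVal_add, add_lie, map_add, neg_add, add_div]
      map_smul' := fun c Z => by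
        rw [centreVal_smul, smul_lie, map_smul, smul_eq_mul, RingHom.id_apply, smul_eq_mul,
          ← mul_neg, mul_div_assoc] }
  refine ⟨l, Z₀, hstable, fun Z x hx => ?_, hsq⟩
  obtain ⟨c, hc⟩ := exists_lie_lie_eq_smul hp M Z Z₀
  have hl : l Z = -c := by
    change -(bilinForm 𝔤 x₀ ⁅centreVal Z, ⁅centreVal Z₀, x₀⁆⁆) / bilinForm 𝔤 x₀ x₀ = -c
    rw [hc x₀ hx₀, map_smul, smul_eq_mul, neg_div, mul_div_cancel_right₀ _ hpos.ne']
  have h1 := hc _ (hstable _ (centreVal_mem Z₀) x hx)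
  rw [hsq x hx, lie_neg] at h1
  rw [hl, neg_smul, ← h1, neg_neg]

end Irreducible

/-! ### Weight spaces of the complexification -/

section SkewEndomorphism

variable {V : Type*} [AddCommGroup V] [Module ℝ V] [FiniteDimensional ℝ V]

lemma IsInnerForm.isSemisimple_of_skew {B : LinearMap.BilinForm ℝ V} (hB : IsInnerForm B)
    (f : Module.End ℝ V) (hf : ∀ x y, B (f x) y = -B x (f y)) : f.IsSemisimple := by
  rw [Module.End.isSemisimple_iff]
  intro p hp
  let q : Submodule ℝ V :=
    { carrier := {x | ∀ v ∈ p, B v x = 0}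
      zero_mem' := fun v _ => map_zero _
      add_mem' := fun {x y} hx hy v hv => by rw [map_add, hx v hv, hy v hv, add_zero]
      smul_mem' := fun c x hx v hv => by rw [map_smul, hx v hv, smul_zero] }
  refine ⟨q, fun x hx v hv => ?_, ?_, ?_⟩
  · have h1 := hf v x
    rw [hx _ (hp hv)] at h1
    linarith
  · rw [Submodule.disjoint_def]
    exact fun x hx hx' => hB.eq_zero_of_self_eq_zero (hx' x hx)
  · rw [codisjoint_iff, eq_top_iff]
    intro v _
    obtain ⟨w, hw, hvw⟩ := hB.exists_orthogonal_projection p v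
    exact Submodule.mem_sup.2 ⟨w, hw, v - w, hvw, add_sub_cancel w v⟩

lemma isSemisimple_baseChange {f : Module.End ℝ V} (hf : f.IsSemisimple) :
    Module.End.IsSemisimple (f.baseChange ℂ : Module.End ℂ (ℂ ⊗[ℝ] V)) := by
  have h1 : ((minpoly ℝ f).map (algebraMap ℝ ℂ)).Separable :=
    (PerfectField.separable_iff_squarefree.mpr hf.minpoly_squarefree).map
  refine Module.End.isSemisimple_of_squarefree_aeval_eq_zero h1.squarefree ?_
  have h2 : (f.baseChange ℂ : Module.End ℂ (ℂ ⊗[ℝ] V)) = Module.End.baseChangeHom ℝ ℂ V f := rfl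
  rw [Polynomial.aeval_map_algebraMap, h2, Polynomial.aeval_algHom_apply, minpoly.aeval, map_zero]

end SkewEndomorphism

section Complexification

variable {V : Type*} [AddCommGroup V] [Module ℝ V]

/-- The vector `a + i b` of the complexification. -/
noncomputable def complexMk (a b : V) : ℂ ⊗[ℝ] V := (1 : ℂ) ⊗ₜ[ℝ] a + Complex.I ⊗ₜ[ℝ] b

lemma exists_eq_complexMk (v : ℂ ⊗[ℝ] V) : ∃ a b : V, v = complexMk a b := by
  induction v using TensorProduct.induction_on with
  | zero => exact ⟨0, 0, by simp [complexMk]⟩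
  | tmul z x =>
    refine ⟨z.re • x, z.im • x, ?_⟩
    rw [complexMk, ← TensorProduct.smul_tmul, ← TensorProduct.smul_tmul, ← TensorProduct.add_tmul]
    congr 1
    apply Complex.ext <;> simp
  | add v w hv hw =>
    obtain ⟨a, b, rfl⟩ := hv
    obtain ⟨c, d, rfl⟩ := hw
    refine ⟨a + c, b + d, ?_⟩
    simp only [complexMk, TensorProduct.tmul_add]
    abel

lemma complexMk_inj {a b c d : V} : complexMk a b = complexMk c d ↔ a = c ∧ b = d := by
  refine ⟨fun h => ?_, fun h => by rw [h.1, h.2]⟩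
  let re : ℂ ⊗[ℝ] V →ₗ[ℝ] V := TensorProduct.lid ℝ V ∘ₗ Complex.reLm.rTensor V
  let im : ℂ ⊗[ℝ] V →ₗ[ℝ] V := TensorProduct.lid ℝ V ∘ₗ Complex.imLm.rTensor V
  have hre : ∀ a b : V, re (complexMk a b) = a := fun a b => by simp [re, complexMk]
  have him : ∀ a b : V, im (complexMk a b) = b := fun a b => by simp [im, complexMk]
  constructor
  · rw [← hre a b, h, hre]
  · rw [← him a b, h, him]

lemma complexMk_zero_zero : complexMk (0 : V) 0 = 0 := by simp [complexMk]

lemma complexMk_add (a b c d : V) :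
    complexMk a b + complexMk c d = complexMk (a + c) (b + d) := by
  simp only [complexMk, TensorProduct.tmul_add]
  abel

lemma smul_complexMk (z : ℂ) (a b : V) :
    z • complexMk a b = complexMk (z.re • a - z.im • b) (z.im • a + z.re • b) := by
  have h1 : ∀ (w : ℂ) (x : V), w ⊗ₜ[ℝ] x = complexMk (w.re • x) (w.im • x) := fun w x => by
    rw [complexMk, ← TensorProduct.smul_tmul, ← TensorProduct.smul_tmul, ← TensorProduct.add_tmul]
    congr 1
    apply Complex.ext <;> simp
  rw [complexMk, smul_add, TensorProduct.smul_tmul', TensorProduct.smul_tmul', h1, h1 (z • _),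
    complexMk_add]
  simp [sub_eq_add_neg]

lemma one_tmul_eq_complexMk (a : V) : (1 : ℂ) ⊗ₜ[ℝ] a = complexMk a 0 := by simp [complexMk]

/-- The operator `ad X` on the complexification. -/
noncomputable def complexAd {𝔤 : Type*} [LieRing 𝔤] [LieAlgebra ℝ 𝔤] :
    𝔤 →ₗ[ℝ] Module.End ℂ (ℂ ⊗[ℝ] 𝔤) :=
  (Module.End.baseChangeHom ℝ ℂ 𝔤).toLinearMap ∘ₗ (LieAlgebra.ad ℝ 𝔤 : 𝔤 →ₗ[ℝ] Module.End ℝ 𝔤)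

section

variable {𝔤 : Type*} [LieRing 𝔤] [LieAlgebra ℝ 𝔤]

lemma complexAd_tmul (X : 𝔤) (z : ℂ) (x : 𝔤) : complexAd X (z ⊗ₜ[ℝ] x) = z ⊗ₜ[ℝ] ⁅X, x⁆ := rfl

lemma complexAd_complexMk (X a b : 𝔤) :
    complexAd X (complexMk a b) = complexMk ⁅X, a⁆ ⁅X, b⁆ := by
  rw [complexMk, map_add, complexAd_tmul, complexAd_tmul, complexMk]

lemma ad_one_tmul (X : 𝔤) :
    LieAlgebra.ad ℂ (ℂ ⊗[ℝ] 𝔤) ((1 : ℂ) ⊗ₜ[ℝ] X) = complexAd X := by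
  ext x
  simp [complexAd_tmul]

end

end Complexification

section ComplexWeight

variable {𝔤 : Type*} [LieRing 𝔤] [LieAlgebra ℝ 𝔤] {𝔨 𝔥 : LieSubalgebra ℝ 𝔤}

/-- The weight space of `𝔤^ℂ` for the weight `ξ` of `𝔱`. -/
noncomputable def complexWeightSpace (ξ : centre 𝔨 𝔥 →ₗ[ℝ] ℂ) : Submodule ℂ (ℂ ⊗[ℝ] 𝔤) where
  carrier := {v | ∀ Z : centre 𝔨 𝔥, complexAd (centreVal Z) v = ξ Z • v}
  zero_mem' Z := by rw [map_zero, smul_zero]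
  add_mem' {v w} hv hw Z := by rw [map_add, hv Z, hw Z, smul_add]
  smul_mem' c v hv Z := by rw [map_smul, hv Z, smul_comm]

lemma mem_rootSpace {α : 𝔥 →ₗ[ℝ] ℂ} {v : ℂ ⊗[ℝ] 𝔤} :
    v ∈ rootSpace 𝔥 α ↔ ∀ X : 𝔥, complexAd (X : 𝔤) v = α X • v := by
  simp only [rootSpace, Submodule.mem_iInf, Module.End.mem_eigenspace_iff, ad_one_tmul]

lemma rootSpace_le_complexWeightSpace (α : 𝔥 →ₗ[ℝ] ℂ) :
    rootSpace 𝔥 α ≤ complexWeightSpace (kappa 𝔨 𝔥 α) :=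
  fun _ hv Z => mem_rootSpace.1 hv Z

/-- `𝔱` centralizes `𝔨^ℂ`. -/
lemma complexAd_eq_zero_of_mem_baseChange (Z : centre 𝔨 𝔥) {v : ℂ ⊗[ℝ] 𝔤}
    (hv : v ∈ 𝔨.toSubmodule.baseChange ℂ) : complexAd (centreVal Z) v = 0 := by
  rw [Submodule.baseChange_eq_span] at hv
  induction hv using Submodule.span_induction with
  | mem v hv =>
    obtain ⟨U, hU, rfl⟩ := hv
    rw [TensorProduct.mk_apply, complexAd_tmul, centreVal_lie Z hU, TensorProduct.tmul_zero]
  | zero => rw [map_zero]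
  | add v w _ _ hv hw => rw [map_add, hv, hw, add_zero]
  | smul c v _ hv => rw [map_smul, hv, smul_zero]

lemma complexMk_mem_baseChange {a b : 𝔤} (ha : a ∈ 𝔨) (hb : b ∈ 𝔨) :
    complexMk a b ∈ 𝔨.toSubmodule.baseChange ℂ :=
  add_mem (Submodule.tmul_mem_baseChange_of_mem _ ha) (Submodule.tmul_mem_baseChange_of_mem _ hb)

/-- A joint eigenvector of `𝔥` of nonzero weight `ξ` for `𝔱` lies in a root space of a
complementary root which restricts to `ξ`. -/
lemma exists_mem_rootSpace {ξ : centre 𝔨 𝔥 →ₗ[ℝ] ℂ} (hξ : ξ ≠ 0) {χ : 𝔥 → ℂ} {v : ℂ ⊗[ℝ] 𝔤}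
    (hv : v ∈ complexWeightSpace ξ) (hv0 : v ≠ 0)
    (hχ : ∀ X : 𝔥, complexAd (X : 𝔤) v = χ X • v) :
    ∃ α ∈ complementaryRoots 𝔨 𝔥, kappa 𝔨 𝔥 α = ξ ∧ v ∈ rootSpace 𝔥 α := by
  let α : 𝔥 →ₗ[ℝ] ℂ :=
    { toFun := χ
      map_add' := fun X Y => smul_left_injective ℂ hv0 (by
        simp only [add_smul, ← hχ]
        change complexAd ((X : 𝔤) + (Y : 𝔤)) v = _
        rw [map_add, LinearMap.add_apply])
      map_smul' := fun c X => smul_left_injective ℂ hv0 (by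
        simp only [RingHom.id_apply, smul_assoc, ← hχ]
        change complexAd (c • (X : 𝔤)) v = _
        rw [map_smul, LinearMap.smul_apply]) }
  have hα : v ∈ rootSpace 𝔥 α := mem_rootSpace.2 hχ
  have hκ : kappa 𝔨 𝔥 α = ξ := LinearMap.ext fun Z => smul_left_injective ℂ hv0 (by
    simp only
    rw [← hv Z]
    exact (hχ Z).symm)
  refine ⟨α, ⟨⟨fun h => hξ ?_, fun h => hv0 ?_⟩, fun h => hξ ?_⟩, hκ, hα⟩
  · rw [← hκ, h]
    rfl
  · rwa [h, Submodule.mem_bot] at hα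
  · refine LinearMap.ext fun Z => smul_left_injective ℂ hv0 ?_
    have h1 := complexAd_eq_zero_of_mem_baseChange Z (h.2 hα)
    simp only
    rw [← hv Z, h1, LinearMap.zero_apply, zero_smul]

variable [FiniteDimensional ℝ 𝔤] (hp : IsFlagPair 𝔨 𝔥)
include hp

/-- The module `𝔪_ξ` is a full weight space of `𝔱`, by simultaneous diagonalization of `𝔥`. -/
theorem tRootModule_eq_complexWeightSpace {ξ : centre 𝔨 𝔥 →ₗ[ℝ] ℂ} (hξ : ξ ≠ 0) :
    tRootModule 𝔨 𝔥 ξ = complexWeightSpace ξ := by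
  refine le_antisymm ?_ ?_
  · refine iSup₂_le fun α hα => ?_
    exact hα.2 ▸ rootSpace_le_complexWeightSpace α
  let F : 𝔥 → Module.End ℂ (ℂ ⊗[ℝ] 𝔤) := fun X =>
    complexAd (X : 𝔤)
  have hcomm : ∀ (X Y : 𝔥) v, F X (F Y v) = F Y (F X v) := fun X Y v => by
    obtain ⟨a, b, rfl⟩ := exists_eq_complexMk v
    have h1 : ∀ x : 𝔤, ⁅(X : 𝔤), ⁅(Y : 𝔤), x⁆⁆ = ⁅(Y : 𝔤), ⁅(X : 𝔤), x⁆⁆ := fun x => by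
      rw [leibniz_lie, hp.lie_eq_zero X X.2 Y Y.2, zero_lie, zero_add]
    simp only [F, complexAd_complexMk, h1]
  have hss : ∀ X, (F X).IsSemisimple := fun X =>
    isSemisimple_baseChange (hp.inner.isSemisimple_of_skew _ fun Y Z =>
      bilinForm_lie_left (X : 𝔤) Y Z)
  have hinv : ∀ X, complexWeightSpace ξ ∈ (F X).invtSubmodule := fun X v hv Z => by
    have h1 : F ⟨centreVal Z, (Z : 𝔥).2⟩ v = ξ Z • v := hv Z
    change F ⟨centreVal Z, (Z : 𝔥).2⟩ (F X v) = ξ Z • F X v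
    rw [hcomm, h1, map_smul]
  let f : 𝔥 → Module.End ℂ (complexWeightSpace ξ) := fun X => (F X).restrict (hinv X)
  have htop :=
    Module.End.iSup_iInf_maxGenEigenspace_eq_top_of_iSup_maxGenEigenspace_eq_top_of_commute
    f (fun X Y _ => LinearMap.ext fun v => Subtype.ext (hcomm X Y v))
    (fun X => Module.End.iSup_maxGenEigenspace_eq_top (f X))
  have hmap : (⨆ χ : 𝔥 → ℂ, ⨅ X, (f X).maxGenEigenspace (χ X)) ≤
      (tRootModule 𝔨 𝔥 ξ).comap (complexWeightSpace ξ).subtype := by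
    refine iSup_le fun χ v hv => ?_
    rw [Submodule.mem_comap, Submodule.subtype_apply]
    by_cases hv0 : (v : ℂ ⊗[ℝ] 𝔤) = 0
    · rw [hv0]
      exact zero_mem _
    have hχ : ∀ X : 𝔥, complexAd (X : 𝔤) (v : ℂ ⊗[ℝ] 𝔤) = χ X • (v : ℂ ⊗[ℝ] 𝔤) := by
      intro X
      have h1 := (Submodule.mem_iInf _).1 hv X
      rw [((hss X).restrict (hinv X)).isFinitelySemisimple.maxGenEigenspace_eq_eigenspace,
        Module.End.mem_eigenspace_iff] at h1
      exact congrArg Subtype.val h1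
    obtain ⟨α, hα, hκ, hvα⟩ := exists_mem_rootSpace hξ v.2 hv0 hχ
    exact (le_iSup₂_of_le α ⟨hα, hκ⟩ le_rfl :
      rootSpace 𝔥 α ≤ tRootModule 𝔨 𝔥 ξ) hvα
  intro v hv
  have h1 : (⟨v, hv⟩ : complexWeightSpace ξ) ∈ (⊤ : Submodule ℂ (complexWeightSpace ξ)) := trivial
  rw [← htop] at h1
  exact hmap h1

lemma mem_tRoots_of_complexWeightSpace_ne_bot {ξ : centre 𝔨 𝔥 →ₗ[ℝ] ℂ} (hξ : ξ ≠ 0)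
    (h : complexWeightSpace ξ ≠ ⊥) : ξ ∈ tRoots 𝔨 𝔥 := by
  by_contra hcon
  refine h ?_
  rw [← tRootModule_eq_complexWeightSpace hp hξ, tRootModule, eq_bot_iff]
  exact iSup₂_le fun α hα => absurd ⟨α, hα⟩ hcon

end ComplexWeight

/-! ### Associated `𝔱`-roots and structure constants -/

section Association

variable {𝔤 : Type*} [LieRing 𝔤] [LieAlgebra ℝ 𝔤] {𝔨 𝔥 : LieSubalgebra ℝ 𝔤}

lemma complexMk_mem_complexWeightSpace {l : centre 𝔨 𝔥 →ₗ[ℝ] ℝ} {a b : 𝔤} :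
    complexMk a b ∈ complexWeightSpace (l.smulRight Complex.I) ↔
      ∀ Z : centre 𝔨 𝔥, ⁅centreVal Z, a⁆ = -l Z • b ∧ ⁅centreVal Z, b⁆ = l Z • a := by
  refine forall_congr' fun Z => ?_
  rw [complexAd_complexMk, smul_complexMk, complexMk_inj]
  simp

/-- The real points of the sum of two opposite imaginary weight spaces form a real weight space. -/
theorem realPoints_complexWeightSpace {l : centre 𝔨 𝔥 →ₗ[ℝ] ℝ} {Z₀ : centre 𝔨 𝔥} (h : l Z₀ = 1) :
    realPoints (complexWeightSpace (l.smulRight Complex.I) ⊔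
      complexWeightSpace (-l.smulRight Complex.I)) = weightSpace l Z₀ := by
  have hneg : -l.smulRight Complex.I = (-l).smulRight Complex.I :=
    LinearMap.ext fun Z => by simp
  rw [hneg]
  ext x
  constructor
  · intro hx
    obtain ⟨v, hv, w, hw, hvw⟩ := Submodule.mem_sup.1 hx
    obtain ⟨a, b, rfl⟩ := exists_eq_complexMk v
    obtain ⟨c, d, rfl⟩ := exists_eq_complexMk w
    rw [TensorProduct.mk_apply, one_tmul_eq_complexMk, complexMk_add, complexMk_inj] at hvw
    obtain ⟨rfl, hbd⟩ := hvw
    rw [complexMk_mem_complexWeightSpace] at hv hw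
    have hd : d = -b := eq_neg_of_add_eq_zero_right hbd
    have hx : ∀ Z : centre 𝔨 𝔥, ⁅centreVal Z, a + c⁆ = l Z • (-(2 : ℝ) • b) := fun Z => by
      rw [lie_add, (hv Z).1, (hw Z).1, hd, LinearMap.neg_apply]
      module
    have hac : a = c := by
      have h1 := (hw Z₀).2
      rw [hd, lie_neg, (hv Z₀).2, LinearMap.neg_apply, h, one_smul, neg_one_smul, neg_inj] at h1
      exact h1
    refine ⟨fun Z => ?_, ?_⟩
    · rw [hx, hx Z₀, h, one_smul]
    · rw [hx, h, one_smul, lie_smul, (hv Z₀).2, h, ← hac]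
      module
  · intro hx
    have hJ := (isWeightModule_weightSpace l Z₀).lie_J_left (x := x)
    refine Submodule.mem_sup.2 ⟨complexMk ((1 / 2 : ℝ) • x) (-(1 / 2 : ℝ) • ⁅centreVal Z₀, x⁆), ?_,
      complexMk ((1 / 2 : ℝ) • x) ((1 / 2 : ℝ) • ⁅centreVal Z₀, x⁆), ?_, ?_⟩
    · refine complexMk_mem_complexWeightSpace.2 fun Z => ⟨?_, ?_⟩
      · rw [lie_smul, hx.1]
        module
      · rw [lie_smul, hJ Z hx]
        module
    · refine complexMk_mem_complexWeightSpace.2 fun Z => ⟨?_, ?_⟩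
      · rw [lie_smul, hx.1, LinearMap.neg_apply]
        module
      · rw [lie_smul, hJ Z hx, LinearMap.neg_apply]
        module
    · rw [TensorProduct.mk_apply, one_tmul_eq_complexMk, complexMk_add, complexMk_inj]
      exact ⟨by module, by module⟩

lemma IsWeightModule.complexWeightSpace_ne_bot {V : Submodule ℝ 𝔤} {l : centre 𝔨 𝔥 →ₗ[ℝ] ℝ}
    {Z₀ : centre 𝔨 𝔥} (hV : IsWeightModule V l Z₀) (hne : V ≠ ⊥) :
    complexWeightSpace (l.smulRight Complex.I) ≠ ⊥ := by
  obtain ⟨x, hx, hx0⟩ := Submodule.exists_mem_ne_zero_of_ne_bot hne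
  intro h
  have h1 : complexMk x (-⁅centreVal Z₀, x⁆) ∈ complexWeightSpace (l.smulRight Complex.I) := by
    refine complexMk_mem_complexWeightSpace.2 fun Z => ⟨?_, ?_⟩
    · rw [hV.lie_eq Z x hx]
      module
    · rw [lie_neg, hV.lie_J_left Z hx]
      module
  rw [h, Submodule.mem_bot, ← complexMk_zero_zero, complexMk_inj] at h1
  exact hx0 h1.1

variable (hp : IsFlagPair 𝔨 𝔥)
include hp

/-- The `𝔱`-roots are nonzero and purely imaginary. -/
lemma exists_eq_smulRight_of_mem_tRoots {ξ : centre 𝔨 𝔥 →ₗ[ℝ] ℂ} (hξ : ξ ∈ tRoots 𝔨 𝔥) :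
    ∃ l : centre 𝔨 𝔥 →ₗ[ℝ] ℝ, l ≠ 0 ∧ ξ = l.smulRight Complex.I := by
  obtain ⟨α, ⟨hα, hαk⟩, rfl⟩ := hξ
  -- a root vector `a + i b` which does not lie in the complexification of `𝔨`
  obtain ⟨v, hv, hvk⟩ := SetLike.not_le_iff_exists.1 fun h => hαk ⟨hα, h⟩
  obtain ⟨a, b, rfl⟩ := exists_eq_complexMk v
  set ξ := kappa 𝔨 𝔥 α with hξ
  have hw : ∀ Z : centre 𝔨 𝔥, ⁅centreVal Z, a⁆ = (ξ Z).re • a - (ξ Z).im • b ∧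
      ⁅centreVal Z, b⁆ = (ξ Z).im • a + (ξ Z).re • b := fun Z => by
    rw [← complexMk_inj, ← complexAd_complexMk, ← smul_complexMk]
    exact rootSpace_le_complexWeightSpace α hv Z
  have hab : 0 < bilinForm 𝔤 a a + bilinForm 𝔤 b b := by
    refine lt_of_le_of_ne (add_nonneg (hp.inner.self_nonneg _) (hp.inner.self_nonneg _)) fun h => ?_
    have h1 := hp.inner.self_nonneg a
    have h2 := hp.inner.self_nonneg b
    have h3 : a = 0 := hp.inner.eq_zero_of_self_eq_zero (by linarith)
    have h4 : b = 0 := hp.inner.eq_zero_of_self_eq_zero (by linarith)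
    exact hvk (complexMk_mem_baseChange (h3 ▸ 𝔨.zero_mem) (h4 ▸ 𝔨.zero_mem))
  -- the real part vanishes because `ad Z` is skew
  have hre : ∀ Z : centre 𝔨 𝔥, (ξ Z).re = 0 := fun Z => by
    have hskew : ∀ x : 𝔤, bilinForm 𝔤 ⁅centreVal Z, x⁆ x = 0 := fun x => by
      have h1 := bilinForm_lie_left (centreVal Z) x x
      rw [bilinForm_comm x] at h1
      linarith
    have h1 := hskew a
    have h2 := hskew b
    rw [(hw Z).1, LinearMap.map_sub₂, LinearMap.map_smul₂, LinearMap.map_smul₂,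
      bilinForm_comm b a, smul_eq_mul, smul_eq_mul] at h1
    rw [(hw Z).2, LinearMap.map_add₂, LinearMap.map_smul₂, LinearMap.map_smul₂,
      smul_eq_mul, smul_eq_mul] at h2
    have h3 : (ξ Z).re * (bilinForm 𝔤 a a + bilinForm 𝔤 b b) = 0 := by linarith
    exact (mul_eq_zero.1 h3).resolve_right hab.ne'
  refine ⟨Complex.imLm ∘ₗ ξ, fun h => hvk ?_, LinearMap.ext fun Z => ?_⟩
  · have him : ∀ Z : centre 𝔨 𝔥, (ξ Z).im = 0 := fun Z => LinearMap.congr_fun h Z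
    refine complexMk_mem_baseChange (hp.mem_of_forall_centreVal fun Z => ?_)
      (hp.mem_of_forall_centreVal fun Z => ?_)
    · rw [(hw Z).1, hre, him, zero_smul, zero_smul, sub_zero]
    · rw [(hw Z).2, hre, him, zero_smul, zero_smul, add_zero]
  · apply Complex.ext <;> simp [hre]

variable [FiniteDimensional ℝ 𝔤]

lemma realPoints_tRootModule {l : centre 𝔨 𝔥 →ₗ[ℝ] ℝ} {Z₀ : centre 𝔨 𝔥} (h : l Z₀ = 1) :
    realPoints (tRootModule 𝔨 𝔥 (l.smulRight Complex.I) ⊔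
      tRootModule 𝔨 𝔥 (-l.smulRight Complex.I)) = weightSpace l Z₀ := by
  have h0 : l.smulRight Complex.I ≠ 0 := fun h1 => by
    have h2 := LinearMap.congr_fun h1 Z₀
    simp [h] at h2
  rw [tRootModule_eq_complexWeightSpace hp h0,
    tRootModule_eq_complexWeightSpace hp (neg_ne_zero.2 h0), realPoints_complexWeightSpace h]

lemma IsWeightModule.isAssociatedTRoot {M : LieSubmodule ℝ 𝔨 𝔤} {l : centre 𝔨 𝔥 →ₗ[ℝ] ℝ}
    {Z₀ : centre 𝔨 𝔥} (hM : IsWeightModule M.toSubmodule l Z₀) (hne : M.toSubmodule ≠ ⊥) :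
    IsAssociatedTRoot 𝔨 𝔥 M (l.smulRight Complex.I) := by
  have h1 := hM.apply_self hne
  refine ⟨mem_tRoots_of_complexWeightSpace_ne_bot hp (fun h => ?_)
    (hM.complexWeightSpace_ne_bot hne), ?_⟩
  · have h2 := LinearMap.congr_fun h Z₀
    simp [h1] at h2
  · rw [realPoints_tRootModule hp h1, hM.eq_weightSpace hp hne]

lemma IsAssociatedTRoot.exists_isWeightModule {M : LieSubmodule ℝ 𝔨 𝔤}
    {ξ : centre 𝔨 𝔥 →ₗ[ℝ] ℂ} (h : IsAssociatedTRoot 𝔨 𝔥 M ξ) :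
    ∃ (l : centre 𝔨 𝔥 →ₗ[ℝ] ℝ) (Z₀ : centre 𝔨 𝔥),
      ξ = l.smulRight Complex.I ∧ IsWeightModule M.toSubmodule l Z₀ := by
  obtain ⟨l, hl, rfl⟩ := exists_eq_smulRight_of_mem_tRoots hp h.1
  obtain ⟨Z, hZ⟩ : ∃ Z, l Z ≠ 0 := by
    by_contra! h0
    exact hl (LinearMap.ext h0)
  have h1 : l ((l Z)⁻¹ • Z) = 1 := by rw [map_smul, smul_eq_mul, inv_mul_cancel₀ hZ]
  refine ⟨l, (l Z)⁻¹ • Z, rfl, ?_⟩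
  rw [h.2, realPoints_tRootModule hp h1]
  exact isWeightModule_weightSpace l _

end Association

section StructureConstant

variable {𝔤 : Type*} [LieRing 𝔤] [LieAlgebra ℝ 𝔤] {𝔨 𝔥 : LieSubalgebra ℝ 𝔤}

lemma structureConstant_ne_zero_iff {s : ℕ} {d : Fin s → ℕ} {e : ∀ i, Fin (d i) → 𝔤}
    {V : Fin s → Submodule ℝ 𝔤} (he : ∀ i, IsOrthonormalBasis (e i) (V i)) (i j k : Fin s) :
    structureConstant e i j k ≠ 0 ↔
      ∃ x ∈ V i, ∃ y ∈ V j, ∃ z ∈ V k, bilinForm 𝔤 ⁅x, y⁆ z ≠ 0 := by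
  have hmem : ∀ i a, e i a ∈ V i := fun i a =>
    (he i).span_eq ▸ Submodule.subset_span (Set.mem_range_self a)
  rw [← not_iff_not, not_not]
  push Not
  constructor
  · intro h
    have h0 : ∀ a b c, bilinForm 𝔤 ⁅e i a, e j b⁆ (e k c) = 0 := by
      intro a b c
      have hc : ∀ a b, 0 ≤ ∑ c, form ⁅e i a, e j b⁆ (e k c) ^ 2 :=
        fun a b => Finset.sum_nonneg fun c _ => sq_nonneg _
      have h1 := (Finset.sum_eq_zero_iff_of_nonneg fun a _ =>
        Finset.sum_nonneg fun b _ => hc a b).1 h a (Finset.mem_univ a)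
      have h2 := (Finset.sum_eq_zero_iff_of_nonneg fun b _ => hc a b).1 h1 b (Finset.mem_univ b)
      have h3 := (Finset.sum_eq_zero_iff_of_nonneg fun c _ => sq_nonneg _).1 h2 c
        (Finset.mem_univ c)
      exact pow_eq_zero_iff two_ne_zero |>.1 h3
    intro x hx y hy z hz
    rw [← (he i).span_eq] at hx
    rw [← (he j).span_eq] at hy
    rw [← (he k).span_eq] at hz
    induction hx using Submodule.span_induction with
    | zero => simp
    | add x x' _ _ hx hx' => rw [add_lie, LinearMap.map_add₂, hx, hx', add_zero]
    | smul c x _ hx => rw [smul_lie, LinearMap.map_smul₂, hx, smul_zero]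
    | mem x hx =>
      obtain ⟨a, rfl⟩ := hx
      induction hy using Submodule.span_induction with
      | zero => simp
      | add x x' _ _ hx hx' => rw [lie_add, LinearMap.map_add₂, hx, hx', add_zero]
      | smul c x _ hx => rw [lie_smul, LinearMap.map_smul₂, hx, smul_zero]
      | mem y hy =>
        obtain ⟨b, rfl⟩ := hy
        induction hz using Submodule.span_induction with
        | zero => simp
        | add x x' _ _ hx hx' => rw [map_add, hx, hx', add_zero]
        | smul c x _ hx => rw [map_smul, hx, smul_zero]
        | mem z hz =>
          obtain ⟨c, rfl⟩ := hz
          exact h0 a b c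
  · intro h
    refine Finset.sum_eq_zero fun a _ => Finset.sum_eq_zero fun b _ =>
      Finset.sum_eq_zero fun c _ => ?_
    rw [← bilinForm_apply, h _ (hmem i a) _ (hmem j b) _ (hmem k c), zero_pow two_ne_zero]

variable [FiniteDimensional ℝ 𝔤] (hp : IsFlagPair 𝔨 𝔥)
include hp

/-- The relation between associated `𝔱`-roots and structure constants for a flag pair. -/
theorem IsFlagPair.associatedTRoots {s : ℕ} {m : Fin s → LieSubmodule ℝ 𝔨 𝔤}
    (hm : IsIsotropyDecomposition 𝔨 m) {d : Fin s → ℕ} {e : ∀ i, Fin (d i) → 𝔤}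
    (he : ∀ i, IsOrthonormalBasis (e i) (m i).toSubmodule) :
    (∀ i, ∃ ξ, IsAssociatedTRoot 𝔨 𝔥 (m i) ξ) ∧
    ∀ i j k, structureConstant e i j k ≠ 0 ↔
      ∃ ξi ξj ξk, IsAssociatedTRoot 𝔨 𝔥 (m i) ξi ∧ IsAssociatedTRoot 𝔨 𝔥 (m j) ξj ∧
        IsAssociatedTRoot 𝔨 𝔥 (m k) ξk ∧ IsSymmetricTTriple 𝔨 𝔥 ξi ξj ξk := by
  have hne : ∀ i, (m i).toSubmodule ≠ ⊥ := fun i => by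
    have := hm.irreducible i
    exact Submodule.nontrivial_iff_ne_bot.1 (LieModule.nontrivial_of_isIrreducible ℝ 𝔨 (m i))
  have hW : ∀ i, ∃ (l : centre 𝔨 𝔥 →ₗ[ℝ] ℝ) (Z₀ : centre 𝔨 𝔥),
      IsWeightModule (m i).toSubmodule l Z₀ := fun i => by
    have := hm.irreducible i
    exact FlagManifold.exists_isWeightModule hp (m i)
      (hm.sum_eq ▸ le_iSup (fun i => (m i).toSubmodule) i)
  choose l Z₀ hl using hW
  refine ⟨fun i => ⟨_, (hl i).isAssociatedTRoot hp (hne i)⟩, fun i j k => ?_⟩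
  rw [structureConstant_ne_zero_iff he]
  constructor
  · rintro ⟨x, hx, y, hy, z, hz, h⟩
    obtain ⟨ε, δ, hε, hδ, hsum⟩ := (hl i).exists_sign_add_eq_zero (hl j) (hl k) hx hy hz h
    have hsign : ∀ i, ∀ ε : ℝ, ε = 1 ∨ ε = -1 →
        IsAssociatedTRoot 𝔨 𝔥 (m i) ((ε • l i).smulRight Complex.I) := by
      rintro i ε (rfl | rfl)
      · rw [one_smul]
        exact (hl i).isAssociatedTRoot hp (hne i)
      · have h1 : (-1 : ℝ) • l i = -l i := LinearMap.ext fun Z => by simp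
        rw [h1]
        exact (hl i).neg.isAssociatedTRoot hp (hne i)
    have hi := (hl i).isAssociatedTRoot hp (hne i)
    refine ⟨_, _, _, hi, hsign j ε hε, hsign k δ hδ, hi.1, (hsign j ε hε).1, (hsign k δ hδ).1, ?_⟩
    refine LinearMap.ext fun Z => ?_
    have h1 : (l i + ε • l j + δ • l k) Z • Complex.I = 0 := by
      rw [hsum, LinearMap.zero_apply, zero_smul]
    simpa only [LinearMap.add_apply, LinearMap.smulRight_apply, add_smul, LinearMap.zero_apply]
      using h1
  · rintro ⟨ξi, ξj, ξk, hi, hj, hk, -, -, -, hsum⟩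
    obtain ⟨li, Zi, rfl, hWi⟩ := hi.exists_isWeightModule hp
    obtain ⟨lj, Zj, rfl, hWj⟩ := hj.exists_isWeightModule hp
    obtain ⟨lk, Zk, rfl, hWk⟩ := hk.exists_isWeightModule hp
    refine hWi.exists_bilinForm_lie_ne_zero hp hWj hWk (hne i) (hne j) (hne k)
      (LinearMap.ext fun Z => ?_)
    have h1 := congrArg Complex.im (LinearMap.congr_fun hsum Z)
    simpa using h1

end StructureConstant

end FlagManifold

theorem mainTheorem5
    {E : Type*} [NormedAddCommGroup E] [NormedSpace ℝ E] [FiniteDimensional ℝ E]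
    {G : Type*} [TopologicalSpace G] [ChartedSpace E G] [Group G] [LieGroup 𝓘(ℝ, E) ∞ G]
    [T2Space G] [CompactSpace G] [ConnectedSpace G]
    (hG : LieAlgebra.IsSimple ℝ (GroupLieAlgebra 𝓘(ℝ, E) G))
    -- `K` is the centralizer of a torus `S`, and `T` is a maximal torus containing `S`
    (S T K : Subgroup G) (hS : FlagManifold.IsTorus S) (hT : FlagManifold.IsMaximalTorus T)
    (hST : S ≤ T) (hK : K = Subgroup.centralizer (S : Set G))
    (𝔨 𝔥 : LieSubalgebra ℝ (GroupLieAlgebra 𝓘(ℝ, E) G))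
    (h𝔨 : 𝔨 = FlagManifold.lieAlgebraOf E K) (h𝔥 : 𝔥 = FlagManifold.lieAlgebraOf E T)
    {s : ℕ} (m : Fin s → LieSubmodule ℝ 𝔨 (GroupLieAlgebra 𝓘(ℝ, E) G))
    (hm : FlagManifold.IsIsotropyDecomposition 𝔨 m)
    {d : Fin s → ℕ} (e : ∀ i, Fin (d i) → GroupLieAlgebra 𝓘(ℝ, E) G)
    (he : ∀ i, FlagManifold.IsOrthonormalBasis (e i) (m i).toSubmodule) :
    (∀ i, ∃ ξ, FlagManifold.IsAssociatedTRoot 𝔨 𝔥 (m i) ξ) ∧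
    ∀ i j k, FlagManifold.structureConstant e i j k ≠ 0 ↔
      ∃ ξi ξj ξk,
        FlagManifold.IsAssociatedTRoot 𝔨 𝔥 (m i) ξi ∧
        FlagManifold.IsAssociatedTRoot 𝔨 𝔥 (m j) ξj ∧
        FlagManifold.IsAssociatedTRoot 𝔨 𝔥 (m k) ξk ∧
        FlagManifold.IsSymmetricTTriple 𝔨 𝔥 ξi ξj ξk := by
  subst h𝔨 h𝔥 hK
  exact (FlagManifold.isFlagPair_lieAlgebraOf hG hS hT hST).associatedTRoots hm he
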